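/- Let $G$ and $H$ be complex Lie groups and let $M$ be a complex manifold (of pure dimension $t$) with commuting holomorphic actions of $G$ and $H$, where $h\in H$ acts by $m\mapsto mh^{-1}$. Assume that the $H$-action is free and proper. Let $\mathfrak h$ be the Lie algebra of $H$, $q=\dim\mathfrak h$, and let $\chi_{\mathfrak h}:H\to\mathbb C^\times$ be the character of the representation $\wedge^q\mathfrak h$ induced by the adjoint representation, i.e. $\chi_{\mathfrak h}(h)=\det\mathrm{Ad}(h)$. For a holomorphic representation $V$ of $H$, $M\times_HV=(M\times V)/H$ carries the $G$-action $g[m,v]=[gm,v]$, and $L_\chi=M\times_H\mathbb C_\chi$ for a holomorphic character $\chi$ of $H$. For a $G\times H$-equivariant holomorphic vector bundle $F$ on $M$, $F/H$ is the quotient bundle on $M/H$ with $G$-action $g[f]=[gf]$. For $y\in\mathfrak h$ put $\xi_y(m)=\frac{d}{dt}\big|_{t=0}\,m\exp(ty)\in T_mM$. Then $X=M/H$, with the quotient topology, is a complex manifold (of dimension $t-q$ if $M\neq\emptyset$) such that $\pi:M\to X$ is a holomorphic submersion and $G$ acts holomorphically on $X$; the bundles $M\times_H\mathfrak h$, $(TM)/H$,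 $K_M/H$ and the $L_\chi$ that occur below are $G$-equivariant holomorphic vector bundles on $X$; and: 1. (Generalized Euler sequence) There is a $G$-equivariant exact sequence of holomorphic vector bundles on $X$ $$0\to M\times_H\mathfrak h\longrightarrow (TM)/H\longrightarrow TX\to 0,$$ given by $[m,y]\mapsto[\xi_y(m)]$ and $[v]\mapsto d\pi(v)$. 2. (Adjunction formula) $\chi_{\mathfrak h}$ is a holomorphic character, and there is a $G$-equivariant isomorphism of holomorphic line bundles $$K_M/H\otimes L_{\chi_{\mathfrak h}}\;\cong\;K_X .$$ More precisely, for every basis $b_1,\dots,b_q$ of $\mathfrak h$ there is such an isomorphism which sends $[\eta]\otimes[m,c]$ ($\eta\in (K_M)_m$, $c\in\mathbb C$) to the form $\theta\in (K_X)_{[m]}$ with $$\theta(d\pi v_1,\dots,d\pi v_{t-q})=c\,\eta(\xi_{b_1}(m),\dots,\xi_{b_q}(m),v_1,\dots,v_{t-q})\qquad(v_j\in T_mM).$$ 3. (Canonical bundle) Let $\omega_M$ be a nowhere vanishing holomorphic top form on $M$ and $\chi_M$ a holomorphic character of $H$ with $\Gamma_h\omega_M=\chi_M(h)\omega_M$ for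 all $h\in H$, where $\Gamma_k\omega=(k^{-1})^*\omega$ denotes the action on forms. Then there is an isomorphism of holomorphic line bundles $$\Psi:\;L_{\chi_M\chi_{\mathfrak h}}\;\cong\;K_X .$$ More precisely, for every basis $b_1,\dots,b_q$ of $\mathfrak h$ there is such an isomorphism which sends $[m,c]$ to the form $\theta\in(K_X)_{[m]}$ with $\theta(d\pi v_1,\dots,d\pi v_{t-q})=c\,\omega_M(\xi_{b_1}(m),\dots,\xi_{b_q}(m),v_1,\dots,v_{t-q})$. If $g\in G$ and $\Gamma_g\omega_M=\vartheta\,\omega_M$ with $\vartheta\in\mathbb C$, then $g\cdot\Psi(e)=\vartheta\,\Psi(g\cdot e)$ for all $e\in L_{\chi_M\chi_{\mathfrak h}}$; in particular $\Psi$ is $G$-equivariant if $\omega_M$ is $G$-invariant. -/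

import Mathlib

open Bundle Module MulAction
open scoped Manifold ContDiff TensorProduct

noncomputable section

/-! ### Holomorphic vector bundles -/

section Bundles

/-- The structure of a holomorphic vector bundle with model fibre `F` on a family `E` of complex
vector spaces over a complex manifold `B` modelled on `EB`: a topology on the total space together
with local trivializations that are fibrewise linear and have holomorphic transition functions. -/
structure HolomorphicBundle (EB : Type*) [NormedAddCommGroup EB] [NormedSpace ℂ EB]
    {B : Type*} [TopologicalSpace B] [ChartedSpace EB B]
    (F : Type*) [NormedAddCommGroup F] [NormedSpace ℂ F]
    (E : B → Type*) [∀ x, AddCommGroup (E x)] [∀ x, Module ℂ (E x)] where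
  totalTopology : TopologicalSpace (TotalSpace F E)
  fibreTopology : ∀ x, TopologicalSpace (E x)
  fibreBundle : FiberBundle F E
  vectorBundle : VectorBundle ℂ F E
  holomorphic : ContMDiffVectorBundle ω F E 𝓘(ℂ, EB)

variable {EB : Type*} [NormedAddCommGroup EB] [NormedSpace ℂ EB]
  {B : Type*} [TopologicalSpace B] [ChartedSpace EB B]
  {F : Type*} [NormedAddCommGroup F] [NormedSpace ℂ F]
  {E : B → Type*} [∀ x, AddCommGroup (E x)] [∀ x, Module ℂ (E x)]
  {EB' : Type*} [NormedAddCommGroup EB'] [NormedSpace ℂ EB']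
  {B' : Type*} [TopologicalSpace B'] [ChartedSpace EB' B']
  {F' : Type*} [NormedAddCommGroup F'] [NormedSpace ℂ F']
  {E' : B' → Type*} [∀ x, AddCommGroup (E' x)] [∀ x, Module ℂ (E' x)]

namespace HolomorphicBundle

/-- A map between the total spaces of two holomorphic vector bundles (possibly over different
bases) is holomorphic. -/
def HolomorphicMap (A : HolomorphicBundle EB F E) (A' : HolomorphicBundle EB' F' E')
    (f : TotalSpace F E → TotalSpace F' E') : Prop :=
  letI := A.totalTopology
  letI := A.fibreTopology
  letI := A.fibreBundle
  letI := A'.totalTopology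
  letI := A'.fibreTopology
  letI := A'.fibreBundle
  ContMDiff (𝓘(ℂ, EB).prod 𝓘(ℂ, F)) (𝓘(ℂ, EB').prod 𝓘(ℂ, F')) ω f

/-- A (global) section of a holomorphic vector bundle is holomorphic. -/
def HolomorphicSection (A : HolomorphicBundle EB F E) (s : ∀ x, E x) : Prop :=
  letI := A.totalTopology
  letI := A.fibreTopology
  letI := A.fibreBundle
  ContMDiff 𝓘(ℂ, EB) (𝓘(ℂ, EB).prod 𝓘(ℂ, F)) ω (fun x ↦ (⟨x, s x⟩ : TotalSpace F E))

/-- A family of linear maps between the fibres of two holomorphic vector bundles over the same base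
is a morphism of holomorphic vector bundles. -/
def IsMorphism {E' : B → Type*} [∀ x, AddCommGroup (E' x)] [∀ x, Module ℂ (E' x)]
    (A : HolomorphicBundle EB F E) (A' : HolomorphicBundle EB F' E')
    (φ : ∀ x, E x →ₗ[ℂ] E' x) : Prop :=
  A.HolomorphicMap A' (fun e ↦ ⟨e.proj, φ e.proj e.snd⟩)

/-- A family of linear equivalences between the fibres of two holomorphic vector bundles over the
same base is an isomorphism of holomorphic vector bundles. -/
def IsIso {E' : B → Type*} [∀ x, AddCommGroup (E' x)] [∀ x, Module ℂ (E' x)]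
    (A : HolomorphicBundle EB F E) (A' : HolomorphicBundle EB F' E')
    (φ : ∀ x, E x ≃ₗ[ℂ] E' x) : Prop :=
  A.IsMorphism A' (fun x ↦ (φ x).toLinearMap) ∧ A'.IsMorphism A (fun x ↦ (φ x).symm.toLinearMap)

end HolomorphicBundle

/-- The product bundle `B × V`. -/
def productBundle (EB : Type*) [NormedAddCommGroup EB] [NormedSpace ℂ EB]
    (B : Type*) [TopologicalSpace B] [ChartedSpace EB B]
    (V : Type*) [NormedAddCommGroup V] [NormedSpace ℂ V] :
    HolomorphicBundle EB V (Bundle.Trivial B V) where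
  totalTopology := inferInstance
  fibreTopology := inferInstance
  fibreBundle := inferInstance
  vectorBundle := inferInstance
  holomorphic := inferInstance

/-- The holomorphic tangent bundle `TB`. -/
def tangentBundle (EB : Type*) [NormedAddCommGroup EB] [NormedSpace ℂ EB]
    (B : Type*) [TopologicalSpace B] [ChartedSpace EB B] [IsManifold 𝓘(ℂ, EB) ω B] :
    HolomorphicBundle EB EB (fun x : B ↦ TangentSpace 𝓘(ℂ, EB) x) where
  totalTopology := inferInstance
  fibreTopology := inferInstance
  fibreBundle := inferInstance
  vectorBundle := inferInstance
  holomorphic := TangentBundle.contMDiffVectorBundle (n := ω)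

/-- The fibre of the canonical bundle `K_B = ∧^top T^*B` at `x`: alternating `ℂ`-multilinear forms
of top degree on the tangent space. -/
abbrev CanonicalFibre (EB : Type*) [NormedAddCommGroup EB] [NormedSpace ℂ EB]
    {B : Type*} [TopologicalSpace B] [ChartedSpace EB B] (x : B) : Type _ :=
  TangentSpace 𝓘(ℂ, EB) x [⋀^Fin (finrank ℂ EB)]→L[ℂ] ℂ

theorem contDiff_compContinuousLinearMapCLM {E : Type*} [NormedAddCommGroup E] [NormedSpace ℂ E]
    [FiniteDimensional ℂ E] {ι : Type*} [Fintype ι] :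
    ContDiff ℂ ω (ContinuousAlternatingMap.compContinuousLinearMapCLM :
      (E →L[ℂ] E) → (E [⋀^ι]→L[ℂ] ℂ) →L[ℂ] (E [⋀^ι]→L[ℂ] ℂ)) := by
  have : FiniteDimensional ℂ (ContinuousMultilinearMap ℂ (fun _ : ι ↦ E) ℂ) :=
    FiniteDimensional.of_injective
      (ContinuousMultilinearMap.toMultilinearMapLinear :
        ContinuousMultilinearMap ℂ (fun _ : ι ↦ E) ℂ →ₗ[ℂ] MultilinearMap ℂ (fun _ : ι ↦ E) ℂ)
      ContinuousMultilinearMap.toMultilinearMap_injective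
  obtain ⟨r, hr⟩ := LinearMap.exists_leftInverse_of_injective
    (ContinuousAlternatingMap.toContinuousMultilinearMapCLM ℂ :
      (E [⋀^ι]→L[ℂ] ℂ) →L[ℂ] _).toLinearMap
    (LinearMap.ker_eq_bot.2 ContinuousAlternatingMap.toContinuousMultilinearMap_injective)
  have key : (ContinuousAlternatingMap.compContinuousLinearMapCLM :
      (E →L[ℂ] E) → (E [⋀^ι]→L[ℂ] ℂ) →L[ℂ] (E [⋀^ι]→L[ℂ] ℂ)) = fun f ↦
      (LinearMap.toContinuousLinearMap r).comp
        ((ContinuousMultilinearMap.compContinuousLinearMapContinuousMultilinear ℂ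
          (fun _ : ι ↦ E) (fun _ ↦ E) ℂ (fun _ ↦ f)).comp
          (ContinuousAlternatingMap.toContinuousMultilinearMapCLM ℂ)) := by
    funext f
    ext1 g
    exact (LinearMap.congr_fun hr (g.compContinuousLinearMap f)).symm
  rw [key]
  refine contDiff_const.clm_comp (ContDiff.clm_comp ?_ contDiff_const)
  exact (ContinuousMultilinearMap.contDiff _).comp (contDiff_pi.2 fun _ ↦ contDiff_id)

/-- The canonical bundle `K_B`. -/
def canonicalBundle (EB : Type*) [NormedAddCommGroup EB] [NormedSpace ℂ EB] [FiniteDimensional ℂ EB]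
    (B : Type*) [TopologicalSpace B] [ChartedSpace EB B] [IsManifold 𝓘(ℂ, EB) ω B] :
    HolomorphicBundle EB (EB [⋀^Fin (finrank ℂ EB)]→L[ℂ] ℂ)
      (fun x : B ↦ CanonicalFibre EB x) where
  totalTopology := ContinuousAlternatingMap.instTopologicalSpaceTotalSpace
    (E₁ := fun x : B ↦ TangentSpace 𝓘(ℂ, EB) x) (E₂ := Bundle.Trivial B ℂ)
  fibreTopology := inferInstance
  fibreBundle := ContinuousAlternatingMap.instFiberBundle
    (E₁ := fun x : B ↦ TangentSpace 𝓘(ℂ, EB) x) (E₂ := Bundle.Trivial B ℂ)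
  vectorBundle := ContinuousAlternatingMap.instVectorBundle
    (E₁ := fun x : B ↦ TangentSpace 𝓘(ℂ, EB) x) (E₂ := Bundle.Trivial B ℂ)
  holomorphic := by
    have : ContMDiffVectorBundle ω EB (fun x : B ↦ TangentSpace 𝓘(ℂ, EB) x) 𝓘(ℂ, EB) :=
      TangentBundle.contMDiffVectorBundle (n := ω)
    have : (ContinuousAlternatingMap.vectorPrebundle ℂ (Fin (finrank ℂ EB)) EB
        (fun x : B ↦ TangentSpace 𝓘(ℂ, EB) x) ℂ (Bundle.Trivial B ℂ)).IsContMDiff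
          𝓘(ℂ, EB) ω :=
      { exists_contMDiffCoordChange := by
          rintro _ ⟨e₁, e₂, he₁, he₂, rfl⟩ _ ⟨e₁', e₂', he₁', he₂', rfl⟩
          refine ⟨Pretrivialization.continuousAlternatingMapCoordChange ℂ _ e₁ e₁' e₂ e₂', ?_,
            Pretrivialization.continuousAlternatingMapCoordChange_apply⟩
          have h₁ := contMDiffOn_coordChangeL (IB := 𝓘(ℂ, EB)) (n := ω) e₁' e₁
          have h₂ := contMDiffOn_coordChangeL (IB := 𝓘(ℂ, EB)) (n := ω) e₂ e₂'
          have h₃ : ContMDiff 𝓘(ℂ, ℂ →L[ℂ] ℂ) 𝓘(ℂ, (EB [⋀^Fin (finrank ℂ EB)]→L[ℂ] ℂ) →L[ℂ]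
              (EB [⋀^Fin (finrank ℂ EB)]→L[ℂ] ℂ)) ω
              (ContinuousLinearMap.compContinuousAlternatingMapCLM ℂ EB ℂ ℂ
                (Fin (finrank ℂ EB))) :=
            (ContinuousLinearMap.contDiff _).contMDiff
          refine ContMDiffOn.clm_comp
            (g := fun b ↦ ContinuousLinearMap.compContinuousAlternatingMapCLM ℂ EB ℂ ℂ
                (Fin (finrank ℂ EB)) (e₂.coordChangeL ℂ e₂' b : ℂ →L[ℂ] ℂ))
            (f := fun b ↦ ContinuousAlternatingMap.compContinuousLinearMapCLM
              (e₁'.coordChangeL ℂ e₁ b : EB →L[ℂ] EB)) ?_ ?_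
          · exact h₃.comp_contMDiffOn (h₂.mono fun b hb ↦ ⟨hb.1.2, hb.2.2⟩)
          · exact contDiff_compContinuousLinearMapCLM.contMDiff.comp_contMDiffOn
              (h₁.mono fun b hb ↦ ⟨hb.2.1, hb.1.1⟩) }
    exact (ContinuousAlternatingMap.vectorPrebundle ℂ (Fin (finrank ℂ EB)) EB
        (fun x : B ↦ TangentSpace 𝓘(ℂ, EB) x) ℂ (Bundle.Trivial B ℂ)).contMDiffVectorBundle
          𝓘(ℂ, EB)

end Bundles

/-! ### Group actions -/

section Actions

/-- A lift of the action of `K` on `B` to the family `E` over `B`: for every `k` and `x`, a linear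
map `E x → E (k x)`. -/
abbrev FibreAction (K : Type*) {B : Type*} [SMul K B] (E : B → Type*)
    [∀ x, AddCommGroup (E x)] [∀ x, Module ℂ (E x)] : Type _ :=
  ∀ (k : K) (x : B), E x →ₗ[ℂ] E (k • x)

/-- A family of linear maps over the identity of `B` is `K`-equivariant. -/
def IsEquivariant {K B : Type*} [SMul K B] {E E' : B → Type*}
    [∀ x, AddCommGroup (E x)] [∀ x, Module ℂ (E x)]
    [∀ x, AddCommGroup (E' x)] [∀ x, Module ℂ (E' x)]
    (a : FibreAction K E) (a' : FibreAction K E') (φ : ∀ x, E x →ₗ[ℂ] E' x) : Prop :=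
  ∀ (k : K) (x : B) (e : E x), φ (k • x) (a k x e) = a' k x (φ x e)

/-- The action of `K` on `B × V` given by `k (x, v) = (k x, ρ(k) v)`. -/
def repAction {K : Type*} [Monoid K] (B : Type*) [SMul K B] {V : Type*} [AddCommGroup V]
    [Module ℂ V] (ρ : Representation ℂ K V) : FibreAction K (Bundle.Trivial B V) :=
  fun k _ ↦ ρ k

/-- The one-dimensional representation `ℂ_χ` of a character `χ`. -/
def characterRep {K : Type*} [Group K] (χ : K →* ℂˣ) : Representation ℂ K ℂ where
  toFun k := (χ k : ℂ) • LinearMap.id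
  map_one' := by simp [Module.End.one_eq_id]
  map_mul' k l := by ext; simp [mul_comm]

section Manifold

variable {K B EB : Type*} [SMul K B] [NormedAddCommGroup EB] [NormedSpace ℂ EB]
  [TopologicalSpace B] [ChartedSpace EB B]

/-- The action of `K` on `TB` by the differentials `dk : T_x B → T_{kx} B`. -/
def tangentAction (K B EB : Type*) [SMul K B] [NormedAddCommGroup EB] [NormedSpace ℂ EB]
    [TopologicalSpace B] [ChartedSpace EB B] :
    FibreAction K (fun x : B ↦ TangentSpace 𝓘(ℂ, EB) x) :=
  fun k x ↦ (mfderiv 𝓘(ℂ, EB) 𝓘(ℂ, EB) (fun y : B ↦ k • y) x).toLinearMap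

/-- The action of `K` on `K_B` by the inverse transposes of the differentials: `η ∈ (K_B)_x` is sent
to `(w₁, …, wₙ) ↦ η(dk⁻¹ w₁, …, dk⁻¹ wₙ)` in `(K_B)_{kx}`. -/
def canonicalAction (K B EB : Type*) [SMul K B] [NormedAddCommGroup EB] [NormedSpace ℂ EB]
    [TopologicalSpace B] [ChartedSpace EB B] :
    FibreAction K (fun x : B ↦ CanonicalFibre EB x) :=
  fun k x ↦ ContinuousAlternatingMap.compContinuousLinearMapₗ
    (mfderiv 𝓘(ℂ, EB) 𝓘(ℂ, EB) (fun y : B ↦ k • y) x).inverse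

end Manifold

end Actions

/-! ### The adjoint representation -/

section Adjoint

variable (EH H : Type*) [NormedAddCommGroup EH] [NormedSpace ℂ EH] [TopologicalSpace H]
  [ChartedSpace EH H] [Group H] [LieGroup 𝓘(ℂ, EH) ω H]

/-- The adjoint representation of `H` on its Lie algebra `𝔥 = T₁H`: `Ad(h)` is the differential at
`1` of the conjugation `k ↦ h k h⁻¹`. (The tangent space `GroupLieAlgebra 𝓘(ℂ, EH) H` at `1` is by
definition a copy of the model space `EH`.) -/
def adjointRep : Representation ℂ H EH where
  toFun h :=
    { toFun := fun x ↦ mfderiv 𝓘(ℂ, EH) 𝓘(ℂ, EH) (fun k : H ↦ h * k * h⁻¹) 1 x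
      map_add' := fun x y ↦ map_add _ _ _
      map_smul' := fun c x ↦ map_smul _ _ _ }
  map_one' := by
    ext x
    have h₁ : (fun k : H ↦ 1 * k * 1⁻¹) = id := by funext k; simp
    change mfderiv 𝓘(ℂ, EH) 𝓘(ℂ, EH) (fun k : H ↦ 1 * k * 1⁻¹) 1 x = x
    rw [h₁, mfderiv_id]
    rfl
  map_mul' g h := by
    ext x
    have hd : ∀ (g k : H), MDifferentiableAt 𝓘(ℂ, EH) 𝓘(ℂ, EH) (fun k : H ↦ g * k * g⁻¹) k :=
      fun g k ↦ ((((contMDiff_mul_right (I := 𝓘(ℂ, EH)) (n := ω) (a := g⁻¹)).comp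
        (contMDiff_mul_left (I := 𝓘(ℂ, EH)) (n := ω) (a := g))).mdifferentiable (by simp)) k)
    have h₁ : (fun k : H ↦ (g * h) * k * (g * h)⁻¹) =
        (fun k : H ↦ g * k * g⁻¹) ∘ fun k : H ↦ h * k * h⁻¹ := by
      funext k; simp [mul_assoc]
    have h₂ := mfderiv_comp (1 : H) (hd g (h * 1 * h⁻¹)) (hd h 1)
    rw [← h₁] at h₂
    have h₃ : h * 1 * h⁻¹ = 1 := by simp
    have h₄ : ∀ k : H, k = 1 → ∀ y : EH,
        (mfderiv 𝓘(ℂ, EH) 𝓘(ℂ, EH) (fun k : H ↦ g * k * g⁻¹) k : EH → EH) y =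
          (mfderiv 𝓘(ℂ, EH) 𝓘(ℂ, EH) (fun k : H ↦ g * k * g⁻¹) 1 : EH → EH) y := by
      rintro k rfl y; rfl
    exact (DFunLike.congr_fun h₂ x).trans (h₄ _ h₃ _)

/-- The character `χ_𝔥` of the one-dimensional representation `∧^q 𝔥` (`q = dim 𝔥`) induced by the
adjoint representation: `χ_𝔥(h) = det Ad(h)`. -/
def adjointCharacter : H →* ℂˣ :=
  (LinearMap.det.comp (adjointRep EH H)).toHomUnits

/-- `H` acts on the top exterior power of `𝔥` through `χ_𝔥`. -/
theorem exteriorPower_map_adjointRep [FiniteDimensional ℂ EH] (h : H)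
    (τ : ⋀[ℂ]^(finrank ℂ EH) EH) :
    exteriorPower.map (finrank ℂ EH) (adjointRep EH H h) τ =
      (adjointCharacter EH H h : ℂ) • τ := by
  have key : exteriorPower.map (finrank ℂ EH) (adjointRep EH H h) =
      (adjointCharacter EH H h : ℂ) • LinearMap.id := by
    refine exteriorPower.linearMap_ext ?_
    ext v : 1
    rw [← sub_eq_zero, ← Module.forall_dual_apply_eq_zero_iff ℂ]
    intro ℓ
    have hℓ := (ℓ.compAlternatingMap (exteriorPower.ιMulti ℂ (finrank ℂ EH))).eq_smul_basis_det
      (finBasis ℂ EH)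
    have h₁ := DFunLike.congr_fun hℓ (adjointRep EH H h ∘ v)
    have h₂ := DFunLike.congr_fun hℓ v
    simp only [LinearMap.compAlternatingMap_apply, AlternatingMap.smul_apply, smul_eq_mul,
      Basis.det_comp] at h₁ h₂
    have h₃ : (adjointCharacter EH H h : ℂ) = LinearMap.det (adjointRep EH H h) := rfl
    simp only [LinearMap.compAlternatingMap_apply, exteriorPower.map_apply_ιMulti, map_sub,
      LinearMap.smul_apply, LinearMap.id_apply, map_smul, smul_eq_mul, h₁, h₂, h₃]
    ring
  rw [key]; rfl

end Adjoint

/-! ### Quotients by a group action -/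

section Quotient

/-- The projection `π : M → M/H`, `m ↦ [m]`, onto the orbit space. -/
abbrev orbitProj (H M : Type*) [Group H] [MulAction H M] (m : M) : orbitRel.Quotient H M :=
  Quotient.mk (orbitRel H M) m

theorem orbitProj_smul {H M : Type*} [Group H] [MulAction H M] (h : H) (m : M) :
    orbitProj H M (h • m) = orbitProj H M m :=
  orbitRel.Quotient.quotient_smul_eq

/-- The action of `G` on `M/H`, `g [m] = [g m]`, for a `G`-action on `M` commuting with the
`H`-action. -/
instance orbitSpaceAction (G H M : Type*) [Group G] [Group H] [MulAction G M] [MulAction H M]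
    [SMulCommClass G H M] : MulAction G (orbitRel.Quotient H M) where
  smul g := Quotient.map (g • ·) (by
    rintro _ m ⟨h, rfl⟩
    exact ⟨h, (smul_comm g h m).symm⟩)
  one_smul x := by
    induction x using Quotient.inductionOn with | _ m => exact congrArg _ (one_smul G m)
  mul_smul g g' x := by
    induction x using Quotient.inductionOn with | _ m => exact congrArg _ (mul_smul g g' m)

/-- The fibre `(F/H)_x = (⋃_{[m] = x} F_m)/H` of the quotient of an `H`-equivariant bundle `F`.
As `H` acts freely on `M`, an `H`-orbit in `⋃_{[m] = x} F_m` contains exactly one vector over every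
point `m` of the `H`-orbit `x`; it is recorded as the family `s` of these vectors, which is subject
to the condition `s(h m) = h s(m)`. The vector space operations are those of the `F_m`. -/
def quotientFibre {H M : Type*} [Group H] [MulAction H M] {F : M → Type*}
    [∀ m, AddCommGroup (F m)] [∀ m, Module ℂ (F m)] (a : FibreAction H F)
    (x : orbitRel.Quotient H M) : Submodule ℂ (∀ m : {m : M // orbitProj H M m = x}, F m) where
  carrier := {s | ∀ (h : H) (m : {m : M // orbitProj H M m = x}),
    s ⟨h • m.1, (orbitProj_smul h m.1).trans m.2⟩ = a h m.1 (s m)}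
  zero_mem' := by intro h m; simp
  add_mem' := by
    intro s t hs ht h m
    simp only [Pi.add_apply, map_add]
    rw [hs h m, ht h m]
  smul_mem' := by
    intro c s hs h m
    simp only [Pi.smul_apply, map_smul]
    rw [hs h m]

variable (EX EG : Type*) [NormedAddCommGroup EX] [NormedSpace ℂ EX]
  [NormedAddCommGroup EG] [NormedSpace ℂ EG]
  {EH : Type*} [NormedAddCommGroup EH] [NormedSpace ℂ EH]
  {EM : Type*} [NormedAddCommGroup EM] [NormedSpace ℂ EM]
  {G : Type*} [Group G] [TopologicalSpace G] [ChartedSpace EG G]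
  {H : Type*} [Group H] [TopologicalSpace H] [ChartedSpace EH H]
  {M : Type*} [TopologicalSpace M] [ChartedSpace EM M]
  [MulAction G M] [MulAction H M] [SMulCommClass G H M]
  [ChartedSpace EX (orbitRel.Quotient H M)]

/-- A complex structure on the orbit space `X = M/H` (with the quotient topology) makes it the
quotient complex manifold of `M` by `H`, with a holomorphic `G`-action: the projection `M → X` is a
holomorphic submersion (which determines the complex structure of `X`). -/
structure IsQuotientManifold (EX EG EM G H M : Type*)
    [NormedAddCommGroup EX] [NormedSpace ℂ EX] [NormedAddCommGroup EG] [NormedSpace ℂ EG]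
    [NormedAddCommGroup EM] [NormedSpace ℂ EM]
    [Group G] [TopologicalSpace G] [ChartedSpace EG G] [Group H]
    [TopologicalSpace M] [ChartedSpace EM M] [MulAction G M] [MulAction H M] [SMulCommClass G H M]
    [ChartedSpace EX (orbitRel.Quotient H M)] : Prop where
  isManifold : IsManifold 𝓘(ℂ, EX) ω (orbitRel.Quotient H M)
  t2Space : T2Space (orbitRel.Quotient H M)
  holomorphic_proj : ContMDiff 𝓘(ℂ, EM) 𝓘(ℂ, EX) ω (orbitProj H M)
  submersion : ∀ m : M, Function.Surjective (mfderiv 𝓘(ℂ, EM) 𝓘(ℂ, EX) (orbitProj H M) m)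
  holomorphic_smul : ContMDiffSMul 𝓘(ℂ, EG) 𝓘(ℂ, EX) ω G (orbitRel.Quotient H M)

/-- The quotient `F/H` of a `G × H`-equivariant holomorphic vector bundle `F` on `M`, as a
`G`-equivariant holomorphic vector bundle on `X = M/H`. The fibres are `quotientFibre aH`; `quotMap` is
the quotient map `F → F/H`, `f ↦ [f]`, which is a linear isomorphism on fibres and is holomorphic
(this determines the holomorphic structure of `F/H`); `G` acts holomorphically by `g [f] = [g f]`. -/
structure QuotientBundle {F₀ : Type*} [NormedAddCommGroup F₀] [NormedSpace ℂ F₀] {F : M → Type*}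
    [∀ m, AddCommGroup (F m)] [∀ m, Module ℂ (F m)] (A : HolomorphicBundle EM F₀ F)
    (aG : FibreAction G F) (aH : FibreAction H F) where
  bundle : HolomorphicBundle EX F₀ (fun x : orbitRel.Quotient H M ↦ quotientFibre aH x)
  quotMap : ∀ m : M, F m ≃ₗ[ℂ] quotientFibre aH (orbitProj H M m)
  quotMap_apply : ∀ (m : M) (f : F m), (quotMap m f).1 ⟨m, rfl⟩ = f
  holomorphic_quotMap : A.HolomorphicMap bundle
    (fun f ↦ ⟨orbitProj H M f.proj, quotMap f.proj f.snd⟩)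
  action : FibreAction G (fun x : orbitRel.Quotient H M ↦ quotientFibre aH x)
  action_quotMap : ∀ (g : G) (m : M) (f : F m),
    action g (orbitProj H M m) (quotMap m f) = quotMap (g • m) (aG g m f)
  holomorphic_action :
    letI := bundle.totalTopology
    letI := bundle.fibreTopology
    letI := bundle.fibreBundle
    ContMDiff (𝓘(ℂ, EG).prod (𝓘(ℂ, EX).prod 𝓘(ℂ, F₀))) (𝓘(ℂ, EX).prod 𝓘(ℂ, F₀)) ω
      (fun p : G × TotalSpace F₀ (fun x : orbitRel.Quotient H M ↦ quotientFibre aH x) ↦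
        (⟨p.1 • p.2.proj, action p.1 p.2.proj p.2.snd⟩ :
          TotalSpace F₀ (fun x : orbitRel.Quotient H M ↦ quotientFibre aH x)))

end Quotient

section Tensor

/-- The tensor product `L ⊗ L'` of two holomorphic line bundles, with fibres `L_x ⊗ L'_x`: the
holomorphic structure is the one for which the map `(l, l') ↦ l ⊗ l'` on the fibre product of `L` and
`L'` is holomorphic (this determines it). -/
structure LineTensorBundle {EB : Type*} [NormedAddCommGroup EB] [NormedSpace ℂ EB]
    {B : Type*} [TopologicalSpace B] [ChartedSpace EB B]
    {F F' : Type*} [NormedAddCommGroup F] [NormedSpace ℂ F] [NormedAddCommGroup F']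
    [NormedSpace ℂ F'] {L L' : B → Type*} [∀ x, AddCommGroup (L x)] [∀ x, Module ℂ (L x)]
    [∀ x, AddCommGroup (L' x)] [∀ x, Module ℂ (L' x)]
    (A : HolomorphicBundle EB F L) (A' : HolomorphicBundle EB F' L') where
  bundle : HolomorphicBundle EB ℂ (fun x ↦ L x ⊗[ℂ] L' x)
  holomorphic_tmul :
    letI := A.totalTopology
    letI := A.fibreTopology
    letI := A.fibreBundle
    letI := A'.totalTopology
    letI := A'.fibreTopology
    letI := A'.fibreBundle
    letI := bundle.totalTopology
    letI := bundle.fibreTopology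
    letI := bundle.fibreBundle
    ContMDiff (𝓘(ℂ, EB).prod 𝓘(ℂ, F × F')) (𝓘(ℂ, EB).prod 𝓘(ℂ, ℂ)) ω
      (fun p : TotalSpace (F × F') (L ×ᵇ L') ↦
        (⟨p.proj, p.snd.1 ⊗ₜ[ℂ] p.snd.2⟩ : TotalSpace ℂ (fun x ↦ L x ⊗[ℂ] L' x)))

/-- The action `k (l ⊗ l') = k l ⊗ k l'` on a tensor product. -/
def tensorAction {K B : Type*} [SMul K B] {L L' : B → Type*}
    [∀ x, AddCommGroup (L x)] [∀ x, Module ℂ (L x)]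
    [∀ x, AddCommGroup (L' x)] [∀ x, Module ℂ (L' x)]
    (a : FibreAction K L) (a' : FibreAction K L') : FibreAction K (fun x ↦ L x ⊗[ℂ] L' x) :=
  fun k x ↦ TensorProduct.map (a k x) (a' k x)

end Tensor

section Contraction

/-- The vector field `ξ_y` on `M` generated by `y ∈ 𝔥`. In terms of the right action
`m h = h⁻¹ • m`, its value at `m` is `d/dt|₀ m exp(ty)`, that is, the image of `y` under the
differential at `1` of `h ↦ h⁻¹ • m`. -/
def fundamentalField (EH EM H : Type*) {M : Type*} [NormedAddCommGroup EH] [NormedSpace ℂ EH]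
    [NormedAddCommGroup EM] [NormedSpace ℂ EM] [Group H] [TopologicalSpace H] [ChartedSpace EH H]
    [TopologicalSpace M] [ChartedSpace EM M] [MulAction H M] (y : EH) (m : M) :
    TangentSpace 𝓘(ℂ, EM) m :=
  mfderiv 𝓘(ℂ, EH) 𝓘(ℂ, EM) (fun h : H ↦ h⁻¹ • m) 1 y

/-- For a basis `b = (b₁, …, b_q)` of `𝔥`, the top form `θ` on `T_[m] X`, `X = M/H`, is induced by the
top form `η` on `T_m M`: `dim H + dim X = dim M`, and for all `v₁, …, v_d ∈ T_m M`,
`θ(dπ v₁, …, dπ v_d) = η(ξ_{b₁}(m), …, ξ_{b_q}(m), v₁, …, v_d)`. -/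
def IsInducedForm {EH EM EX H M : Type*} [NormedAddCommGroup EH] [NormedSpace ℂ EH]
    [NormedAddCommGroup EM] [NormedSpace ℂ EM] [NormedAddCommGroup EX] [NormedSpace ℂ EX]
    [Group H] [TopologicalSpace H] [ChartedSpace EH H]
    [TopologicalSpace M] [ChartedSpace EM M] [MulAction H M] [ChartedSpace EX (orbitRel.Quotient H M)]
    (b : Basis (Fin (finrank ℂ EH)) ℂ EH) (m : M) (η : CanonicalFibre EM m)
    (θ : CanonicalFibre EX (orbitProj H M m)) : Prop :=
  ∃ hdim : finrank ℂ EM = finrank ℂ EH + finrank ℂ EX,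
    ∀ v : Fin (finrank ℂ EX) → TangentSpace 𝓘(ℂ, EM) m,
      θ (fun j ↦ mfderiv 𝓘(ℂ, EM) 𝓘(ℂ, EX) (orbitProj H M) m (v j)) =
        η (fun i ↦ Fin.append (fun j ↦ fundamentalField EH EM H (b j) m) v (Fin.cast hdim i))

end Contraction

/-- The model space `ℂ^d`, `d = dim M - dim H`, of the quotient manifold `M/H`. -/
abbrev QuotientModel (EM EH : Type*) [NormedAddCommGroup EM] [NormedSpace ℂ EM]
    [NormedAddCommGroup EH] [NormedSpace ℂ EH] : Type :=
  EuclideanSpace ℂ (Fin (finrank ℂ EM - finrank ℂ EH))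

end

/-!
The theorem rests on two facts about a free proper holomorphic action of `H` on `M`.

*Slices.* A free action is infinitesimally free: if `ξ_y(m) = 0`, then the orbit map through `m` is
constant along an integral curve of an invariant vector field on `H`, which contradicts injectivity
unless `y = 0` (`eq_zero_of_fderiv_orbit_eq_zero`, `injective_fundamentalField`). By the inverse
function theorem, acting on a complement of the tangent space of the orbit gives coordinates on `M`
near `m` (`exists_local_slice`). Properness makes a small slice meet every orbit at most once, so
that slices are charts of `X = M/H` (`exists_sliceChart`, `exists_complexStructure`). They come with
holomorphic local sections `σ` of `π : M → X`, and with holomorphic maps to `H` that compare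
a point `m` with `σ(π m)` (`LocalSection`).

*Descent.* A fibre of `F/H` consists of the equivariant families of vectors along an orbit, and as
the action is free it is identified with `F_m` by evaluation at a point `m` of the orbit. Evaluation
along local sections of `π` gives the local coordinates of `F/H`; two of them differ by the action
of a holomorphic map to `H`, hence holomorphically (`quotientAtlas`). So holomorphy of families in
`F/H` means holomorphy of their values along lifts to `M` (`holoAt_quotientAtlas_iff`), and all maps
of bundles below are checked on values. Holomorphy of bundle maps is tested on local frames
(`isMorphism_of_frame`), and the inverse of a holomorphic bijective morphism is holomorphic
(`isIso_of_isMorphism`).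

At a point `m` of the orbit, the Euler sequence is `0 → 𝔥 → T_m M → T_[m] X → 0`; it is exact by the
injectivity of `y ↦ ξ_y(m)` and a count of dimensions (`ker_mfderiv_proj`), and equivariant because
`ξ_{Ad(h) y}(h m) = dh ξ_y(m)` (`fundamentalField_adjointRep`). In a basis of `T_m M` adapted to the
sequence, `det(ξ_{y₁}, …, ξ_{y_q}, v₁, …) = det(y) det(dπ v)` (`exists_basis_det_append`). Hence the
contraction of a top form with `ξ_{b₁}(m), …, ξ_{b_q}(m)` is a top form on `T_[m] X`, and this is an
isomorphism of lines (`exists_contraction`). If `m` is replaced by `h m`, the contraction changes by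
`det Ad(h⁻¹)`, and the factor `χ_𝔥` of the adjunction formula compensates this
(`IsInducedForm.smul_canonicalAction`). The description of `K_X` by a semi-invariant form `ω_M` is
the same contraction applied to the forms `c ω_M(m)`.
-/

noncomputable section

open Set Filter Topology

/-! ### Local frames and holomorphic maps into total spaces -/

section LocalFrames

variable {EB : Type*} [NormedAddCommGroup EB] [NormedSpace ℂ EB]
  {B : Type*} [TopologicalSpace B] [ChartedSpace EB B]
  {F : Type*} [NormedAddCommGroup F] [NormedSpace ℂ F]
  {E : B → Type*} [∀ x, AddCommGroup (E x)] [∀ x, Module ℂ (E x)]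
  {EB' : Type*} [NormedAddCommGroup EB'] [NormedSpace ℂ EB']
  {B' : Type*} [TopologicalSpace B'] [ChartedSpace EB' B']
  {F' : Type*} [NormedAddCommGroup F'] [NormedSpace ℂ F']
  {E' : B' → Type*} [∀ x, AddCommGroup (E' x)] [∀ x, Module ℂ (E' x)]
  {EN : Type*} [NormedAddCommGroup EN] [NormedSpace ℂ EN] {HN : Type*} [TopologicalSpace HN]
  {I : ModelWithCorners ℂ EN HN} {N : Type*} [TopologicalSpace N] [ChartedSpace HN N]
  {EN' : Type*} [NormedAddCommGroup EN'] [NormedSpace ℂ EN'] {HN' : Type*} [TopologicalSpace HN']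
  {I' : ModelWithCorners ℂ EN' HN'} {N' : Type*} [TopologicalSpace N'] [ChartedSpace HN' N']

namespace HolomorphicBundle

variable (A : HolomorphicBundle EB F E) (A' : HolomorphicBundle EB' F' E')

/-- The domain of the preferred local trivialization of `A` at `x₀`. -/
def dom (x₀ : B) : Set B :=
  letI := A.totalTopology
  letI := A.fibreTopology
  letI := A.fibreBundle
  (trivializationAt F E x₀).baseSet

/-- The fibre coordinate of the preferred local trivialization of `A` at `x₀`
(zero outside of `A.dom x₀`). -/
def coord (x₀ x : B) : E x →ₗ[ℂ] F :=
  letI := A.totalTopology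
  letI := A.fibreTopology
  letI := A.fibreBundle
  letI := A.vectorBundle
  (trivializationAt F E x₀).linearMapAt ℂ x

/-- The inverse of `A.coord x₀ x` (zero outside of `A.dom x₀`). -/
def frame (x₀ x : B) : F →ₗ[ℂ] E x :=
  letI := A.totalTopology
  letI := A.fibreTopology
  letI := A.fibreBundle
  letI := A.vectorBundle
  (trivializationAt F E x₀).symmₗ ℂ x

/-- A map into the total space of a holomorphic vector bundle is holomorphic at a point. -/
def HoloAt (I : ModelWithCorners ℂ EN HN) (f : N → TotalSpace F E) (n : N) : Prop :=
  letI := A.totalTopology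
  letI := A.fibreTopology
  letI := A.fibreBundle
  ContMDiffAt I (𝓘(ℂ, EB).prod 𝓘(ℂ, F)) ω f n

theorem isOpen_dom (x₀ : B) : IsOpen (A.dom x₀) :=
  letI := A.totalTopology
  letI := A.fibreTopology
  letI := A.fibreBundle
  (trivializationAt F E x₀).open_baseSet

theorem mem_dom (x₀ : B) : x₀ ∈ A.dom x₀ :=
  letI := A.totalTopology
  letI := A.fibreTopology
  letI := A.fibreBundle
  mem_baseSet_trivializationAt F E x₀

variable {A A'}

theorem coord_frame {x₀ x : B} (hx : x ∈ A.dom x₀) (v : F) :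
    A.coord x₀ x (A.frame x₀ x v) = v :=
  letI := A.totalTopology
  letI := A.fibreTopology
  letI := A.fibreBundle
  letI := A.vectorBundle
  (trivializationAt F E x₀).linearMapAt_symmₗ hx v

theorem frame_coord {x₀ x : B} (hx : x ∈ A.dom x₀) (e : E x) :
    A.frame x₀ x (A.coord x₀ x e) = e :=
  letI := A.totalTopology
  letI := A.fibreTopology
  letI := A.fibreBundle
  letI := A.vectorBundle
  (trivializationAt F E x₀).symmₗ_linearMapAt hx e

theorem holoAt_iff {f : N → TotalSpace F E} {n : N} {x₀ : B} (hx : (f n).proj ∈ A.dom x₀) :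
    A.HoloAt I f n ↔ ContMDiffAt I 𝓘(ℂ, EB) ω (fun y ↦ (f y).proj) n ∧
      ContMDiffAt I 𝓘(ℂ, F) ω (fun y ↦ A.coord x₀ (f y).proj (f y).snd) n := by
  let := A.totalTopology
  let := A.fibreTopology
  let := A.fibreBundle
  let := A.vectorBundle
  let := A.holomorphic
  have h := Trivialization.contMDiffAt_iff (n := ω) (IB := 𝓘(ℂ, EB)) (IM := I)
    (e := trivializationAt F E x₀) (f := f) (x₀ := n) ((Trivialization.mem_source _).2 hx)
  refine h.trans (and_congr_right fun hp ↦ EventuallyEq.contMDiffAt_iff ?_)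
  filter_upwards [hp.continuousAt.preimage_mem_nhds ((A.isOpen_dom x₀).mem_nhds hx)] with y hy
  exact (congrFun ((trivializationAt F E x₀).coe_linearMapAt_of_mem (R := ℂ) hy) _).symm

theorem HoloAt.proj {f : N → TotalSpace F E} {n : N} (hf : A.HoloAt I f n) :
    ContMDiffAt I 𝓘(ℂ, EB) ω (fun y ↦ (f y).proj) n :=
  ((holoAt_iff (A.mem_dom _)).1 hf).1

theorem HoloAt.coord {f : N → TotalSpace F E} {n : N} (hf : A.HoloAt I f n) {x₀ : B}
    (hx : (f n).proj ∈ A.dom x₀) :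
    ContMDiffAt I 𝓘(ℂ, F) ω (fun y ↦ A.coord x₀ (f y).proj (f y).snd) n :=
  ((holoAt_iff hx).1 hf).2

theorem HoloAt.congr {f g : N → TotalSpace F E} {n : N} (hf : A.HoloAt I f n) (h : g =ᶠ[𝓝 n] f) :
    A.HoloAt I g n :=
  letI := A.totalTopology
  letI := A.fibreTopology
  letI := A.fibreBundle
  ContMDiffAt.congr_of_eventuallyEq hf h

theorem HoloAt.comp {f : N → TotalSpace F E} {g : N' → N} {n : N'} (hf : A.HoloAt I f (g n))
    (hg : ContMDiffAt I' I ω g n) : A.HoloAt I' (fun y ↦ f (g y)) n :=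
  letI := A.totalTopology
  letI := A.fibreTopology
  letI := A.fibreBundle
  ContMDiffAt.comp n hf hg

theorem eventually_mem_dom {g : N → B} {n : N} (hg : ContinuousAt g n) {x₀ : B}
    (hx : g n ∈ A.dom x₀) : ∀ᶠ y in 𝓝 n, g y ∈ A.dom x₀ :=
  hg.preimage_mem_nhds ((A.isOpen_dom x₀).mem_nhds hx)

theorem holoAt_frame {g : N → B} {v : N → F} {n : N} (hg : ContMDiffAt I 𝓘(ℂ, EB) ω g n)
    (hv : ContMDiffAt I 𝓘(ℂ, F) ω v n) {x₀ : B} (hx : g n ∈ A.dom x₀) :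
    A.HoloAt I (fun y ↦ ⟨g y, A.frame x₀ (g y) (v y)⟩) n := by
  refine (holoAt_iff (f := fun y ↦ ⟨g y, A.frame x₀ (g y) (v y)⟩) hx).2 ⟨hg, ?_⟩
  refine hv.congr_of_eventuallyEq ?_
  filter_upwards [eventually_mem_dom hg.continuousAt hx] with y hy
  exact coord_frame hy _

theorem HoloAt.smul {g : N → B} {s : ∀ y, E (g y)} {c : N → ℂ} {n : N}
    (hc : ContMDiffAt I 𝓘(ℂ, ℂ) ω c n) (hs : A.HoloAt I (fun y ↦ ⟨g y, s y⟩) n) :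
    A.HoloAt I (fun y ↦ ⟨g y, c y • s y⟩) n := by
  refine (holoAt_iff (f := fun y ↦ ⟨g y, c y • s y⟩) (A.mem_dom (g n))).2 ⟨hs.proj, ?_⟩
  refine (hc.smul (hs.coord (A.mem_dom _))).congr_of_eventuallyEq (Eventually.of_forall fun y ↦ ?_)
  exact map_smul _ _ _

theorem HolomorphicSection.holoAt {s : ∀ x, E x} (hs : A.HolomorphicSection s) {g : N → B} {n : N}
    (hg : ContMDiffAt I 𝓘(ℂ, EB) ω g n) : A.HoloAt I (fun y ↦ ⟨g y, s (g y)⟩) n :=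
  HoloAt.comp (f := fun x ↦ ⟨x, s x⟩) (g := g)
    (letI := A.totalTopology
     letI := A.fibreTopology
     letI := A.fibreBundle
     ContMDiff.contMDiffAt hs) hg

theorem HolomorphicMap.holoAt {f : TotalSpace F E → TotalSpace F' E'} (hf : A.HolomorphicMap A' f)
    {g : N → TotalSpace F E} {n : N} (hg : A.HoloAt I g n) : A'.HoloAt I (fun y ↦ f (g y)) n :=
  letI := A.totalTopology
  letI := A.fibreTopology
  letI := A.fibreBundle
  letI := A'.totalTopology
  letI := A'.fibreTopology
  letI := A'.fibreBundle
  ContMDiffAt.comp n (ContMDiff.contMDiffAt hf) hg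

/-- Every vector of a holomorphic vector bundle is a value of a local frame, so a map out of the
total space is holomorphic as soon as it is so along the local frames. -/
theorem holomorphicMap_of_frame {f : TotalSpace F E → TotalSpace F' E'}
    (hf : ∀ (x : B) (v : F), A'.HoloAt (𝓘(ℂ, EB).prod 𝓘(ℂ, F))
      (fun p : B × F ↦ f ⟨p.1, A.frame x p.1 p.2⟩) (x, v)) : A.HolomorphicMap A' f := by
  let := A.totalTopology
  let := A.fibreTopology
  let := A.fibreBundle
  let := A'.totalTopology
  let := A'.fibreTopology
  let := A'.fibreBundle
  intro e
  have hid : A.HoloAt (𝓘(ℂ, EB).prod 𝓘(ℂ, F)) (fun e : TotalSpace F E ↦ e) e := contMDiffAt_id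
  have h := HoloAt.comp (A := A') (g := fun e' : TotalSpace F E ↦
    (e'.proj, A.coord e.proj e'.proj e'.snd)) (n := e) (hf e.proj _)
    (hid.proj.prodMk (hid.coord (A.mem_dom _)))
  refine HoloAt.congr (A := A') h ?_
  filter_upwards [eventually_mem_dom hid.proj.continuousAt (A.mem_dom e.proj)] with e' he'
  exact congrArg f (congrArg (TotalSpace.mk e'.proj) (frame_coord he' _).symm)

theorem isMorphism_of_frame {E' : B → Type*} [∀ x, AddCommGroup (E' x)] [∀ x, Module ℂ (E' x)]
    {A' : HolomorphicBundle EB F' E'} {φ : ∀ x, E x →ₗ[ℂ] E' x}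
    (hφ : ∀ (x : B) (v : F), A'.HoloAt (𝓘(ℂ, EB).prod 𝓘(ℂ, F))
      (fun p : B × F ↦ ⟨p.1, φ p.1 (A.frame x p.1 p.2)⟩) (x, v)) : A.IsMorphism A' φ :=
  holomorphicMap_of_frame hφ

theorem IsMorphism.holoAt {E' : B → Type*} [∀ x, AddCommGroup (E' x)] [∀ x, Module ℂ (E' x)]
    {A' : HolomorphicBundle EB F' E'} {φ : ∀ x, E x →ₗ[ℂ] E' x} (hφ : A.IsMorphism A' φ)
    {g : N → B} {s : ∀ y, E (g y)} {n : N} (hs : A.HoloAt I (fun y ↦ ⟨g y, s y⟩) n) :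
    A'.HoloAt I (fun y ↦ ⟨g y, φ (g y) (s y)⟩) n :=
  HolomorphicMap.holoAt hφ hs

end HolomorphicBundle

/-- A holomorphic map that is linear in the second variable, ranging over a finite-dimensional
space, is a holomorphic family of linear maps. -/
theorem contMDiffAt_clm_of_apply [FiniteDimensional ℂ F] {L : N → F →L[ℂ] F'} {n : N}
    (h : ∀ v, ContMDiffAt I 𝓘(ℂ, F') ω (fun y ↦ L y v) n) :
    ContMDiffAt I 𝓘(ℂ, F →L[ℂ] F') ω L n := by
  have key : L = fun y ↦ ∑ i, ContinuousLinearMap.smulRightL ℂ F F'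
      (LinearMap.toContinuousLinearMap ((finBasis ℂ F).coord i)) (L y (finBasis ℂ F i)) := by
    funext y
    ext v
    conv_lhs => rw [← (finBasis ℂ F).sum_repr v, map_sum]
    simp
  rw [key]
  refine ContMDiffAt.sum fun i _ ↦ ?_
  exact (ContinuousLinearMap.contDiff _).contMDiff.contMDiffAt.comp n (h _)

namespace HolomorphicBundle

/-- A bijective morphism of holomorphic vector bundles is an isomorphism, because the inverse of a
holomorphic family of invertible matrices is holomorphic. -/
theorem isIso_of_isMorphism {E' : B → Type*} [∀ x, AddCommGroup (E' x)] [∀ x, Module ℂ (E' x)]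
    {A : HolomorphicBundle EB F E}
    {A' : HolomorphicBundle EB F' E'} [FiniteDimensional ℂ F] [FiniteDimensional ℂ F']
    {φ : ∀ x, E x ≃ₗ[ℂ] E' x}
    (hφ : A.IsMorphism A' fun x ↦ (φ x).toLinearMap) : A.IsIso A' φ := by
  refine ⟨hφ, isMorphism_of_frame fun x v ↦ ?_⟩
  let L : B → F →L[ℂ] F' := fun y ↦ LinearMap.toContinuousLinearMap
    (A'.coord x y ∘ₗ (φ y).toLinearMap ∘ₗ A.frame x y)
  let R : B → F' →L[ℂ] F := fun y ↦ LinearMap.toContinuousLinearMap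
    (A.coord x y ∘ₗ (φ y).symm.toLinearMap ∘ₗ A'.frame x y)
  have hL : ContMDiffAt 𝓘(ℂ, EB) 𝓘(ℂ, F →L[ℂ] F') ω L x :=
    contMDiffAt_clm_of_apply fun v ↦ (hφ.holoAt (g := fun y ↦ y) (s := fun y ↦ A.frame x y v)
      (holoAt_frame contMDiffAt_id contMDiffAt_const (A.mem_dom x))).coord (A'.mem_dom x)
  have hRL : ∀ y ∈ A.dom x ∩ A'.dom x, (L y).inverse = R y := by
    rintro y ⟨hy, hy'⟩
    have h1 : ∀ v, R y (L y v) = v := fun v ↦ by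
      simp only [R, L, LinearMap.coe_toContinuousLinearMap', LinearMap.comp_apply,
        LinearEquiv.coe_coe, frame_coord hy', LinearEquiv.symm_apply_apply, coord_frame hy]
    have h2 : ∀ v, L y (R y v) = v := fun v ↦ by
      simp only [R, L, LinearMap.coe_toContinuousLinearMap', LinearMap.comp_apply,
        LinearEquiv.coe_coe, frame_coord hy, LinearEquiv.apply_symm_apply, coord_frame hy']
    exact ContinuousLinearMap.inverse_eq (ContinuousLinearMap.ext h2) (ContinuousLinearMap.ext h1)
  have hdom : ∀ᶠ y in 𝓝 x, y ∈ A.dom x ∩ A'.dom x :=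
    inter_mem ((A.isOpen_dom x).mem_nhds (A.mem_dom x)) ((A'.isOpen_dom x).mem_nhds (A'.mem_dom x))
  have hinv : ContDiffAt ℂ ω (ContinuousLinearMap.inverse : (F →L[ℂ] F') → F' →L[ℂ] F) (L x) := by
    have h1 : ∀ v, R x (L x v) = v := fun v ↦ by
      simp only [R, L, LinearMap.coe_toContinuousLinearMap', LinearMap.comp_apply,
        LinearEquiv.coe_coe, frame_coord (A'.mem_dom x), LinearEquiv.symm_apply_apply,
        coord_frame (A.mem_dom x)]
    have h2 : ∀ v, L x (R x v) = v := fun v ↦ by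
      simp only [R, L, LinearMap.coe_toContinuousLinearMap', LinearMap.comp_apply,
        LinearEquiv.coe_coe, frame_coord (A.mem_dom x), LinearEquiv.apply_symm_apply,
        coord_frame (A'.mem_dom x)]
    have : CompleteSpace F := FiniteDimensional.complete ℂ F
    exact contDiffAt_map_inverse (ContinuousLinearEquiv.equivOfInverse (L x) (R x) h1 h2)
  have hR : ContMDiffAt 𝓘(ℂ, EB) 𝓘(ℂ, F' →L[ℂ] F) ω R x := by
    refine (hinv.contMDiffAt.comp x hL).congr_of_eventuallyEq ?_
    filter_upwards [hdom] with y hy using (hRL y hy).symm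
  have h1 : ContMDiffAt (𝓘(ℂ, EB).prod 𝓘(ℂ, F')) 𝓘(ℂ, F) ω (fun p : B × F' ↦ R p.1 p.2) (x, v) :=
    ContMDiffAt.clm_apply (g := fun p : B × F' ↦ R p.1)
      (ContMDiffAt.comp (x, v) (g := R) (f := Prod.fst) hR contMDiffAt_fst) contMDiffAt_snd
  refine (holoAt_frame (A := A) contMDiffAt_fst h1 (A.mem_dom x)).congr ?_
  filter_upwards [continuousAt_fst.preimage_mem_nhds hdom] with p hp
  exact congrArg (TotalSpace.mk p.1) (frame_coord hp.1 _).symm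

end HolomorphicBundle

/-- Holomorphic maps into a product bundle are pairs of holomorphic maps. -/
theorem holoAt_productBundle_iff {V : Type*} [NormedAddCommGroup V] [NormedSpace ℂ V]
    {f : N → TotalSpace V (Bundle.Trivial B V)} {n : N} :
    (productBundle EB B V).HoloAt I f n ↔ ContMDiffAt I 𝓘(ℂ, EB) ω (fun y ↦ (f y).proj) n ∧
      ContMDiffAt I 𝓘(ℂ, V) ω (fun y ↦ ((f y).snd : V)) n :=
  contMDiffAt_totalSpace (F := V) (E := Bundle.Trivial B V) (IB := 𝓘(ℂ, EB)) (IM := I) (n := ω)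

end LocalFrames

/-! ### Holomorphic vector bundles from local frames -/

section BundleConstruction

variable {EB : Type*} [NormedAddCommGroup EB] [NormedSpace ℂ EB]
  {B : Type*} [TopologicalSpace B] [ChartedSpace EB B]
  {F : Type*} [NormedAddCommGroup F] [NormedSpace ℂ F]
  {E : B → Type*} [∀ x, AddCommGroup (E x)] [∀ x, Module ℂ (E x)]

variable (EB F E) in
/-- Fibrewise linear coordinates on a family `E` of complex vector spaces over `B`, one system
around every point `x₀` of `B`, whose changes of coordinates are holomorphic: the data from which
a holomorphic vector bundle is glued. -/
structure BundleAtlas where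
  dom : B → Set B
  isOpen_dom : ∀ x₀, IsOpen (dom x₀)
  mem_dom : ∀ x, x ∈ dom x
  coordEquiv : ∀ x₀ x, x ∈ dom x₀ → E x ≃ₗ[ℂ] F
  holomorphic : ∀ (x₀ x₁ : B) (f : B → F →ₗ[ℂ] F),
    (∀ x (h₀ : x ∈ dom x₀) (h₁ : x ∈ dom x₁), f x =
      (coordEquiv x₁ x h₁).toLinearMap ∘ₗ (coordEquiv x₀ x h₀).symm.toLinearMap) →
    ∀ v : F, ContMDiffOn 𝓘(ℂ, EB) 𝓘(ℂ, F) ω (fun x ↦ f x v) (dom x₀ ∩ dom x₁)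

namespace BundleAtlas

variable (Z : BundleAtlas EB F E)

open Classical in
/-- The local trivialization given by the coordinates around `x₀`. -/
def pretrivialization (x₀ : B) : Pretrivialization F (π F E) where
  toFun p := ⟨p.1, if h : p.1 ∈ Z.dom x₀ then Z.coordEquiv x₀ p.1 h p.2 else 0⟩
  invFun p := ⟨p.1, if h : p.1 ∈ Z.dom x₀ then (Z.coordEquiv x₀ p.1 h).symm p.2 else 0⟩
  source := TotalSpace.proj ⁻¹' Z.dom x₀
  target := Z.dom x₀ ×ˢ univ
  map_source' := fun _ h ↦ ⟨h, mem_univ _⟩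
  map_target' := fun _ h ↦ h.1
  left_inv' := by
    rintro ⟨x, e⟩ (h : x ∈ Z.dom x₀)
    simp [h]
  right_inv' := by
    rintro ⟨x, v⟩ ⟨h : x ∈ Z.dom x₀, -⟩
    simp [h]
  open_target := (Z.isOpen_dom x₀).prod isOpen_univ
  baseSet := Z.dom x₀
  open_baseSet := Z.isOpen_dom x₀
  source_eq := rfl
  target_eq := rfl
  proj_toFun _ _ := rfl

theorem pretrivialization_apply {x₀ x : B} (h : x ∈ Z.dom x₀) (e : E x) :
    (Z.pretrivialization x₀ ⟨x, e⟩).2 = Z.coordEquiv x₀ x h e :=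
  dif_pos h

theorem pretrivialization_symm {x₀ x : B} (h : x ∈ Z.dom x₀) (v : F) :
    (Z.pretrivialization x₀).symm x v = (Z.coordEquiv x₀ x h).symm v := by
  rw [Pretrivialization.symm_apply _ (show x ∈ (Z.pretrivialization x₀).baseSet from h)]
  exact dif_pos h

instance isLinear_pretrivialization (x₀ : B) : (Z.pretrivialization x₀).IsLinear ℂ where
  linear x h :=
    { map_add := fun e e' ↦ by
        simp only [Z.pretrivialization_apply (x₀ := x₀) h, map_add]
      map_smul := fun c e ↦ by
        simp only [Z.pretrivialization_apply (x₀ := x₀) h, map_smul] }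

open Classical in
theorem exists_coordChange [FiniteDimensional ℂ F] (x₀ x₁ : B) : ∃ f : B → F →L[ℂ] F,
    ContMDiffOn 𝓘(ℂ, EB) 𝓘(ℂ, F →L[ℂ] F) ω f (Z.dom x₀ ∩ Z.dom x₁) ∧
      ∀ x ∈ Z.dom x₀ ∩ Z.dom x₁, ∀ v,
        f x v = (Z.pretrivialization x₁ ⟨x, (Z.pretrivialization x₀).symm x v⟩).2 := by
  let f : B → F →ₗ[ℂ] F := fun x ↦ if h : x ∈ Z.dom x₀ ∩ Z.dom x₁ then
    (Z.coordEquiv x₁ x h.2).toLinearMap ∘ₗ (Z.coordEquiv x₀ x h.1).symm.toLinearMap else 0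
  refine ⟨fun x ↦ LinearMap.toContinuousLinearMap (f x), fun x hx ↦ ?_, fun x hx v ↦ ?_⟩
  · refine (contMDiffAt_clm_of_apply fun v ↦ ?_).contMDiffWithinAt
    exact (Z.holomorphic x₀ x₁ f (fun x h₀ h₁ ↦ dif_pos ⟨h₀, h₁⟩) v).contMDiffAt
      (((Z.isOpen_dom x₀).inter (Z.isOpen_dom x₁)).mem_nhds hx)
  · rw [Z.pretrivialization_apply hx.2, Z.pretrivialization_symm hx.1]
    simp [f, hx.1, hx.2]

variable [FiniteDimensional ℂ F]

/-- The fibres carry the topology that makes the coordinates homeomorphisms. -/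
abbrev fibreTopology (x : B) : TopologicalSpace (E x) :=
  TopologicalSpace.induced (Z.coordEquiv x x (Z.mem_dom x)) inferInstance

/-- The holomorphic vector prebundle defined by a bundle atlas. -/
def vectorPrebundle : letI := Z.fibreTopology; VectorPrebundle ℂ F E :=
  letI := Z.fibreTopology
  { pretrivializationAtlas := range Z.pretrivialization
    pretrivialization_linear' := by
      rintro _ ⟨x₀, rfl⟩
      infer_instance
    pretrivializationAt := Z.pretrivialization
    mem_base_pretrivializationAt := Z.mem_dom
    pretrivialization_mem_atlas := fun x ↦ ⟨x, rfl⟩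
    exists_coordChange := by
      rintro _ ⟨x₀, rfl⟩ _ ⟨x₁, rfl⟩
      obtain ⟨f, hf, h⟩ := Z.exists_coordChange x₀ x₁
      exact ⟨f, hf.continuousOn, h⟩
    totalSpaceMk_isInducing := fun x ↦ by
      have : (Z.pretrivialization x ∘ TotalSpace.mk x : E x → B × F) =
          fun e ↦ (x, Z.coordEquiv x x (Z.mem_dom x) e) :=
        funext fun e ↦ Prod.ext rfl (Z.pretrivialization_apply (Z.mem_dom x) e)
      rw [this, isInducing_const_prod]
      exact ⟨rfl⟩ }

/-- The holomorphic vector bundle defined by a bundle atlas. -/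
def toBundle : HolomorphicBundle EB F E where
  totalTopology := letI := Z.fibreTopology; Z.vectorPrebundle.totalSpaceTopology
  fibreTopology := Z.fibreTopology
  fibreBundle := letI := Z.fibreTopology; Z.vectorPrebundle.toFiberBundle
  vectorBundle := letI := Z.fibreTopology; Z.vectorPrebundle.toVectorBundle
  holomorphic := by
    let := Z.fibreTopology
    have : Z.vectorPrebundle.IsContMDiff 𝓘(ℂ, EB) ω :=
      { exists_contMDiffCoordChange := by
          rintro _ ⟨x₀, rfl⟩ _ ⟨x₁, rfl⟩
          exact Z.exists_coordChange x₀ x₁ }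
    exact Z.vectorPrebundle.contMDiffVectorBundle 𝓘(ℂ, EB)

theorem toBundle_coord {x₀ x : B} (h : x ∈ Z.dom x₀) (e : E x) :
    Z.toBundle.coord x₀ x e = Z.coordEquiv x₀ x h e := by
  let := Z.toBundle.totalTopology
  let := Z.toBundle.fibreTopology
  let := Z.toBundle.fibreBundle
  have := Z.toBundle.vectorBundle
  exact (congrFun ((trivializationAt F E x₀).coe_linearMapAt_of_mem (R := ℂ) h) e).trans
    (Z.pretrivialization_apply h e)

theorem toBundle_frame {x₀ x : B} (h : x ∈ Z.dom x₀) (v : F) :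
    Z.toBundle.frame x₀ x v = (Z.coordEquiv x₀ x h).symm v := by
  rw [LinearEquiv.eq_symm_apply, ← Z.toBundle_coord h]
  exact HolomorphicBundle.coord_frame (A := Z.toBundle) h v

end BundleAtlas

end BundleConstruction

/-! ### Differentials as maps of tangent bundles -/

section Tangent

variable {EM : Type*} [NormedAddCommGroup EM] [NormedSpace ℂ EM]
  {M : Type*} [TopologicalSpace M] [ChartedSpace EM M] [IsManifold 𝓘(ℂ, EM) ω M]
  {EM' : Type*} [NormedAddCommGroup EM'] [NormedSpace ℂ EM']
  {M' : Type*} [TopologicalSpace M'] [ChartedSpace EM' M'] [IsManifold 𝓘(ℂ, EM') ω M']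
  {EN : Type*} [NormedAddCommGroup EN] [NormedSpace ℂ EN] {HN : Type*} [TopologicalSpace HN]
  {I : ModelWithCorners ℂ EN HN} {N : Type*} [TopologicalSpace N] [ChartedSpace HN N]

open HolomorphicBundle

/-- The differentials of a holomorphic family of maps send holomorphic families of tangent vectors
to holomorphic families of tangent vectors. -/
theorem holoAt_mfderiv [IsManifold I ω N] {f : N → M → M'} {g : N → M}
    {v : ∀ y, TangentSpace 𝓘(ℂ, EM) (g y)} {n : N}
    (hf : ContMDiffAt (I.prod 𝓘(ℂ, EM)) 𝓘(ℂ, EM') ω (Function.uncurry f) (n, g n))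
    (hv : (tangentBundle EM M).HoloAt I (fun y ↦ ⟨g y, v y⟩) n) :
    (tangentBundle EM' M').HoloAt I
      (fun y ↦ ⟨f y (g y), mfderiv 𝓘(ℂ, EM) 𝓘(ℂ, EM') (f y) (g y) (v y)⟩) n := by
  have hg : ContMDiffAt I 𝓘(ℂ, EM) ω g n := hv.proj
  have hc := hv.coord ((tangentBundle EM M).mem_dom (g n))
  have h := (ContMDiffAt.mfderiv f g hf hg (m := ω) (by simp)).clm_apply hc
  have hp : ContMDiffAt I 𝓘(ℂ, EM') ω (fun y ↦ f y (g y)) n :=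
    ContMDiffAt.comp n (f := fun y ↦ (y, g y)) hf (contMDiffAt_id.prodMk hg)
  refine (holoAt_iff (A := tangentBundle EM' M') (x₀ := f n (g n)) ?_).2 ⟨hp, ?_⟩
  · exact (tangentBundle EM' M').mem_dom _
  refine h.congr_of_eventuallyEq ?_
  filter_upwards [eventually_mem_dom hg.continuousAt ((tangentBundle EM M).mem_dom (g n))] with y hy
  have := frame_coord hy (v y)
  conv_lhs => rw [← this]
  rfl

/-- A holomorphic family of tangent vectors at a fixed point. -/
theorem holoAt_tangent_const [FiniteDimensional ℂ EM] {g : N → M} {m : M} (hg : ∀ y, g y = m)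
    {v : N → EM} {n : N} (hv : ContMDiffAt I 𝓘(ℂ, EM) ω v n) :
    (tangentBundle EM M).HoloAt I
      (fun y ↦ (⟨g y, v y⟩ : TotalSpace EM (fun x : M ↦ TangentSpace 𝓘(ℂ, EM) x))) n := by
  have hgm : g = fun _ ↦ m := funext hg
  subst hgm
  refine (holoAt_iff (A := tangentBundle EM M) (x₀ := m) ?_).2 ⟨contMDiffAt_const, ?_⟩
  · exact (tangentBundle EM M).mem_dom m
  let L : EM →ₗ[ℂ] EM := (tangentBundle EM M).coord m m
  exact (LinearMap.toContinuousLinearMap L).contDiff.contMDiff.contMDiffAt.comp n hv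

end Tangent

/-! ### Top forms -/

section TopForms

variable {EM : Type*} [NormedAddCommGroup EM] [NormedSpace ℂ EM]

/-- A top form is determined by its value on a basis. -/
theorem topForm_apply {n : ℕ} (e : Basis (Fin n) ℂ EM) (η : EM [⋀^Fin n]→L[ℂ] ℂ)
    (v : Fin n → EM) : η v = η e * e.det v := by
  have := DFunLike.congr_fun (η.toAlternatingMap.eq_smul_basis_det e) v
  simpa using this

variable [FiniteDimensional ℂ EM]

/-- The determinant with respect to a basis, as a continuous alternating form. -/
def detForm {n : ℕ} (e : Basis (Fin n) ℂ EM) : EM [⋀^Fin n]→L[ℂ] ℂ :=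
  { e.det with
    cont := by
      have h : ∀ i j, Continuous fun v : Fin n → EM ↦ e.repr (v j) i := fun i j ↦
        (LinearMap.continuous_of_finiteDimensional (e.coord i)).comp (continuous_apply j)
      change Continuous fun v : Fin n → EM ↦ e.det v
      simp only [e.det_apply]
      exact Continuous.matrix_det (continuous_matrix fun i j ↦ h i j) }

theorem detForm_apply {n : ℕ} (e : Basis (Fin n) ℂ EM) (v : Fin n → EM) :
    detForm e v = e.det v := rfl

/-- The evaluation of top forms at a basis. -/
def topFormEquiv {n : ℕ} (e : Basis (Fin n) ℂ EM) : (EM [⋀^Fin n]→L[ℂ] ℂ) ≃ₗ[ℂ] ℂ where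
  toFun η := η e
  map_add' _ _ := rfl
  map_smul' _ _ := rfl
  invFun c := c • detForm e
  left_inv η := by
    ext v
    simp [topForm_apply e η v, detForm_apply]
  right_inv c := by simp [detForm_apply, e.det_self]

variable {M : Type*} [TopologicalSpace M] [ChartedSpace EM M] [IsManifold 𝓘(ℂ, EM) ω M]
  {EN : Type*} [NormedAddCommGroup EN] [NormedSpace ℂ EN] {HN : Type*} [TopologicalSpace HN]
  {I : ModelWithCorners ℂ EN HN} {N : Type*} [TopologicalSpace N] [ChartedSpace HN N]

open HolomorphicBundle

theorem canonicalBundle_dom (x₀ : M) :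
    (canonicalBundle EM M).dom x₀ = (tangentBundle EM M).dom x₀ :=
  Set.inter_univ ((tangentBundle EM M).dom x₀)

theorem canonicalBundle_coord_apply {x₀ x : M} (hx : x ∈ (tangentBundle EM M).dom x₀)
    (η : CanonicalFibre EM x) (v : Fin (finrank ℂ EM) → EM) :
    (canonicalBundle EM M).coord x₀ x η v =
      η (fun i ↦ (tangentBundle EM M).frame x₀ x (v i)) := by
  have hx' : x ∈ (canonicalBundle EM M).dom x₀ := by
    rw [canonicalBundle_dom]
    exact hx
  let := (canonicalBundle EM M).totalTopology
  let := (canonicalBundle EM M).fibreTopology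
  let := (canonicalBundle EM M).fibreBundle
  have := (canonicalBundle EM M).vectorBundle
  have h := congrFun ((trivializationAt (EM [⋀^Fin (finrank ℂ EM)]→L[ℂ] ℂ)
    (fun x : M ↦ CanonicalFibre EM x) x₀).coe_linearMapAt_of_mem (R := ℂ)
      hx') η
  exact (congrArg (fun ζ : EM [⋀^Fin (finrank ℂ EM)]→L[ℂ] ℂ ↦ ζ v) h).trans (by
    change (trivializationAt ℂ (Bundle.Trivial M ℂ) x₀).continuousLinearMapAt ℂ x _ = _
    exact congrArg (fun L : ℂ →L[ℂ] ℂ ↦ L (η fun i ↦ (tangentBundle EM M).frame x₀ x (v i)))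
      (Trivial.continuousLinearMapAt_trivialization (𝕜 := ℂ) (B := M) (F := ℂ) x))

instance : FiniteDimensional ℂ (EM [⋀^Fin (finrank ℂ EM)]→L[ℂ] ℂ) :=
  (topFormEquiv (finBasis ℂ EM)).symm.finiteDimensional

theorem contMDiffAt_topForm_iff {η : N → EM [⋀^Fin (finrank ℂ EM)]→L[ℂ] ℂ} {n : N} :
    ContMDiffAt I 𝓘(ℂ, EM [⋀^Fin (finrank ℂ EM)]→L[ℂ] ℂ) ω η n ↔
      ContMDiffAt I 𝓘(ℂ, ℂ) ω (fun y ↦ η y (finBasis ℂ EM)) n := by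
  let L := (topFormEquiv (finBasis ℂ EM)).toContinuousLinearEquiv
  constructor
  · exact fun h ↦ L.contDiff.contMDiff.contMDiffAt.comp n h
  · intro h
    refine (L.symm.contDiff.contMDiff.contMDiffAt.comp n h).congr_of_eventuallyEq
      (Eventually.of_forall fun y ↦ ?_)
    exact (L.symm_apply_apply (η y)).symm

/-- A family of top forms is holomorphic if its values on the local frames of the tangent bundle
are. -/
theorem holoAt_canonicalBundle {g : N → M} {η : ∀ y, CanonicalFibre EM (g y)} {n : N}
    (hg : ContMDiffAt I 𝓘(ℂ, EM) ω g n)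
    (h : ContMDiffAt I 𝓘(ℂ, ℂ) ω (fun y ↦ η y
      (fun i ↦ (tangentBundle EM M).frame (g n) (g y) (finBasis ℂ EM i))) n) :
    (canonicalBundle EM M).HoloAt I (fun y ↦ ⟨g y, η y⟩) n := by
  refine (holoAt_iff (A := canonicalBundle EM M) (x₀ := g n) ?_).2 ⟨hg, ?_⟩
  · exact (canonicalBundle EM M).mem_dom _
  refine contMDiffAt_topForm_iff.2 (h.congr_of_eventuallyEq ?_)
  filter_upwards [eventually_mem_dom hg.continuousAt ((tangentBundle EM M).mem_dom (g n))] with y hy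
  exact canonicalBundle_coord_apply hy _ _

/-- A holomorphic family of top forms takes holomorphic values on holomorphic families of tangent
vectors. -/
theorem HolomorphicBundle.HoloAt.form_apply {g : N → M} {η : ∀ y, CanonicalFibre EM (g y)} {n : N}
    {v : Fin (finrank ℂ EM) → ∀ y, TangentSpace 𝓘(ℂ, EM) (g y)}
    (hη : (canonicalBundle EM M).HoloAt I (fun y ↦ ⟨g y, η y⟩) n)
    (hv : ∀ i, (tangentBundle EM M).HoloAt I (fun y ↦ ⟨g y, v i y⟩) n) :
    ContMDiffAt I 𝓘(ℂ, ℂ) ω (fun y ↦ η y (fun i ↦ v i y)) n := by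
  have hmem := (tangentBundle EM M).mem_dom (g n)
  have h1 := contMDiffAt_topForm_iff.1 (hη.coord (x₀ := g n) ((canonicalBundle EM M).mem_dom _))
  have h2 : ContMDiffAt I 𝓘(ℂ, Fin (finrank ℂ EM) → EM) ω
      (fun y i ↦ (tangentBundle EM M).coord (g n) (g y) (v i y)) n :=
    contMDiffAt_pi_space.2 fun i ↦ (hv i).coord hmem
  have h3 : ContDiff ℂ ω (fun w : Fin (finrank ℂ EM) → EM ↦ (finBasis ℂ EM).det w) :=
    (detForm (finBasis ℂ EM)).toContinuousMultilinearMap.contDiff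
  refine (h1.mul (h3.contMDiff.contMDiffAt.comp n h2)).congr_of_eventuallyEq ?_
  filter_upwards [eventually_mem_dom hη.proj.continuousAt hmem] with y hy
  refine Eq.trans ?_ (topForm_apply (finBasis ℂ EM) _ _)
  rw [canonicalBundle_coord_apply hy]
  congr 1
  funext i
  exact (frame_coord hy _).symm

end TopForms

/-! ### Free actions are infinitesimally free -/

/-- Let `μ` be a group law near `e` and `α` a local action of it, in coordinates, and let `F` be the
orbit map through a point. If `F` is injective near `e`, then the derivative of `F` at `e` is
injective: otherwise `F` would be constant along an integral curve of an invariant vector field. -/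
theorem eq_zero_of_fderiv_orbit_eq_zero {E E' : Type*} [NormedAddCommGroup E] [NormedSpace ℂ E]
    [CompleteSpace E] [NormedAddCommGroup E'] [NormedSpace ℂ E'] {μ : E × E → E}
    {α : E × E' → E'} {F : E → E'} {e : E} (hμ : ContDiffAt ℂ ω μ (e, e))
    (hα : ContDiffAt ℂ ω α (e, F e)) (hF : ContDiffAt ℂ ω F e)
    (hμl : ∀ᶠ z in 𝓝 e, μ (e, z) = z) (hμr : ∀ᶠ y in 𝓝 e, μ (y, e) = y)
    (hFμ : ∀ᶠ y in 𝓝 e, ∀ᶠ z in 𝓝 e, F (μ (y, z)) = α (y, F z))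
    {U : Set E} (hU : U ∈ 𝓝 e) (hinj : InjOn F U) {v : E} (hv : fderiv ℂ F e v = 0) : v = 0 := by
  -- the invariant vector field with value `v` at `e`
  let V : E → E := fun y ↦ fderiv ℂ μ (y, e) (0, v)
  have hV : ContDiffAt ℂ ω V e := by
    have h1 : ContDiffAt ℂ ω (fderiv ℂ μ) (e, e) := hμ.fderiv_right (by simp)
    exact (h1.comp (f := fun y : E ↦ (y, e)) e (contDiffAt_id.prodMk contDiffAt_const)).clm_apply
      contDiffAt_const
  have hVe : V e = v := by
    have h1 : HasFDerivAt (fun z ↦ μ (e, z)) ((fderiv ℂ μ (e, e)).comp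
        (ContinuousLinearMap.inr ℂ E E)) e :=
      (hμ.differentiableAt (by simp)).hasFDerivAt.comp e (hasFDerivAt_prodMk_right e e)
    have h2 := (hasFDerivAt_id (𝕜 := ℂ) e).congr_of_eventuallyEq hμl
    exact DFunLike.congr_fun (h1.unique h2) v
  -- the vector field `V` is tangent to the fibres of `F`
  have hFV : ∀ᶠ y in 𝓝 e, DifferentiableAt ℂ F y ∧ fderiv ℂ F y (V y) = 0 := by
    have d1 : ∀ᶠ y in 𝓝 e, DifferentiableAt ℂ F y :=
      ((hF.of_le (m := 1) le_top).eventually (by simp)).mono fun y hy ↦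
        hy.differentiableAt (by simp)
    have d2 : ∀ᶠ y in 𝓝 e, DifferentiableAt ℂ μ (y, e) :=
      (continuousAt_id.prodMk continuousAt_const).eventually
        (((hμ.of_le (m := 1) le_top).eventually (by simp)).mono fun y hy ↦
          hy.differentiableAt (by simp))
    have d3 : ∀ᶠ y in 𝓝 e, DifferentiableAt ℂ α (y, F e) :=
      (continuousAt_id.prodMk continuousAt_const).eventually
        (((hα.of_le (m := 1) le_top).eventually (by simp)).mono fun y hy ↦
          hy.differentiableAt (by simp))
    filter_upwards [d1, d2, d3, hμr, hFμ] with y h1 h2 h3 h4 h5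
    refine ⟨h1, ?_⟩
    have k1 : HasFDerivAt (fun z ↦ F (μ (y, z))) ((fderiv ℂ F y).comp ((fderiv ℂ μ (y, e)).comp
        (ContinuousLinearMap.inr ℂ E E))) e :=
      HasFDerivAt.comp e (f := fun z ↦ μ (y, z)) (by rw [h4]; exact h1.hasFDerivAt)
        (h2.hasFDerivAt.comp e (hasFDerivAt_prodMk_right y e))
    have k2 : HasFDerivAt (fun z ↦ α (y, F z)) (((fderiv ℂ α (y, F e)).comp
        (ContinuousLinearMap.inr ℂ E E')).comp (fderiv ℂ F e)) e :=
      HasFDerivAt.comp e (g := fun x ↦ α (y, x)) (f := F)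
        (h3.hasFDerivAt.comp (F e) (hasFDerivAt_prodMk_right y (F e)))
        (hF.differentiableAt (by simp)).hasFDerivAt
    have k3 := DFunLike.congr_fun (k1.unique (k2.congr_of_eventuallyEq h5)) v
    simp only [ContinuousLinearMap.comp_apply, hv, map_zero] at k3
    exact k3
  -- a real integral curve `γ` of `V` through `e`, along which `F` is constant; as `F` is injective,
  -- `γ` is constant, so `v = V e = γ'(0) = 0`
  obtain ⟨γ, hγ0, ε, hε, hγ⟩ :=
    ContDiffAt.exists_forall_mem_closedBall_exists_eq_forall_mem_Ioo_hasDerivAt₀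
      ((hV.restrict_scalars ℝ).of_le (m := 1) le_top) 0
  have hγc : ContinuousAt γ 0 := (hγ 0 (by simp [hε])).continuousAt
  have hIoo : Ioo (0 - ε) (0 + ε) ∈ 𝓝 (0 : ℝ) := Ioo_mem_nhds (by linarith) (by linarith)
  have h1 : ∀ᶠ t in 𝓝 (0 : ℝ), γ t ∈ U ∧ DifferentiableAt ℂ F (γ t) ∧
      fderiv ℂ F (γ t) (V (γ t)) = 0 ∧ t ∈ Ioo (0 - ε) (0 + ε) := by
    rw [ContinuousAt, hγ0] at hγc
    filter_upwards [hγc.eventually hU, hγc.eventually hFV, hIoo]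
      with t h1 h2 h3 using ⟨h1, h2.1, h2.2, h3⟩
  obtain ⟨δ, hδ, h1⟩ := Metric.eventually_nhds_iff_ball.1 h1
  have h2 : ∀ t ∈ Metric.ball (0 : ℝ) δ, HasDerivAt (fun t ↦ F (γ t)) 0 t := fun t ht ↦ by
    obtain ⟨-, h3, h4, h5⟩ := h1 t ht
    have := (h3.hasFDerivAt.restrictScalars ℝ).comp_hasDerivAt t (hγ t h5)
    simpa [h4, Function.comp_def] using this
  have h3 : ∀ t ∈ Metric.ball (0 : ℝ) δ, γ t = e := fun t ht ↦ by
    have h0 : (0 : ℝ) ∈ Metric.ball (0 : ℝ) δ := Metric.mem_ball_self hδ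
    have := Metric.isOpen_ball.is_const_of_deriv_eq_zero
      (convex_ball (0 : ℝ) δ).isPreconnected
      (fun t ht ↦ (h2 t ht).differentiableAt.differentiableWithinAt)
      (fun t ht ↦ (h2 t ht).deriv) ht h0
    exact (hinj (h1 t ht).1 (h1 0 h0).1 this).trans hγ0
  have h4 : HasDerivAt γ 0 0 := (hasDerivAt_const (0 : ℝ) e).congr_of_eventuallyEq
    (eventually_of_mem (Metric.ball_mem_nhds 0 hδ) h3)
  have h5 := (hγ 0 (by simp [hε])).unique h4
  rwa [hγ0, hVe] at h5

/-! ### Local slices -/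

section Slice

set_option linter.unusedSectionVars false

variable {EH EM H M : Type*}
  [NormedAddCommGroup EH] [NormedSpace ℂ EH]
  [NormedAddCommGroup EM] [NormedSpace ℂ EM]
  [Group H] [TopologicalSpace H] [ChartedSpace EH H] [LieGroup 𝓘(ℂ, EH) ω H]
  [TopologicalSpace M] [ChartedSpace EM M] [IsManifold 𝓘(ℂ, EM) ω M]
  [MulAction H M] [ContMDiffSMul 𝓘(ℂ, EH) 𝓘(ℂ, EM) ω H M]

theorem contMDiffAt_chart_of_mem {x y : M} (hy : y ∈ (chartAt EM x).source) :
    ContMDiffAt 𝓘(ℂ, EM) 𝓘(ℂ, EM) ω (chartAt EM x) y :=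
  contMDiffOn_chart.contMDiffAt ((chartAt EM x).open_source.mem_nhds hy)

theorem contMDiffAt_chart_symm_of_mem {x : M} {y : EM} (hy : y ∈ (chartAt EM x).target) :
    ContMDiffAt 𝓘(ℂ, EM) 𝓘(ℂ, EM) ω (chartAt EM x).symm y :=
  contMDiffOn_chart_symm.contMDiffAt ((chartAt EM x).open_target.mem_nhds hy)

/-- The right orbit map `h ↦ h⁻¹ • m` in the preferred charts around `1` and `m`. -/
def orbitInChart (EH EM H : Type*) {M : Type*} [NormedAddCommGroup EH] [NormedAddCommGroup EM]
    [Group H] [TopologicalSpace H] [ChartedSpace EH H] [TopologicalSpace M] [ChartedSpace EM M]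
    [MulAction H M] (m : M) (z : EH) : EM :=
  chartAt EM m (((chartAt EH (1 : H)).symm z)⁻¹ • m)

/-- The right action of `H`, in the preferred charts around `1` and `m`. -/
def actionInChart (EH EM H : Type*) {M : Type*} [NormedAddCommGroup EH] [NormedAddCommGroup EM]
    [Group H] [TopologicalSpace H] [ChartedSpace EH H] [TopologicalSpace M] [ChartedSpace EM M]
    [MulAction H M] (m : M) (p : EH × EM) : EM :=
  chartAt EM m (((chartAt EH (1 : H)).symm p.1)⁻¹ • (chartAt EM m).symm p.2)

variable (EH H) in
theorem chart_one_symm : (chartAt EH (1 : H)).symm (chartAt EH (1 : H) 1) = 1 :=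
  (chartAt EH (1 : H)).left_inv (mem_chart_source EH 1)

variable (EH H) in
theorem contMDiffAt_chart_one_symm :
    ContMDiffAt 𝓘(ℂ, EH) 𝓘(ℂ, EH) ω (chartAt EH (1 : H)).symm (chartAt EH (1 : H) 1) :=
  contMDiffAt_chart_symm_of_mem (mem_chart_target EH 1)

theorem contMDiffAt_smul_in_chart (m : M) :
    ContMDiffAt 𝓘(ℂ, EH × EM) 𝓘(ℂ, EM) ω
      (fun p : EH × EM ↦ ((chartAt EH (1 : H)).symm p.1)⁻¹ • (chartAt EM m).symm p.2)
      (chartAt EH (1 : H) 1, chartAt EM m m) := by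
  refine ContMDiffAt.smul (I := 𝓘(ℂ, EH))
    (f := fun p : EH × EM ↦ ((chartAt EH (1 : H)).symm p.1)⁻¹)
    (g := fun p : EH × EM ↦ (chartAt EM m).symm p.2) (ContMDiffAt.inv ?_) ?_
  · exact ContMDiffAt.comp (_, _) (f := Prod.fst) (contMDiffAt_chart_one_symm EH H)
      contDiff_fst.contMDiff.contMDiffAt
  · exact ContMDiffAt.comp (chartAt EH (1 : H) 1, chartAt EM m m) (f := Prod.snd)
      (contMDiffAt_chart_symm_of_mem (mem_chart_target EM m)) contDiff_snd.contMDiff.contMDiffAt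

theorem smul_in_chart_self (m : M) :
    ((chartAt EH (1 : H)).symm (chartAt EH (1 : H) 1))⁻¹ •
      (chartAt EM m).symm (chartAt EM m m) = m := by
  rw [chart_one_symm, (chartAt EM m).left_inv (mem_chart_source EM m), inv_one, one_smul]

theorem contDiffAt_actionInChart (m : M) : ContDiffAt ℂ ω (actionInChart EH EM H m)
    (chartAt EH (1 : H) 1, chartAt EM m m) := by
  rw [← contMDiffAt_iff_contDiffAt]
  refine ContMDiffAt.comp (chartAt EH (1 : H) 1, chartAt EM m m) (g := chartAt EM m) ?_
    (contMDiffAt_smul_in_chart m)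
  simp only [smul_in_chart_self]
  exact contMDiffAt_chart_of_mem (mem_chart_source EM m)

theorem orbitInChart_eq (m : M) (z : EH) :
    orbitInChart EH EM H m z = actionInChart EH EM H m (z, chartAt EM m m) := by
  rw [orbitInChart, actionInChart, (chartAt EM m).left_inv (mem_chart_source EM m)]

theorem orbitInChart_self (m : M) :
    orbitInChart EH EM H m (chartAt EH (1 : H) 1) = chartAt EM m m := by
  rw [orbitInChart, chart_one_symm, inv_one, one_smul]

theorem contDiffAt_orbitInChart (m : M) :
    ContDiffAt ℂ ω (orbitInChart EH EM H m) (chartAt EH (1 : H) 1) := by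
  have h : orbitInChart EH EM H m = fun z ↦ actionInChart EH EM H m (z, chartAt EM m m) :=
    funext (orbitInChart_eq m)
  rw [h]
  exact (contDiffAt_actionInChart m).comp (f := fun z : EH ↦ (z, chartAt EM m m)) _
    (contDiffAt_id.prodMk contDiffAt_const)

/-- The orbit maps of a free holomorphic action are immersions at `1`, in charts. -/
theorem injective_fderiv_orbitInChart [CompleteSpace EH]
    (hfree : ∀ (h : H) (m : M), h • m = m → h = 1) (m : M) :
    Function.Injective (fderiv ℂ (orbitInChart EH EM H m) (chartAt EH (1 : H) 1)) := by
  have : IsTopologicalGroup H := topologicalGroup_of_lieGroup 𝓘(ℂ, EH) ω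
  have : ContinuousSMul H M := ContMDiffSMul.continuousSMul (I := 𝓘(ℂ, EH)) (I' := 𝓘(ℂ, EM)) ω
  rw [injective_iff_map_eq_zero]
  intro v hv
  set c := chartAt EH (1 : H) with hc
  have hcs : ContinuousAt c.symm (c 1) := (contMDiffAt_chart_one_symm EH H).continuousAt
  have hcs1 : c.symm (c 1) = 1 := chart_one_symm EH H
  have hsm : ContinuousAt (fun z ↦ (c.symm z)⁻¹ • m) (c 1) := hcs.inv.smul continuousAt_const
  -- `h ↦ h⁻¹ • m` is the orbit map of a right action, whence the opposite multiplication
  let μ : EH × EH → EH := fun p ↦ c (c.symm p.2 * c.symm p.1)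
  have hmul : ContMDiffAt 𝓘(ℂ, EH × EH) 𝓘(ℂ, EH) ω
      (fun p : EH × EH ↦ c.symm p.2 * c.symm p.1) (c 1, c 1) :=
    ContMDiffAt.mul
      (ContMDiffAt.comp (c 1, c 1) (f := Prod.snd) (contMDiffAt_chart_one_symm EH H)
        contDiff_snd.contMDiff.contMDiffAt)
      (ContMDiffAt.comp (c 1, c 1) (f := Prod.fst) (contMDiffAt_chart_one_symm EH H)
        contDiff_fst.contMDiff.contMDiffAt)
  have hμ : ContDiffAt ℂ ω μ (c 1, c 1) := by
    rw [← contMDiffAt_iff_contDiffAt]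
    refine ContMDiffAt.comp (c 1, c 1) (g := c) ?_ hmul
    simp only [hcs1, mul_one]
    exact contMDiffAt_chart_of_mem (mem_chart_source EH 1)
  have htarget : ∀ᶠ z in 𝓝 (c 1), z ∈ c.target := c.open_target.mem_nhds (mem_chart_target EH 1)
  have hα := contDiffAt_actionInChart (EH := EH) (EM := EM) (H := H) m
  rw [← orbitInChart_self (EH := EH) (H := H) m] at hα
  refine eq_zero_of_fderiv_orbit_eq_zero hμ hα (contDiffAt_orbitInChart m) ?_ ?_ ?_
    (U := c.target ∩ {z | (c.symm z)⁻¹ • m ∈ (chartAt EM m).source}) ?_ ?_ hv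
  · filter_upwards [htarget] with z hz
    simp only [μ, hcs1, mul_one, c.right_inv hz]
  · filter_upwards [htarget] with z hz
    simp only [μ, hcs1, one_mul, c.right_inv hz]
  · have h1 : ∀ᶠ p : EH × EH in 𝓝 (c 1, c 1), c.symm p.2 * c.symm p.1 ∈ c.source := by
      refine hmul.continuousAt.eventually (c.open_source.mem_nhds ?_)
      simp only [hcs1, mul_one]
      exact mem_chart_source EH 1
    have h2 : ∀ᶠ z in 𝓝 (c 1), (c.symm z)⁻¹ • m ∈ (chartAt EM m).source := by
      refine hsm.eventually ((chartAt EM m).open_source.mem_nhds ?_)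
      change (c.symm (c 1))⁻¹ • m ∈ _
      rw [hcs1, inv_one, one_smul]
      exact mem_chart_source EM m
    filter_upwards [h1.curry_nhds] with y hy
    filter_upwards [hy, h2] with z h3 h4
    simp only [orbitInChart, actionInChart, μ, ← hc, c.left_inv h3, (chartAt EM m).left_inv h4,
      mul_inv_rev, mul_smul]
  · refine inter_mem htarget (hsm.preimage_mem_nhds ((chartAt EM m).open_source.mem_nhds ?_))
    rw [hcs1, inv_one, one_smul]
    exact mem_chart_source EM m
  · rintro z ⟨hz, hz'⟩ w ⟨hw, hw'⟩ h
    have h1 : (c.symm z)⁻¹ • m = (c.symm w)⁻¹ • m := (chartAt EM m).injOn hz' hw' h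
    have h2 := hfree (c.symm w * (c.symm z)⁻¹) m (by rw [mul_smul, h1, smul_inv_smul])
    exact c.symm.injOn hz hw (mul_inv_eq_one.1 h2).symm

/-- The infinitesimal action of a free action is injective. -/
theorem injective_fundamentalField [CompleteSpace EH]
    (hfree : ∀ (h : H) (m : M), h • m = m → h = 1) (m : M) {y : EH}
    (hy : fundamentalField EH EM H y m = 0) : y = 0 := by
  set c := chartAt EH (1 : H) with hc
  set φ := chartAt EM m with hφ
  set f : H → M := fun h ↦ h⁻¹ • m with hf
  have hf1 : f 1 = m := by simp [hf]
  have hfd : ContMDiff 𝓘(ℂ, EH) 𝓘(ℂ, EM) ω f :=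
    ContMDiff.smul (I := 𝓘(ℂ, EH)) (f := fun h : H ↦ h⁻¹) (contMDiff_inv 𝓘(ℂ, EH) ω)
      (contMDiff_const (c := m))
  have hcd : ContMDiffAt 𝓘(ℂ, EH) 𝓘(ℂ, EH) ω c 1 :=
    contMDiffAt_chart_of_mem (mem_chart_source EH 1)
  have hφd : ContMDiffAt 𝓘(ℂ, EM) 𝓘(ℂ, EM) ω φ (f 1) :=
    contMDiffAt_chart_of_mem (by rw [hf1]; exact mem_chart_source EM m)
  have hsrc : ∀ᶠ h in 𝓝 (1 : H), h ∈ c.source := c.open_source.mem_nhds (mem_chart_source EH 1)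
  have h1 : (fun h ↦ orbitInChart EH EM H m (c h)) =ᶠ[𝓝 1] fun h ↦ φ (f h) := by
    filter_upwards [hsrc] with h hh
    simp only [orbitInChart, ← hc, c.left_inv hh, hf, hφ]
  have hF : ContMDiffAt 𝓘(ℂ, EH) 𝓘(ℂ, EM) ω (orbitInChart EH EM H m) (c 1) :=
    (contDiffAt_orbitInChart m).contMDiffAt
  have h2 := mfderiv_comp (1 : H) (hF.mdifferentiableAt (by simp)) (hcd.mdifferentiableAt (by simp))
  have h3 := mfderiv_comp (1 : H) (hφd.mdifferentiableAt (by simp))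
    (hfd.contMDiffAt.mdifferentiableAt (by simp))
  have h4 := DFunLike.congr_fun (h2.symm.trans (h1.mfderiv_eq.trans h3)) y
  have h5 : mfderiv 𝓘(ℂ, EH) 𝓘(ℂ, EM) f 1 y = 0 := hy
  change mfderiv 𝓘(ℂ, EH) 𝓘(ℂ, EM) (orbitInChart EH EM H m) (c 1)
    (mfderiv 𝓘(ℂ, EH) 𝓘(ℂ, EH) c 1 y) =
      mfderiv 𝓘(ℂ, EM) 𝓘(ℂ, EM) φ (f 1) (mfderiv 𝓘(ℂ, EH) 𝓘(ℂ, EM) f 1 y) at h4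
  rw [h5, map_zero, mfderiv_eq_fderiv] at h4
  have h5' (w : EH) (hw : fderiv ℂ (orbitInChart EH EM H m) (c 1) w = 0) : w = 0 :=
    injective_fderiv_orbitInChart hfree m (hw.trans (map_zero _).symm)
  have h6 : mfderiv 𝓘(ℂ, EH) 𝓘(ℂ, EH) c 1 y = 0 := h5' _ h4
  have h7 := mfderiv_comp (1 : H)
    ((contMDiffAt_chart_one_symm EH H).mdifferentiableAt (by simp))
    (hcd.mdifferentiableAt (by simp))
  have h8 : c.symm ∘ c =ᶠ[𝓝 1] id := hsrc.mono fun h hh ↦ c.left_inv hh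
  rw [h8.mfderiv_eq, mfderiv_id] at h7
  have h9 := DFunLike.congr_fun h7 y
  change y = mfderiv 𝓘(ℂ, EH) 𝓘(ℂ, EH) c.symm (c 1) (mfderiv 𝓘(ℂ, EH) 𝓘(ℂ, EH) c 1 y) at h9
  rw [h6, map_zero] at h9
  exact h9

/-- The local slice theorem: near `m`, every point is of the form `κ • σ ρ` with `κ` near `1` in the
group and `ρ` near `0` in a space of complementary dimension, and `ρ` is locally invariant along the
orbits. The dimension of `EX` is a truncated difference, but it is a true one, since the derivative
of the orbit map is injective. -/
theorem exists_local_slice [FiniteDimensional ℂ EH] [FiniteDimensional ℂ EM]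
    {EX : Type*} [NormedAddCommGroup EX] [NormedSpace ℂ EX] [FiniteDimensional ℂ EX]
    (hdim : finrank ℂ EX = finrank ℂ EM - finrank ℂ EH)
    (hfree : ∀ (h : H) (m : M), h • m = m → h = 1) (m : M) :
    ∃ (σ : EX → M) (κ : M → H) (ρ : M → EX),
      ContMDiffAt 𝓘(ℂ, EX) 𝓘(ℂ, EM) ω σ 0 ∧ ContMDiffAt 𝓘(ℂ, EM) 𝓘(ℂ, EH) ω κ m ∧
      ContMDiffAt 𝓘(ℂ, EM) 𝓘(ℂ, EX) ω ρ m ∧ σ 0 = m ∧ κ m = 1 ∧ ρ m = 0 ∧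
      (∀ᶠ x in 𝓝 m, κ x • σ (ρ x) = x) ∧
      ∀ᶠ p : H × EX in 𝓝 (1, 0), ρ (p.1 • σ p.2) = p.2 := by
  have : CompleteSpace EH := FiniteDimensional.complete ℂ EH
  have : IsTopologicalGroup H := topologicalGroup_of_lieGroup 𝓘(ℂ, EH) ω
  have : ContinuousSMul H M := ContMDiffSMul.continuousSMul (I := 𝓘(ℂ, EH)) (I' := 𝓘(ℂ, EM)) ω
  set c := chartAt EH (1 : H) with hc
  set φ := chartAt EM m with hφ
  let F' := fderiv ℂ (orbitInChart EH EM H m) (c 1)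
  have hF' : Function.Injective F' := injective_fderiv_orbitInChart hfree m
  -- a complement of the tangent space of the orbit
  obtain ⟨Q, hQ⟩ := Submodule.exists_isCompl (LinearMap.range F'.toLinearMap)
  have hQdim : finrank ℂ EX = finrank ℂ Q := by
    have h1 := Submodule.finrank_add_eq_of_isCompl hQ
    have h2 := LinearMap.finrank_range_of_inj (f := F'.toLinearMap) hF'
    omega
  let j : EX ≃ₗ[ℂ] Q := LinearEquiv.ofFinrankEq _ _ hQdim
  let L : (EH × EX) ≃L[ℂ] EM := (((LinearEquiv.ofInjective F'.toLinearMap hF').prodCongr j).trans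
    (Submodule.prodEquivOfIsCompl _ _ hQ)).toContinuousLinearEquiv
  let j' : EX →L[ℂ] EM := LinearMap.toContinuousLinearMap (Q.subtype ∘ₗ j.toLinearMap)
  have hL : (L : (EH × EX) →L[ℂ] EM) = F'.comp (ContinuousLinearMap.fst ℂ EH EX) +
      j'.comp (ContinuousLinearMap.snd ℂ EH EX) := by
    ext p <;> simp [L, j']
  -- `Ψ` spreads the affine slice `φ m + j' EX` by the right action; its derivative at `(c 1, 0)` is
  -- the isomorphism `L`
  let Ψ : EH × EX → EM := fun p ↦ actionInChart EH EM H m (p.1, φ m + j' p.2)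
  have hj : ContDiff ℂ ω (fun p : EH × EX ↦ (p.1, φ m + j' p.2)) :=
    contDiff_fst.prodMk (contDiff_const.add (j'.contDiff.comp contDiff_snd))
  have hα := contDiffAt_actionInChart (EH := EH) (EM := EM) (H := H) m
  have hΨ : ContDiffAt ℂ ω Ψ (c 1, 0) :=
    ContDiffAt.comp (c 1, 0) (g := actionInChart EH EM H m)
      (f := fun p : EH × EX ↦ (p.1, φ m + j' p.2)) (by simpa using hα) hj.contDiffAt
  have hΨ' : HasFDerivAt Ψ (L : (EH × EX) →L[ℂ] EM) (c 1, 0) := by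
    have h0 := (hΨ.differentiableAt (by simp)).hasFDerivAt
    have h1 : HasFDerivAt (fun z ↦ Ψ (z, 0)) ((fderiv ℂ Ψ (c 1, 0)).comp
        (ContinuousLinearMap.inl ℂ EH EX)) (c 1) :=
      HasFDerivAt.comp (c 1) (f := fun z : EH ↦ (z, (0 : EX))) h0 (hasFDerivAt_prodMk_left (c 1) 0)
    have h2 : HasFDerivAt (fun s ↦ Ψ (c 1, s)) ((fderiv ℂ Ψ (c 1, 0)).comp
        (ContinuousLinearMap.inr ℂ EH EX)) 0 :=
      HasFDerivAt.comp 0 (f := fun s : EX ↦ (c 1, s)) h0 (hasFDerivAt_prodMk_right (c 1) 0)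
    have h3 : HasFDerivAt (fun z ↦ Ψ (z, 0)) F' (c 1) := by
      have : (fun z ↦ Ψ (z, 0)) = orbitInChart EH EM H m := by
        funext z
        simp [Ψ, orbitInChart_eq, hφ]
      rw [this]
      exact ((contDiffAt_orbitInChart m).differentiableAt (by simp)).hasFDerivAt
    have h4 : HasFDerivAt (fun s ↦ Ψ (c 1, s)) j' 0 := by
      refine (j'.hasFDerivAt.const_add (φ m)).congr_of_eventuallyEq ?_
      have : ∀ᶠ s in 𝓝 (0 : EX), φ m + j' s ∈ φ.target := by
        refine ContinuousAt.preimage_mem_nhds (by fun_prop) (φ.open_target.mem_nhds ?_)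
        rw [map_zero, add_zero]
        exact mem_chart_target EM m
      filter_upwards [this] with s hs
      simp only [Ψ, actionInChart, ← hc, ← hφ]
      rw [chart_one_symm, inv_one, one_smul, φ.right_inv hs]
    have h5 : (L : (EH × EX) →L[ℂ] EM) = fderiv ℂ Ψ (c 1, 0) := by
      rw [hL, ← h1.unique h3, ← h2.unique h4]
      ext p <;> simp <;> exact map_zero _
    rw [h5]
    exact h0
  let P := hΨ.toOpenPartialHomeomorph Ψ hΨ' (by simp)
  have hPs : (c 1, (0 : EX)) ∈ P.source := hΨ.mem_toOpenPartialHomeomorph_source hΨ' (by simp)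
  have hPc : ∀ p, P p = Ψ p := fun _ ↦ rfl
  have hΨ0 : Ψ (c 1, 0) = φ m := by
    change actionInChart EH EM H m (c 1, φ m + j' 0) = φ m
    rw [map_zero, add_zero, actionInChart, smul_in_chart_self]
  have hP0 : P.symm (φ m) = (c 1, 0) := by rw [← hΨ0, ← hPc, P.left_inv hPs]
  have hPt : φ m ∈ P.target := by rw [← hΨ0, ← hPc]; exact P.map_source hPs
  have hPsymm : ContMDiffAt 𝓘(ℂ, EM) 𝓘(ℂ, EH × EX) ω P.symm (φ m) := by
    rw [contMDiffAt_iff_contDiffAt]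
    refine P.contDiffAt_symm hPt (f₀' := L) ?_ ?_ <;> rw [hP0]
    · exact hΨ'
    · exact hΨ
  have hPφ : ContMDiffAt 𝓘(ℂ, EM) 𝓘(ℂ, EH × EX) ω (fun x ↦ P.symm (φ x)) m :=
    ContMDiffAt.comp m hPsymm (contMDiffAt_chart_of_mem (mem_chart_source EM m))
  have hσ : ContMDiffAt 𝓘(ℂ, EX) 𝓘(ℂ, EM) ω (fun s ↦ φ.symm (φ m + j' s)) 0 := by
    refine ContMDiffAt.comp 0 (g := φ.symm) ?_
      (contDiff_const.add j'.contDiff).contMDiff.contMDiffAt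
    simp only [map_zero, add_zero]
    exact contMDiffAt_chart_symm_of_mem (mem_chart_target EM m)
  have hκ : ContMDiffAt 𝓘(ℂ, EM) 𝓘(ℂ, EH) ω (fun x ↦ (c.symm (P.symm (φ x)).1)⁻¹) m := by
    refine ContMDiffAt.inv (ContMDiffAt.comp m (g := c.symm) ?_
      (contDiff_fst.contMDiff.contMDiffAt.comp m hPφ))
    simp only [hP0]
    exact contMDiffAt_chart_one_symm EH H
  have hρ : ContMDiffAt 𝓘(ℂ, EM) 𝓘(ℂ, EX) ω (fun x ↦ (P.symm (φ x)).2) m :=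
    contDiff_snd.contMDiff.contMDiffAt.comp m hPφ
  have hφm : φ.symm (φ m) = m := φ.left_inv (mem_chart_source EM m)
  -- the inverse in `κ` turns the right action of `Ψ` into the given left action
  refine ⟨fun s ↦ φ.symm (φ m + j' s), fun x ↦ (c.symm (P.symm (φ x)).1)⁻¹,
    fun x ↦ (P.symm (φ x)).2, hσ, hκ, hρ, ?_, ?_, ?_, ?_, ?_⟩
  · simp [hφm]
  · simp only [hP0]
    rw [chart_one_symm, inv_one]
  · simp only [hP0]
  · have h1 : ∀ᶠ x in 𝓝 m, φ x ∈ P.target :=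
      (contMDiffAt_chart_of_mem (mem_chart_source EM m)).continuousAt.preimage_mem_nhds
        (P.open_target.mem_nhds hPt)
    have h2 : ∀ᶠ x in 𝓝 m, x ∈ φ.source := φ.open_source.mem_nhds (mem_chart_source EM m)
    have h3 : ∀ᶠ x in 𝓝 m, (c.symm (P.symm (φ x)).1)⁻¹ • φ.symm (φ m + j' (P.symm (φ x)).2) ∈
        φ.source := by
      have hσ' : ContinuousAt (fun s ↦ φ.symm (φ m + j' s)) (P.symm (φ m)).2 := by
        rw [hP0]
        exact hσ.continuousAt
      refine (hκ.continuousAt.smul (ContinuousAt.comp (f := fun x ↦ (P.symm (φ x)).2) hσ'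
        hρ.continuousAt)).preimage_mem_nhds (φ.open_source.mem_nhds ?_)
      change (c.symm (P.symm (φ m)).1)⁻¹ • φ.symm (φ m + j' (P.symm (φ m)).2) ∈ φ.source
      rw [hP0, chart_one_symm, inv_one, one_smul, map_zero, add_zero, hφm]
      exact mem_chart_source EM m
    filter_upwards [h1, h2, h3] with x h1 h2 h3
    refine φ.injOn h3 h2 ?_
    have := P.right_inv h1
    exact this
  · have h1 : ∀ᶠ p : H × EX in 𝓝 (1, 0), p.1⁻¹ ∈ c.source := by
      refine ContinuousAt.preimage_mem_nhds (by fun_prop) (c.open_source.mem_nhds ?_)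
      rw [inv_one]
      exact mem_chart_source EH (1 : H)
    have h2 : ∀ᶠ p : H × EX in 𝓝 (1, 0), (c p.1⁻¹, p.2) ∈ P.source := by
      have hcc : ContinuousAt c ((1 : H)⁻¹) := by
        rw [inv_one]
        exact (contMDiffAt_chart_of_mem (mem_chart_source EH 1)).continuousAt
      refine ContinuousAt.preimage_mem_nhds (f := fun p : H × EX ↦ (c p.1⁻¹, p.2))
        ((ContinuousAt.comp (f := fun p : H × EX ↦ p.1⁻¹) hcc (by fun_prop)).prodMk
          continuousAt_snd) (P.open_source.mem_nhds ?_)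
      simpa using hPs
    filter_upwards [h1, h2] with p h1 h2
    have h3 : φ (p.1 • φ.symm (φ m + j' p.2)) = P (c p.1⁻¹, p.2) := by
      simp only [hPc, Ψ, actionInChart, ← hc, ← hφ, c.left_inv h1, inv_inv]
    simp only [h3, P.left_inv h2]

end Slice

/-! ### The complex structure of the orbit space -/

section QuotientManifold

set_option linter.unusedSectionVars false

theorem orbitProj_eq_iff {H M : Type*} [Group H] [MulAction H M] {m m' : M} :
    orbitProj H M m = orbitProj H M m' ↔ ∃ h : H, h • m' = m :=
  Quotient.eq.trans Iff.rfl

/-- Near a point, a free proper action only moves points a short distance by group elements close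
to `1`. -/
theorem exists_nhds_forall_smul_mem {H M : Type*} [Group H] [TopologicalSpace H]
    [TopologicalSpace M] [MulAction H M] [ProperSMul H M]
    (hfree : ∀ (h : H) (m : M), h • m = m → h = 1) (m : M) {U : Set H} (hU : U ∈ 𝓝 1) :
    ∃ W ∈ 𝓝 m, ∀ (h : H) (x : M), x ∈ W → h • x ∈ W → h ∈ U := by
  have hcl : IsClosed ((fun p : H × M ↦ (p.1 • p.2, p.2)) '' ((interior U)ᶜ ×ˢ univ)) :=
    ProperSMul.isProperMap_smul_pair.isClosedMap _ (isOpen_interior.isClosed_compl.prod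
      isClosed_univ)
  have hm : ((m, m) : M × M) ∈
      ((fun p : H × M ↦ (p.1 • p.2, p.2)) '' ((interior U)ᶜ ×ˢ univ))ᶜ := by
    rintro ⟨⟨h, x⟩, ⟨hh, -⟩, hx⟩
    obtain ⟨h1, rfl⟩ := Prod.mk.inj hx
    have := hfree h x h1
    subst this
    exact hh (mem_interior_iff_mem_nhds.2 hU)
  obtain ⟨W₁, hW₁, W₂, hW₂, hW⟩ := mem_nhds_prod_iff.1 (hcl.isOpen_compl.mem_nhds hm)
  refine ⟨W₁ ∩ W₂, inter_mem hW₁ hW₂, fun h x hx hhx ↦ ?_⟩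
  by_contra hU'
  exact hW (show (h • x, x) ∈ W₁ ×ˢ W₂ from ⟨hhx.1, hx.2⟩)
    ⟨(h, x), ⟨fun hi ↦ hU' (interior_subset hi), mem_univ _⟩, rfl⟩

variable {EH EM H M : Type*}
  [NormedAddCommGroup EH] [NormedSpace ℂ EH] [FiniteDimensional ℂ EH]
  [NormedAddCommGroup EM] [NormedSpace ℂ EM] [FiniteDimensional ℂ EM]
  [Group H] [TopologicalSpace H] [ChartedSpace EH H] [LieGroup 𝓘(ℂ, EH) ω H]
  [TopologicalSpace M] [ChartedSpace EM M] [IsManifold 𝓘(ℂ, EM) ω M]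
  [MulAction H M] [ContMDiffSMul 𝓘(ℂ, EH) 𝓘(ℂ, EM) ω H M] [ProperSMul H M]
  {EX : Type*} [NormedAddCommGroup EX] [NormedSpace ℂ EX]

/-- A chart of the orbit space obtained from a slice: the inverse of the chart lifts to
a holomorphic map `sect` into `M`, and `m = quot m • sect (chart [m])` with `quot` holomorphic. -/
structure SliceChart (EH EM H M EX : Type*)
    [NormedAddCommGroup EH] [NormedSpace ℂ EH]
    [NormedAddCommGroup EM] [NormedSpace ℂ EM]
    [Group H] [TopologicalSpace H] [ChartedSpace EH H]
    [TopologicalSpace M] [ChartedSpace EM M] [MulAction H M]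
    [NormedAddCommGroup EX] [NormedSpace ℂ EX] where
  chart : OpenPartialHomeomorph (orbitRel.Quotient H M) EX
  sect : EX → M
  quot : M → H
  holo_sect : ContMDiffOn 𝓘(ℂ, EX) 𝓘(ℂ, EM) ω sect chart.target
  proj_sect : ∀ s ∈ chart.target, orbitProj H M (sect s) = chart.symm s
  holo_chart : ContMDiffOn 𝓘(ℂ, EM) 𝓘(ℂ, EX) ω (fun m ↦ chart (orbitProj H M m))
    (orbitProj H M ⁻¹' chart.source)
  holo_quot : ContMDiffOn 𝓘(ℂ, EM) 𝓘(ℂ, EH) ω quot (orbitProj H M ⁻¹' chart.source)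
  quot_smul : ∀ m, orbitProj H M m ∈ chart.source → quot m • sect (chart (orbitProj H M m)) = m

/-- Around every orbit of a free proper action there is a slice chart. Near `m` the slice coordinate
of a point is determined by the local slice theorem as long as only elements near `1` of the group
are used; properness excludes that other elements map points of a small slice into it. -/
theorem exists_sliceChart [FiniteDimensional ℂ EX]
    (hdim : finrank ℂ EX = finrank ℂ EM - finrank ℂ EH)
    (hfree : ∀ (h : H) (m : M), h • m = m → h = 1) (m : M) :
    ∃ c : SliceChart EH EM H M EX, orbitProj H M m ∈ c.chart.source := by
  classical
  have : ContinuousSMul H M := ContMDiffSMul.continuousSMul (I := 𝓘(ℂ, EH)) (I' := 𝓘(ℂ, EM)) ω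
  obtain ⟨σ, κ, ρ, hσ, hκ, hρ, hσ0, hκ0, hρ0, hκσ, hρσ⟩ :=
    exists_local_slice (EH := EH) (EM := EM) (H := H) (EX := EX) hdim hfree m
  rw [nhds_prod_eq, eventually_prod_iff] at hρσ
  obtain ⟨pU, hU, pS, hS, hρσ⟩ := hρσ
  obtain ⟨W₁, hW₁, hW₁U⟩ := exists_nhds_forall_smul_mem hfree m (U := {h | pU h}) hU
  -- the open neighbourhood `W` of `m` where `κ` and `ρ` are defined, and the slice `σ(S)`
  obtain ⟨W, hW, hWo, hmW⟩ := mem_nhds_iff.1 (hκσ.and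
    ((contMDiffAt_iff_contMDiffAt_nhds (by simp)).1 hκ |>.and
      ((contMDiffAt_iff_contMDiffAt_nhds (by simp)).1 hρ)))
  have hσc : ContinuousAt σ 0 := hσ.continuousAt
  rw [ContinuousAt, hσ0] at hσc
  obtain ⟨S, hSsub, hSo, h0S⟩ := mem_nhds_iff.1 (hS.and
    (((contMDiffAt_iff_contMDiffAt_nhds (by simp)).1 hσ).and
      ((hσc.eventually hW₁).and (hσc.eventually (hWo.mem_nhds hmW)))))
  have huniq : ∀ s ∈ S, ∀ s' ∈ S, ∀ h : H, h • σ s = σ s' → s = s' ∧ h = 1 := by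
    intro s hs s' hs' h hh
    obtain ⟨h1, -, h2, -⟩ := hSsub hs
    obtain ⟨h1', -, h2', -⟩ := hSsub hs'
    have h3 := hρσ (hW₁U h (σ s) h2 (by rw [hh]; exact h2')) h1
    have h4 := hρσ (mem_of_mem_nhds hU) h1'
    simp only [one_smul] at h3 h4
    have h5 : s = s' := by rw [← h3, hh, h4]
    subst h5
    exact ⟨rfl, hfree h _ hh⟩
  -- the saturation `O = H • σ(S)` of the slice, and the decomposition `x = h • σ s`,
  -- `K x = (h, s)`, of its points, which is unique by `huniq`
  let O : Set M := {x | ∃ p : H × EX, p.2 ∈ S ∧ p.1 • σ p.2 = x}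
  let K : M → H × EX := fun x ↦ if hx : x ∈ O then hx.choose else (1, 0)
  have hK : ∀ x ∈ O, (K x).2 ∈ S ∧ (K x).1 • σ (K x).2 = x := fun x hx ↦ by
    simp only [K, dif_pos hx]
    exact hx.choose_spec
  have hKeq : ∀ (h : H), ∀ s ∈ S, K (h • σ s) = (h, s) := by
    intro h s hs
    obtain ⟨h1, h2⟩ := hK (h • σ s) ⟨(h, s), hs, rfl⟩
    obtain ⟨h3, h4⟩ := huniq _ h1 _ hs (h⁻¹ * (K (h • σ s)).1) (by
      rw [mul_smul, h2, inv_smul_smul])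
    exact Prod.ext (inv_mul_eq_one.1 h4).symm h3
  have hOinv : ∀ (h : H), ∀ x ∈ O, h • x ∈ O ∧ (K (h • x)).2 = (K x).2 := by
    rintro h _ ⟨⟨k, s⟩, hs, rfl⟩
    simp only
    rw [smul_smul, hKeq _ _ hs, hKeq _ _ hs]
    exact ⟨⟨(h * k, s), hs, rfl⟩, rfl⟩
  -- near `h • σ s`, the decomposition of `x` is a translate of that given by `κ` and `ρ`
  have hloc : ∀ (h : H), ∀ s ∈ S, ∀ᶠ x in 𝓝 (h • σ s),
      x ∈ O ∧ K x = (h * κ (h⁻¹ • x), ρ (h⁻¹ • x)) := by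
    intro h s hs
    obtain ⟨h1, -, -, h2⟩ := hSsub hs
    have hc : Tendsto (fun x : M ↦ h⁻¹ • x) (𝓝 (h • σ s)) (𝓝 (σ s)) := by
      have : ContinuousAt (fun x : M ↦ h⁻¹ • x) (h • σ s) := by fun_prop
      rwa [ContinuousAt, inv_smul_smul] at this
    have hρs : ρ (σ s) = s := by
      have := hρσ (mem_of_mem_nhds hU) h1
      simpa using this
    have hρc : Tendsto ρ (𝓝 (σ s)) (𝓝 s) := by
      have := (hW h2).2.2.continuousAt
      rwa [ContinuousAt, hρs] at this
    filter_upwards [hc.eventually (hWo.mem_nhds h2),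
      (hρc.comp hc).eventually (hSo.mem_nhds hs)] with x hx hx'
    have h3 : (h * κ (h⁻¹ • x)) • σ (ρ (h⁻¹ • x)) = x := by
      rw [mul_smul, (hW hx).1, smul_inv_smul]
    refine ⟨⟨(h * κ (h⁻¹ • x), ρ (h⁻¹ • x)), hx', h3⟩, ?_⟩
    conv_lhs => rw [← h3]
    exact hKeq _ _ hx'
  have hOo : IsOpen O := isOpen_iff_mem_nhds.2 fun x ⟨⟨h, s⟩, hs, hx⟩ ↦ by
    rw [← hx]
    exact (hloc h s hs).mono fun _ h ↦ h.1
  have hhol : ∀ x ∈ O, ContMDiffAt 𝓘(ℂ, EM) 𝓘(ℂ, EH) ω (fun x ↦ (K x).1) x ∧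
      ContMDiffAt 𝓘(ℂ, EM) 𝓘(ℂ, EX) ω (fun x ↦ (K x).2) x := by
    rintro _ ⟨⟨h, s⟩, hs, rfl⟩
    obtain ⟨-, -, -, h2⟩ := hSsub hs
    have h3 : ContMDiffAt 𝓘(ℂ, EM) 𝓘(ℂ, EM) ω (fun x : M ↦ h⁻¹ • x) (h • σ s) :=
      (ContMDiffSMul.contMDiff_const_smul (I := 𝓘(ℂ, EH)) h⁻¹).contMDiffAt
    have h4 : h⁻¹ • h • σ s = σ s := inv_smul_smul _ _
    constructor
    · refine ContMDiffAt.congr_of_eventuallyEq (f := fun x ↦ h * κ (h⁻¹ • x)) ?_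
        ((hloc h s hs).mono fun x hx ↦ congrArg Prod.fst hx.2)
      exact contMDiffAt_const.mul (ContMDiffAt.comp (h • σ s) (g := κ)
        (by rw [h4]; exact (hW h2).2.1) h3)
    · refine ContMDiffAt.congr_of_eventuallyEq (f := fun x ↦ ρ (h⁻¹ • x)) ?_
        ((hloc h s hs).mono fun x hx ↦ congrArg Prod.snd hx.2)
      exact ContMDiffAt.comp (h • σ s) (g := ρ) (by rw [h4]; exact (hW h2).2.2) h3
  -- the chart of the orbit space is induced by the invariant function `x ↦ (K x).2`
  let e : orbitRel.Quotient H M → EX := Quotient.lift (fun x ↦ (K x).2) (by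
    rintro _ x ⟨h, rfl⟩
    by_cases hx : x ∈ O
    · exact (hOinv h x hx).2
    · have hx' : h • x ∉ O := fun h' ↦ hx (by simpa using (hOinv h⁻¹ _ h').1)
      simp only [K, dif_neg hx, dif_neg hx'])
  have hpre : orbitProj H M ⁻¹' (orbitProj H M '' O) = O := by
    refine Subset.antisymm ?_ (subset_preimage_image _ _)
    rintro x ⟨y, hy, hyx⟩
    obtain ⟨h, rfl⟩ := orbitProj_eq_iff.1 hyx.symm
    exact (hOinv h y hy).1
  have hso : IsOpen (orbitProj H M '' O) := by
    refine isOpen_coinduced.2 ?_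
    change IsOpen (orbitProj H M ⁻¹' _)
    rw [hpre]
    exact hOo
  have hcont : ContinuousOn σ S := fun s hs ↦
    (hSsub hs).2.1.continuousAt.continuousWithinAt
  let ch : OpenPartialHomeomorph (orbitRel.Quotient H M) EX :=
    { toFun := e
      invFun := fun s ↦ orbitProj H M (σ s)
      source := orbitProj H M '' O
      target := S
      map_source' := by
        rintro _ ⟨x, hx, rfl⟩
        exact (hK x hx).1
      map_target' := fun s hs ↦ ⟨σ s, ⟨(1, s), hs, one_smul _ _⟩, rfl⟩
      left_inv' := by
        rintro _ ⟨x, hx, rfl⟩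
        exact (orbitProj_eq_iff (H := H)).2 ⟨(K x).1⁻¹, inv_smul_eq_iff.2 (hK x hx).2.symm⟩
      right_inv' := fun s hs ↦ by
        have := hKeq 1 s hs
        rw [one_smul] at this
        exact congrArg Prod.snd this
      open_source := hso
      open_target := hSo
      continuousOn_toFun := by
        refine (continuousOn_open_iff hso).2 fun V hV ↦ isOpen_coinduced.2 ?_
        have h1 : IsOpen (O ∩ (fun x ↦ (K x).2) ⁻¹' V) :=
          ContinuousOn.isOpen_inter_preimage
            (fun x hx ↦ (hhol x hx).2.continuousAt.continuousWithinAt) hOo hV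
        have h2 : Quotient.mk (orbitRel H M) ⁻¹' (orbitProj H M '' O ∩ e ⁻¹' V) =
            O ∩ (fun x ↦ (K x).2) ⁻¹' V := by
          rw [preimage_inter]
          exact congrArg₂ _ hpre rfl
        exact h2 ▸ h1
      continuousOn_invFun := continuous_quotient_mk'.comp_continuousOn hcont }
  refine ⟨⟨ch, σ, fun x ↦ (K x).1, fun s hs ↦ (hSsub hs).2.1.contMDiffWithinAt,
    fun s hs ↦ rfl, ?_, ?_, ?_⟩, m, ⟨(1, 0), h0S, ?_⟩, rfl⟩
  · intro x hx
    have hx' : x ∈ O := hpre ▸ hx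
    exact (hhol x hx').2.contMDiffWithinAt
  · intro x hx
    have hx' : x ∈ O := hpre ▸ hx
    exact (hhol x hx').1.contMDiffWithinAt
  · intro x hx
    have hx' : x ∈ O := hpre ▸ hx
    exact (hK x hx').2
  · rw [one_smul, hσ0]

/-- A holomorphic local section `sect` of `M → M/H` over an open set, together with the holomorphic
map `quot` that compares it with the points of `M`. -/
structure LocalSection (EH EM EX H M : Type*)
    [NormedAddCommGroup EH] [NormedSpace ℂ EH]
    [NormedAddCommGroup EM] [NormedSpace ℂ EM]
    [Group H] [TopologicalSpace H] [ChartedSpace EH H]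
    [TopologicalSpace M] [ChartedSpace EM M] [MulAction H M]
    [NormedAddCommGroup EX] [NormedSpace ℂ EX] [ChartedSpace EX (orbitRel.Quotient H M)] where
  dom : Set (orbitRel.Quotient H M)
  isOpen_dom : IsOpen dom
  sect : orbitRel.Quotient H M → M
  quot : M → H
  holo_sect : ContMDiffOn 𝓘(ℂ, EX) 𝓘(ℂ, EM) ω sect dom
  proj_sect : ∀ x ∈ dom, orbitProj H M (sect x) = x
  holo_quot : ContMDiffOn 𝓘(ℂ, EM) 𝓘(ℂ, EH) ω quot (orbitProj H M ⁻¹' dom)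
  quot_smul : ∀ m, orbitProj H M m ∈ dom → quot m • sect (orbitProj H M m) = m

/-- The orbit space of a free proper holomorphic action is a complex manifold, with holomorphic
projection and holomorphic local sections through every point. -/
theorem exists_complexStructure [FiniteDimensional ℂ EX]
    (hdim : finrank ℂ EX = finrank ℂ EM - finrank ℂ EH)
    (hfree : ∀ (h : H) (m : M), h • m = m → h = 1) :
    ∃ (_ : ChartedSpace EX (orbitRel.Quotient H M))
      (_ : IsManifold 𝓘(ℂ, EX) ω (orbitRel.Quotient H M)),
      ContMDiff 𝓘(ℂ, EM) 𝓘(ℂ, EX) ω (orbitProj H M) ∧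
      ∀ m : M, ∃ s : LocalSection EH EM EX H M,
        orbitProj H M m ∈ s.dom ∧ s.sect (orbitProj H M m) = m := by
  have hx : ∀ x : orbitRel.Quotient H M, ∃ c : SliceChart EH EM H M EX, x ∈ c.chart.source :=
    fun x ↦ Quotient.inductionOn x fun m ↦ exists_sliceChart hdim hfree m
  choose c hc using hx
  let inst : ChartedSpace EX (orbitRel.Quotient H M) :=
    { atlas := range fun x ↦ (c x).chart
      chartAt := fun x ↦ (c x).chart
      mem_chart_source := hc
      chart_mem_atlas := fun x ↦ ⟨x, rfl⟩ }
  have hman : IsManifold 𝓘(ℂ, EX) ω (orbitRel.Quotient H M) := by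
    refine isManifold_of_contDiffOn _ _ _ ?_
    rintro _ _ ⟨x, rfl⟩ ⟨y, rfl⟩
    simp only [modelWithCornersSelf_coe, modelWithCornersSelf_coe_symm, Function.id_comp,
      Function.comp_id, preimage_id, range_id, inter_univ]
    rw [← contMDiffOn_iff_contDiffOn]
    have h1 : ContMDiffOn 𝓘(ℂ, EX) 𝓘(ℂ, EX) ω
        (fun s ↦ (c y).chart (orbitProj H M ((c x).sect s)))
        ((c x).chart.symm ≫ₕ (c y).chart).source := by
      refine (c y).holo_chart.comp ((c x).holo_sect.mono fun s hs ↦ hs.1) fun s hs ↦ ?_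
      change orbitProj H M ((c x).sect s) ∈ (c y).chart.source
      rw [(c x).proj_sect s hs.1]
      exact hs.2
    refine h1.congr fun s hs ↦ ?_
    simp only [(c x).proj_sect s hs.1]
    rfl
  have hchart : ∀ x, (c x).chart ∈ IsManifold.maximalAtlas 𝓘(ℂ, EX) ω (orbitRel.Quotient H M) :=
    fun x ↦ IsManifold.chart_mem_maximalAtlas x
  have hproj : ContMDiff 𝓘(ℂ, EM) 𝓘(ℂ, EX) ω (orbitProj H M) := by
    intro m
    have hopen : IsOpen (orbitProj H M ⁻¹' (c (orbitProj H M m)).chart.source) :=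
      (c (orbitProj H M m)).chart.open_source.preimage continuous_quotient_mk'
    have h1 := (contMDiffOn_symm_of_mem_maximalAtlas (hchart (orbitProj H M m))).comp
      (c (orbitProj H M m)).holo_chart fun x hx ↦ (c (orbitProj H M m)).chart.map_source hx
    have h2 := h1.contMDiffAt (hopen.mem_nhds (hc (orbitProj H M m)))
    refine h2.congr_of_eventuallyEq ?_
    filter_upwards [hopen.mem_nhds (hc (orbitProj H M m))] with x hx
    exact ((c (orbitProj H M m)).chart.left_inv hx).symm
  refine ⟨inst, hman, hproj, fun m ↦ ?_⟩
  let d := c (orbitProj H M m)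
  have hd : orbitProj H M m ∈ d.chart.source := hc _
  -- the section of the slice chart is translated so that it passes through `m`
  refine ⟨⟨d.chart.source, d.chart.open_source, fun x ↦ d.quot m • d.sect (d.chart x),
    fun m' ↦ d.quot m' * (d.quot m)⁻¹, ?_, ?_, ?_, ?_⟩, hd, d.quot_smul m hd⟩
  · have h1 : ContMDiffOn 𝓘(ℂ, EX) 𝓘(ℂ, EM) ω (fun x ↦ d.sect (d.chart x)) d.chart.source :=
      d.holo_sect.comp (contMDiffOn_of_mem_maximalAtlas (hchart _)) fun x hx ↦
        d.chart.map_source hx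
    exact ContMDiffOn.smul (I := 𝓘(ℂ, EH)) (f := fun _ ↦ d.quot m) contMDiffOn_const h1
  · intro x hx
    rw [orbitProj_smul, d.proj_sect _ (d.chart.map_source hx), d.chart.left_inv hx]
  · exact d.holo_quot.mul contMDiffOn_const
  · intro m' hm'
    rw [mul_smul, inv_smul_smul, d.quot_smul m' hm']

/-- The differential of the projection and that of a local section compose to the identity. -/
theorem LocalSection.mfderiv_proj_mfderiv_sect [ChartedSpace EX (orbitRel.Quotient H M)]
    (hproj : ContMDiff 𝓘(ℂ, EM) 𝓘(ℂ, EX) ω (orbitProj H M)) (s : LocalSection EH EM EX H M)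
    {x : orbitRel.Quotient H M} (hx : x ∈ s.dom) (w : TangentSpace 𝓘(ℂ, EX) x) :
    mfderiv 𝓘(ℂ, EM) 𝓘(ℂ, EX) (orbitProj H M) (s.sect x)
      (mfderiv 𝓘(ℂ, EX) 𝓘(ℂ, EM) s.sect x w) = (w : EX) := by
  have h1 : ContMDiffAt 𝓘(ℂ, EX) 𝓘(ℂ, EM) ω s.sect x :=
    s.holo_sect.contMDiffAt (s.isOpen_dom.mem_nhds hx)
  have h2 := mfderiv_comp x (hproj.contMDiffAt.mdifferentiableAt (by simp))
    (h1.mdifferentiableAt (by simp))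
  have h3 : orbitProj H M ∘ s.sect =ᶠ[𝓝 x] id := by
    filter_upwards [s.isOpen_dom.mem_nhds hx] with y hy using s.proj_sect y hy
  have h4 := DFunLike.congr_fun (h2.symm.trans h3.mfderiv_eq) w
  rw [mfderiv_id] at h4
  exact h4

/-- The projection is a submersion, and `G` acts holomorphically on `M/H`, since `M → M/H` has
holomorphic local sections through every point; the Hausdorff property is that of orbit spaces of
proper actions. -/
theorem isQuotientManifold {EG G : Type*} [NormedAddCommGroup EG] [NormedSpace ℂ EG]
    [Group G] [TopologicalSpace G] [ChartedSpace EG G]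
    [MulAction G M] [ContMDiffSMul 𝓘(ℂ, EG) 𝓘(ℂ, EM) ω G M] [SMulCommClass G H M] [T2Space M]
    [ChartedSpace EX (orbitRel.Quotient H M)] [IsManifold 𝓘(ℂ, EX) ω (orbitRel.Quotient H M)]
    (hproj : ContMDiff 𝓘(ℂ, EM) 𝓘(ℂ, EX) ω (orbitProj H M))
    (hsec : ∀ m : M, ∃ s : LocalSection EH EM EX H M,
        orbitProj H M m ∈ s.dom ∧ s.sect (orbitProj H M m) = m) :
    IsQuotientManifold EX EG EM G H M where
  isManifold := inferInstance
  t2Space := t2Space_quotient_mulAction_of_properSMul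
  holomorphic_proj := hproj
  submersion m w := by
    obtain ⟨s, hs, hsm⟩ := hsec m
    have h := s.mfderiv_proj_mfderiv_sect hproj hs w
    rw [hsm] at h
    exact ⟨_, h⟩
  holomorphic_smul := by
    refine ⟨fun ⟨g, x⟩ ↦ ?_⟩
    induction x using Quotient.inductionOn with | _ m => ?_
    obtain ⟨s, hs, -⟩ := hsec m
    have h1 : ContMDiffAt (𝓘(ℂ, EG).prod 𝓘(ℂ, EX)) 𝓘(ℂ, EM) ω
        (fun p : G × orbitRel.Quotient H M ↦ s.sect p.2) (g, orbitProj H M m) :=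
      ContMDiffAt.comp (g, orbitProj H M m) (g := s.sect) (f := Prod.snd)
        (s.holo_sect.contMDiffAt (s.isOpen_dom.mem_nhds hs)) contMDiffAt_snd
    have h2 : ContMDiffAt (𝓘(ℂ, EG).prod 𝓘(ℂ, EX)) 𝓘(ℂ, EM) ω
        (fun p : G × orbitRel.Quotient H M ↦ p.1 • s.sect p.2) (g, orbitProj H M m) :=
      ContMDiffAt.smul (I := 𝓘(ℂ, EG)) contMDiffAt_fst h1
    refine (hproj.contMDiffAt.comp _ h2).congr_of_eventuallyEq ?_
    have h3 : ∀ᶠ p : G × orbitRel.Quotient H M in 𝓝 (g, orbitProj H M m), p.2 ∈ s.dom :=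
      continuousAt_snd.preimage_mem_nhds (s.isOpen_dom.mem_nhds hs)
    filter_upwards [h3] with p hp
    conv_lhs => rw [← s.proj_sect p.2 hp]
    rfl

end QuotientManifold

/-! ### Holomorphic group actions on vector bundles -/

section BundleActions

variable {EB : Type*} [NormedAddCommGroup EB] [NormedSpace ℂ EB]
  {B : Type*} [TopologicalSpace B] [ChartedSpace EB B]
  {F₀ : Type*} [NormedAddCommGroup F₀] [NormedSpace ℂ F₀]
  {F : B → Type*} [∀ x, AddCommGroup (F x)] [∀ x, Module ℂ (F x)]

/-- The preferred local trivialization of a holomorphic vector bundle, as a linear equivalence. -/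
def HolomorphicBundle.coordEquiv (A : HolomorphicBundle EB F₀ F) {x₀ x : B} (hx : x ∈ A.dom x₀) :
    F x ≃ₗ[ℂ] F₀ :=
  { A.coord x₀ x with
    invFun := A.frame x₀ x
    left_inv := HolomorphicBundle.frame_coord hx
    right_inv := HolomorphicBundle.coord_frame hx }

/-- A lift of an action of `K` on `B` to a holomorphic vector bundle over `B` that is an action on
the total space and holomorphic; holomorphy is tested on local frames. Identities between vectors
over propositionally equal points are expressed in the total space. -/
structure IsHolomorphicAction {K : Type*} [Group K] [MulAction K B] (EK : Type*)
    [NormedAddCommGroup EK] [NormedSpace ℂ EK] [TopologicalSpace K] [ChartedSpace EK K]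
    (A : HolomorphicBundle EB F₀ F) (a : FibreAction K F) : Prop where
  one_smul : ∀ (x : B) (e : F x), (⟨(1 : K) • x, a 1 x e⟩ : TotalSpace F₀ F) = ⟨x, e⟩
  mul_smul : ∀ (k l : K) (x : B) (e : F x),
    (⟨(k * l) • x, a (k * l) x e⟩ : TotalSpace F₀ F) = ⟨k • l • x, a k (l • x) (a l x e)⟩
  holoAt_frame : ∀ (k : K) (x : B) (v : F₀), A.HoloAt (𝓘(ℂ, EK).prod (𝓘(ℂ, EB).prod 𝓘(ℂ, F₀)))
    (fun p : K × B × F₀ ↦ ⟨p.1 • p.2.1, a p.1 p.2.1 (A.frame x p.2.1 p.2.2)⟩) (k, x, v)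

variable {EN : Type*} [NormedAddCommGroup EN] [NormedSpace ℂ EN] {HN : Type*} [TopologicalSpace HN]
  {I : ModelWithCorners ℂ EN HN} {N : Type*} [TopologicalSpace N] [ChartedSpace HN N]

theorem IsHolomorphicAction.holoAt {K : Type*} [Group K] [MulAction K B] {EK : Type*}
    [NormedAddCommGroup EK] [NormedSpace ℂ EK] [TopologicalSpace K] [ChartedSpace EK K]
    {A : HolomorphicBundle EB F₀ F} {a : FibreAction K F} (ha : IsHolomorphicAction EK A a)
    {k : N → K} {g : N → B} {e : ∀ y, F (g y)} {n : N} (hk : ContMDiffAt I 𝓘(ℂ, EK) ω k n)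
    (he : A.HoloAt I (fun y ↦ ⟨g y, e y⟩) n) :
    A.HoloAt I (fun y ↦ ⟨k y • g y, a (k y) (g y) (e y)⟩) n := by
  have h1 := HolomorphicBundle.HoloAt.comp
    (g := fun y ↦ (k y, g y, A.coord (g n) (g y) (e y))) (n := n) (ha.holoAt_frame (k n) (g n) _)
    (hk.prodMk (he.proj.prodMk (he.coord (A.mem_dom (g n)))))
  refine h1.congr ?_
  filter_upwards [HolomorphicBundle.eventually_mem_dom he.proj.continuousAt (A.mem_dom (g n))]
    with y hy
  simp only [HolomorphicBundle.frame_coord hy]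

end BundleActions

/-! ### The fibres of a quotient bundle -/

section QuotientFibre

variable {H M : Type*} [Group H] [MulAction H M] {F : M → Type*}
  [∀ m, AddCommGroup (F m)] [∀ m, Module ℂ (F m)] (a : FibreAction H F)

open Classical in
/-- The value at `m` of an element of the fibre of `F/H` at `x` (zero unless `m` lies in the
orbit `x`). -/
def fibreVal (x : orbitRel.Quotient H M) (m : M) : quotientFibre a x →ₗ[ℂ] F m :=
  if h : orbitProj H M m = x then
    LinearMap.proj (R := ℂ) (φ := fun m : {m : M // orbitProj H M m = x} ↦ F m) ⟨m, h⟩ ∘ₗ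
      (quotientFibre a x).subtype
  else 0

variable {a}

theorem fibreVal_apply {x : orbitRel.Quotient H M} {m : M} (h : orbitProj H M m = x)
    (t : quotientFibre a x) : fibreVal a x m t = t.1 ⟨m, h⟩ := by
  rw [fibreVal, dif_pos h]
  rfl

theorem fibreVal_smul {x : orbitRel.Quotient H M} {m : M} (hm : orbitProj H M m = x) (h : H)
    (t : quotientFibre a x) : fibreVal a x (h • m) t = a h m (fibreVal a x m t) := by
  rw [fibreVal_apply hm, fibreVal_apply ((orbitProj_smul h m).trans hm)]
  exact t.2 h ⟨m, hm⟩

theorem fibreVal_injective {x : orbitRel.Quotient H M} {m : M} (hm : orbitProj H M m = x) :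
    Function.Injective (fibreVal a x m) := by
  intro t t' h
  ext ⟨m', hm'⟩
  obtain ⟨k, rfl⟩ := orbitProj_eq_iff.1 (hm'.trans hm.symm)
  rw [← fibreVal_apply hm' t, ← fibreVal_apply hm' t', fibreVal_smul hm, fibreVal_smul hm, h]

/-- An `H`-equivariant family along an orbit can be prescribed at one point, as the action is
free. -/
theorem fibreVal_surjective {F₀ : Type*} (hfree : ∀ (h : H) (m : M), h • m = m → h = 1)
    (hone : ∀ (m : M) (e : F m), (⟨(1 : H) • m, a 1 m e⟩ : TotalSpace F₀ F) = ⟨m, e⟩)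
    (hmul : ∀ (k l : H) (m : M) (e : F m),
      (⟨(k * l) • m, a (k * l) m e⟩ : TotalSpace F₀ F) = ⟨k • l • m, a k (l • m) (a l m e)⟩)
    {x : orbitRel.Quotient H M} {m : M} (hm : orbitProj H M m = x) :
    Function.Surjective (fibreVal a x m) := by
  intro f
  have hex : ∀ m' : {m' : M // orbitProj H M m' = x}, ∃ h : H, h • m = m'.1 := fun m' ↦
    orbitProj_eq_iff.1 (m'.2.trans hm.symm)
  -- the value at `k m' • m = m'` must be the translate of `f` by `k m'`
  choose k hk using hex
  have hval : ∀ m' : {m' : M // orbitProj H M m' = x}, ∃ e : F m',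
      (⟨m'.1, e⟩ : TotalSpace F₀ F) = ⟨k m' • m, a (k m') m f⟩ := by
    rintro ⟨m', hm'⟩
    have := hk ⟨m', hm'⟩
    generalize k ⟨m', hm'⟩ = l at this ⊢
    simp only at this ⊢
    subst this
    exact ⟨_, rfl⟩
  choose e he using hval
  have hmem : e ∈ quotientFibre a x := by
    intro h m'
    -- the element `k` is unique, hence equivariant
    have h1 : k ⟨h • m'.1, (orbitProj_smul h m'.1).trans m'.2⟩ = h * k m' := by
      rw [← inv_mul_eq_one, ← mul_assoc]
      refine (hfree _ m ?_)
      rw [mul_smul, hk m', mul_smul, inv_smul_eq_iff, hk]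
    have h2 := he ⟨h • m'.1, (orbitProj_smul h m'.1).trans m'.2⟩
    rw [h1, hmul] at h2
    have h3 : (⟨h • k m' • m, a h (k m' • m) (a (k m') m f)⟩ : TotalSpace F₀ F) =
        ⟨h • m'.1, a h m'.1 (e m')⟩ := by
      have := congrArg (fun p : TotalSpace F₀ F ↦
        (⟨h • p.proj, a h p.proj p.snd⟩ : TotalSpace F₀ F)) (he m')
      exact this.symm
    exact (TotalSpace.mk_inj).1 (h2.trans h3)
  refine ⟨⟨e, hmem⟩, ?_⟩
  rw [fibreVal_apply hm]
  have h1 := he ⟨m, hm⟩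
  rw [hfree _ m (hk ⟨m, hm⟩), hone] at h1
  exact TotalSpace.mk_inj.1 h1

end QuotientFibre

/-! ### Quotients of equivariant bundles -/

section QuotientBundles

set_option linter.unusedSectionVars false

open HolomorphicBundle

variable {EX EH EM EG G H M : Type*}
  [NormedAddCommGroup EX] [NormedSpace ℂ EX]
  [NormedAddCommGroup EH] [NormedSpace ℂ EH]
  [NormedAddCommGroup EM] [NormedSpace ℂ EM]
  [NormedAddCommGroup EG] [NormedSpace ℂ EG]
  [Group G] [TopologicalSpace G] [ChartedSpace EG G]
  [Group H] [TopologicalSpace H] [ChartedSpace EH H] [LieGroup 𝓘(ℂ, EH) ω H]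
  [TopologicalSpace M] [ChartedSpace EM M] [IsManifold 𝓘(ℂ, EM) ω M]
  [MulAction G M] [ContMDiffSMul 𝓘(ℂ, EG) 𝓘(ℂ, EM) ω G M]
  [MulAction H M] [SMulCommClass G H M]
  [ChartedSpace EX (orbitRel.Quotient H M)] [IsManifold 𝓘(ℂ, EX) ω (orbitRel.Quotient H M)]
  {F₀ : Type*} [NormedAddCommGroup F₀] [NormedSpace ℂ F₀] [FiniteDimensional ℂ F₀]
  {F : M → Type*} [∀ m, AddCommGroup (F m)] [∀ m, Module ℂ (F m)]
  {A : HolomorphicBundle EM F₀ F} {aG : FibreAction G F} {aH : FibreAction H F}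

/-- The evaluation at a point of the orbit, as a linear equivalence. -/
def fibreEquiv (hfree : ∀ (h : H) (m : M), h • m = m → h = 1)
    (ha : IsHolomorphicAction EH A aH) {x : orbitRel.Quotient H M} {m : M}
    (hm : orbitProj H M m = x) : quotientFibre aH x ≃ₗ[ℂ] F m :=
  LinearEquiv.ofBijective (fibreVal aH x m)
    ⟨fibreVal_injective hm, fibreVal_surjective hfree ha.one_smul ha.mul_smul hm⟩

theorem fibreVal_fibreEquiv_symm (hfree : ∀ (h : H) (m : M), h • m = m → h = 1)
    (ha : IsHolomorphicAction EH A aH) {x : orbitRel.Quotient H M} {m : M}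
    (hm : orbitProj H M m = x) (f : F m) :
    fibreVal aH x m ((fibreEquiv hfree ha hm).symm f) = f :=
  (fibreEquiv hfree ha hm).apply_symm_apply f

section

variable {EN : Type*} [NormedAddCommGroup EN] [NormedSpace ℂ EN] {HN : Type*} [TopologicalSpace HN]
  {I : ModelWithCorners ℂ EN HN} {N : Type*} [TopologicalSpace N] [ChartedSpace HN N]

/-- The values of a family of elements of `F/H` along two lifts to `M` of a family of points of
`M/H` are holomorphic simultaneously, if the lifts differ by a holomorphic map to `H`. -/
theorem HolomorphicBundle.HoloAt.fibreVal_smul (ha : IsHolomorphicAction EH A aH) {m m' : N → M}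
    {k : N → H} {g : N → orbitRel.Quotient H M} {t : ∀ y, quotientFibre aH (g y)} {n : N}
    (h : A.HoloAt I (fun y ↦ ⟨m y, fibreVal aH (g y) (m y) (t y)⟩) n)
    (hk : ContMDiffAt I 𝓘(ℂ, EH) ω k n) (hm : ∀ᶠ y in 𝓝 n, orbitProj H M (m y) = g y)
    (hkm : ∀ᶠ y in 𝓝 n, k y • m y = m' y) :
    A.HoloAt I (fun y ↦ ⟨m' y, fibreVal aH (g y) (m' y) (t y)⟩) n := by
  refine (ha.holoAt hk h).congr ?_
  filter_upwards [hm, hkm] with y h1 h2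
  rw [← h2, _root_.fibreVal_smul h1]

end

/-- Coordinates on `F/H`: over the domain of a local section of `M → M/H`, an element of `F/H` is
given by its value along the section, which is described in a local trivialization of `F`. -/
def quotientAtlas (hfree : ∀ (h : H) (m : M), h • m = m → h = 1)
    (ha : IsHolomorphicAction EH A aH)
    (hproj : Continuous (orbitProj H M))
    (σ : orbitRel.Quotient H M → LocalSection EH EM EX H M) (hσ : ∀ x, x ∈ (σ x).dom) :
    BundleAtlas EX F₀ (fun x : orbitRel.Quotient H M ↦ quotientFibre aH x) where
  dom x₀ := (σ x₀).dom ∩ (σ x₀).sect ⁻¹' A.dom ((σ x₀).sect x₀)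
  isOpen_dom x₀ := (σ x₀).holo_sect.continuousOn.isOpen_inter_preimage (σ x₀).isOpen_dom
    (A.isOpen_dom _)
  mem_dom x := ⟨hσ x, A.mem_dom _⟩
  coordEquiv x₀ x hx :=
    (fibreEquiv hfree ha ((σ x₀).proj_sect x hx.1)).trans (A.coordEquiv hx.2)
  holomorphic := by
    intro x₀ x₁ f hf v x hx
    refine ContMDiffAt.contMDiffWithinAt ?_
    obtain ⟨⟨h1, h2⟩, h3, h4⟩ := hx
    have hs₀ : ContMDiffAt 𝓘(ℂ, EX) 𝓘(ℂ, EM) ω (σ x₀).sect x :=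
      (σ x₀).holo_sect.contMDiffAt ((σ x₀).isOpen_dom.mem_nhds h1)
    have hs₁ : ContMDiffAt 𝓘(ℂ, EX) 𝓘(ℂ, EM) ω (σ x₁).sect x :=
      (σ x₁).holo_sect.contMDiffAt ((σ x₁).isOpen_dom.mem_nhds h3)
    have hdom : ∀ᶠ y in 𝓝 x, y ∈ (σ x₀).dom ∩ (σ x₀).sect ⁻¹' A.dom ((σ x₀).sect x₀) ∧
        y ∈ (σ x₁).dom ∩ (σ x₁).sect ⁻¹' A.dom ((σ x₁).sect x₁) :=
      ((Filter.Eventually.and ((σ x₀).isOpen_dom.mem_nhds h1) (hs₀.continuousAt.preimage_mem_nhds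
        ((A.isOpen_dom _).mem_nhds h2)))).and (Filter.Eventually.and ((σ x₁).isOpen_dom.mem_nhds h3)
        (hs₁.continuousAt.preimage_mem_nhds ((A.isOpen_dom _).mem_nhds h4)))
    -- two local sections differ by a holomorphic map to `H`
    have hk : ContMDiffAt 𝓘(ℂ, EX) 𝓘(ℂ, EH) ω (fun y ↦ (σ x₀).quot ((σ x₁).sect y)) x :=
      ContMDiffAt.comp x ((σ x₀).holo_quot.contMDiffAt
        (((σ x₀).isOpen_dom.preimage hproj).mem_nhds
          (by rwa [mem_preimage, (σ x₁).proj_sect x h3]))) hs₁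
    classical
    let t : ∀ y, quotientFibre aH y := fun y ↦
      if h : orbitProj H M ((σ x₀).sect y) = y then
        (fibreEquiv hfree ha h).symm (A.frame ((σ x₀).sect x₀) ((σ x₀).sect y) v) else 0
    have ht : ∀ y ∈ (σ x₀).dom, fibreVal aH y ((σ x₀).sect y) (t y) =
        A.frame ((σ x₀).sect x₀) ((σ x₀).sect y) v := fun y hy ↦ by
      simp only [t, dif_pos ((σ x₀).proj_sect y hy), fibreVal_fibreEquiv_symm]
    have hA : A.HoloAt 𝓘(ℂ, EX)
        (fun y ↦ ⟨(σ x₀).sect y, fibreVal aH y ((σ x₀).sect y) (t y)⟩) x := by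
      refine (holoAt_frame hs₀ (contMDiffAt_const (c := v)) h2).congr ?_
      filter_upwards [hdom] with y hy
      rw [ht y hy.1.1]
    have hB := (hA.fibreVal_smul ha hk (hdom.mono fun y hy ↦ (σ x₀).proj_sect y hy.1.1)
      (m' := (σ x₁).sect) (hdom.mono fun y hy ↦ ?_)).coord h4
    · refine hB.congr_of_eventuallyEq ?_
      filter_upwards [hdom] with y hy
      rw [hf y hy.1 hy.2]
      simp only [t, dif_pos ((σ x₀).proj_sect y hy.1.1)]
      rfl
    · have := (σ x₀).quot_smul ((σ x₁).sect y)
        (by rw [(σ x₁).proj_sect y hy.2.1]; exact hy.1.1)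
      rwa [(σ x₁).proj_sect y hy.2.1] at this

/-- The holomorphic structure of `F/H` is characterized by its relation to that of `F`: a family of
elements of `F/H` is holomorphic if and only if its values along a holomorphic lift to `M` of the
family of base points are holomorphic. -/
theorem holoAt_quotientAtlas_iff {EN : Type*} [NormedAddCommGroup EN] [NormedSpace ℂ EN]
    {HN : Type*} [TopologicalSpace HN] {I : ModelWithCorners ℂ EN HN} {N : Type*}
    [TopologicalSpace N] [ChartedSpace HN N]
    (hfree : ∀ (h : H) (m : M), h • m = m → h = 1) (ha : IsHolomorphicAction EH A aH)
    (hproj : ContMDiff 𝓘(ℂ, EM) 𝓘(ℂ, EX) ω (orbitProj H M))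
    (σ : orbitRel.Quotient H M → LocalSection EH EM EX H M) (hσ : ∀ x, x ∈ (σ x).dom)
    {m : N → M} {g : N → orbitRel.Quotient H M} {t : ∀ y, quotientFibre aH (g y)} {n : N}
    (hm : ContMDiffAt I 𝓘(ℂ, EM) ω m n) (hmg : ∀ᶠ y in 𝓝 n, orbitProj H M (m y) = g y) :
    (quotientAtlas hfree ha hproj.continuous σ hσ).toBundle.HoloAt I (fun y ↦ ⟨g y, t y⟩) n ↔
      A.HoloAt I (fun y ↦ ⟨m y, fibreVal aH (g y) (m y) (t y)⟩) n := by
  set Z := quotientAtlas hfree ha hproj.continuous σ hσ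
  set s := σ (g n)
  have hg : ContMDiffAt I 𝓘(ℂ, EX) ω g n :=
    (hproj.contMDiffAt.comp n hm).congr_of_eventuallyEq (hmg.mono fun y hy ↦ hy.symm)
  have hgs : ∀ᶠ y in 𝓝 n, g y ∈ s.dom := hg.continuousAt (s.isOpen_dom.mem_nhds (hσ _))
  have hsg : ContMDiffAt I 𝓘(ℂ, EM) ω (fun y ↦ s.sect (g y)) n :=
    ContMDiffAt.comp n (s.holo_sect.contMDiffAt (s.isOpen_dom.mem_nhds (hσ _))) hg
  have hk : ContMDiffAt I 𝓘(ℂ, EH) ω (fun y ↦ s.quot (m y)) n :=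
    ContMDiffAt.comp n (s.holo_quot.contMDiffAt ((s.isOpen_dom.preimage hproj.continuous).mem_nhds
      (by rw [mem_preimage, hmg.self_of_nhds]; exact hσ _))) hm
  have hkm : ∀ᶠ y in 𝓝 n, s.quot (m y) • s.sect (g y) = m y := by
    filter_upwards [hmg, hgs] with y h1 h2
    have := s.quot_smul (m y) (by rwa [h1])
    rwa [h1] at this
  have key : A.HoloAt I (fun y ↦ ⟨s.sect (g y), fibreVal aH (g y) (s.sect (g y)) (t y)⟩) n ↔
      A.HoloAt I (fun y ↦ ⟨m y, fibreVal aH (g y) (m y) (t y)⟩) n := by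
    refine ⟨fun h ↦ h.fibreVal_smul ha hk (hgs.mono fun y hy ↦ s.proj_sect _ hy) hkm,
      fun h ↦ h.fibreVal_smul ha hk.inv hmg (hkm.mono fun y hy ↦ ?_)⟩
    rw [inv_smul_eq_iff, hy]
  rw [← key, holoAt_iff (A := Z.toBundle) (x₀ := g n) (Z.mem_dom _),
    holoAt_iff (A := A) (x₀ := s.sect (g n)) (A.mem_dom _)]
  refine and_congr ⟨fun _ ↦ hsg, fun _ ↦ hg⟩ (EventuallyEq.contMDiffAt_iff ?_)
  filter_upwards [eventually_mem_dom (A := Z.toBundle) hg.continuousAt (Z.mem_dom (g n))] with y hy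
  exact Z.toBundle_coord hy _

/-- The action of `G` on the fibres of `F/H`, computed at a representative of the orbit. -/
def quotientAction (hfree : ∀ (h : H) (m : M), h • m = m → h = 1)
    (ha : IsHolomorphicAction EH A aH) (aG : FibreAction G F) :
    FibreAction G (fun x : orbitRel.Quotient H M ↦ quotientFibre aH x) := fun g x ↦
  (fibreEquiv hfree ha (m := g • x.out) (congrArg (g • ·) x.out_eq)).symm.toLinearMap ∘ₗ
    aG g x.out ∘ₗ fibreVal aH x x.out

theorem fibreVal_quotientAction (hfree : ∀ (h : H) (m : M), h • m = m → h = 1)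
    (ha : IsHolomorphicAction EH A aH)
    (hcomm : ∀ (g : G) (h : H) (m : M) (f : F m),
      (⟨g • h • m, aG g (h • m) (aH h m f)⟩ : TotalSpace F₀ F) =
        ⟨h • g • m, aH h (g • m) (aG g m f)⟩)
    (g : G) {x : orbitRel.Quotient H M} {m : M} (hm : orbitProj H M m = x)
    (t : quotientFibre aH x) :
    fibreVal aH (g • x) (g • m) (quotientAction hfree ha aG g x t) =
      aG g m (fibreVal aH x m t) := by
  obtain ⟨h, rfl⟩ := orbitProj_eq_iff.1 (hm.trans x.out_eq.symm)
  have h1 : (⟨g • h • x.out,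
      fibreVal aH (g • x) (g • h • x.out) (quotientAction hfree ha aG g x t)⟩ :
      TotalSpace F₀ F) =
      ⟨h • g • x.out, fibreVal aH (g • x) (h • g • x.out) (quotientAction hfree ha aG g x t)⟩ := by
    rw [smul_comm]
  have hgx : orbitProj H M (g • x.out) = g • x := congrArg (g • ·) x.out_eq
  have h2 : fibreVal aH (g • x) (g • x.out) (quotientAction hfree ha aG g x t) =
      aG g x.out (fibreVal aH x x.out t) := fibreVal_fibreEquiv_symm hfree ha hgx _
  rw [fibreVal_smul hgx, h2, ← hcomm, ← fibreVal_smul x.out_eq] at h1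
  exact TotalSpace.mk_inj.1 h1

/-- The quotient of an equivariant holomorphic vector bundle by a free action with holomorphic
local sections. -/
def quotientBundle (hfree : ∀ (h : H) (m : M), h • m = m → h = 1)
    (ha : IsHolomorphicAction EH A aH) (haG : IsHolomorphicAction EG A aG)
    (hcomm : ∀ (g : G) (h : H) (m : M) (f : F m),
      (⟨g • h • m, aG g (h • m) (aH h m f)⟩ : TotalSpace F₀ F) =
        ⟨h • g • m, aH h (g • m) (aG g m f)⟩)
    (hproj : ContMDiff 𝓘(ℂ, EM) 𝓘(ℂ, EX) ω (orbitProj H M))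
    (σ : orbitRel.Quotient H M → LocalSection EH EM EX H M) (hσ : ∀ x, x ∈ (σ x).dom) :
    QuotientBundle EX EG A aG aH where
  bundle := (quotientAtlas hfree ha hproj.continuous σ hσ).toBundle
  quotMap m := (fibreEquiv hfree ha rfl).symm
  quotMap_apply m f :=
    (fibreVal_apply rfl _).symm.trans (fibreVal_fibreEquiv_symm hfree ha rfl f)
  holomorphic_quotMap := holomorphicMap_of_frame fun m v ↦ by
    refine (holoAt_quotientAtlas_iff hfree ha hproj σ hσ (m := Prod.fst) contMDiffAt_fst
      (Eventually.of_forall fun _ ↦ rfl)).2 ?_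
    simp only [fibreVal_fibreEquiv_symm]
    exact holoAt_frame contMDiffAt_fst contMDiffAt_snd (A.mem_dom m)
  action := quotientAction hfree ha aG
  action_quotMap g m f := by
    refine fibreVal_injective (m := g • m) rfl ?_
    refine (fibreVal_quotientAction hfree ha hcomm g rfl _).trans ?_
    rw [fibreVal_fibreEquiv_symm]
    exact (fibreVal_fibreEquiv_symm hfree ha rfl _).symm
  holomorphic_action := by
    set Q := (quotientAtlas hfree ha hproj.continuous σ hσ).toBundle with hQ
    let := Q.totalTopology
    let := Q.fibreTopology
    let := Q.fibreBundle
    rintro ⟨g, e⟩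
    set s := σ e.proj with hs
    have hid : Q.HoloAt (𝓘(ℂ, EG).prod (𝓘(ℂ, EX).prod 𝓘(ℂ, F₀)))
        (fun p : G × TotalSpace F₀ (fun x : orbitRel.Quotient H M ↦ quotientFibre aH x) ↦
          ⟨p.2.proj, p.2.snd⟩) (g, e) := contMDiffAt_snd
    have hdom : ∀ᶠ p : G × TotalSpace F₀ (fun x : orbitRel.Quotient H M ↦ quotientFibre aH x) in
        𝓝 (g, e), p.2.proj ∈ s.dom :=
      hid.proj.continuousAt (s.isOpen_dom.mem_nhds (hσ _))
    have hsect : ContMDiffAt (𝓘(ℂ, EG).prod (𝓘(ℂ, EX).prod 𝓘(ℂ, F₀))) 𝓘(ℂ, EM) ω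
        (fun p : G × TotalSpace F₀ (fun x : orbitRel.Quotient H M ↦ quotientFibre aH x) ↦
          s.sect p.2.proj) (g, e) :=
      ContMDiffAt.comp (g, e) (s.holo_sect.contMDiffAt (s.isOpen_dom.mem_nhds (hσ _))) hid.proj
    have hA := (holoAt_quotientAtlas_iff hfree ha hproj σ hσ hsect
      (hdom.mono fun p hp ↦ s.proj_sect _ hp)).1 hid
    have hk : ContMDiffAt (𝓘(ℂ, EG).prod (𝓘(ℂ, EX).prod 𝓘(ℂ, F₀))) 𝓘(ℂ, EG) ω
        (Prod.fst : G × TotalSpace F₀ (fun x : orbitRel.Quotient H M ↦ quotientFibre aH x) → G)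
        (g, e) := contMDiffAt_fst
    refine (holoAt_quotientAtlas_iff hfree ha hproj σ hσ (hk.smul hsect)
      (hdom.mono fun p hp ↦ congrArg (p.1 • ·) (s.proj_sect _ hp))).2 ?_
    refine (haG.holoAt hk hA).congr ?_
    filter_upwards [hdom] with p hp
    exact congrArg (TotalSpace.mk (p.1 • s.sect p.2.proj))
      (fibreVal_quotientAction hfree ha hcomm p.1 (s.proj_sect _ hp) p.2.snd)

variable (EH) in
/-- The values of the local frames of `F/H` along local sections of `M → M/H` are holomorphic. -/
def QuotientBundle.HoloEval (Q : QuotientBundle EX EG A aG aH) : Prop :=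
  ∀ (s : LocalSection EH EM EX H M) (x : orbitRel.Quotient H M) (v : F₀), x ∈ s.dom →
    A.HoloAt (𝓘(ℂ, EX).prod 𝓘(ℂ, F₀)) (fun p : orbitRel.Quotient H M × F₀ ↦
      ⟨s.sect p.1, fibreVal aH p.1 (s.sect p.1) (Q.bundle.frame x p.1 p.2)⟩) (x, v)

theorem exists_quotientBundle (hfree : ∀ (h : H) (m : M), h • m = m → h = 1)
    (ha : IsHolomorphicAction EH A aH) (haG : IsHolomorphicAction EG A aG)
    (hcomm : ∀ (g : G) (h : H) (m : M) (f : F m),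
      (⟨g • h • m, aG g (h • m) (aH h m f)⟩ : TotalSpace F₀ F) =
        ⟨h • g • m, aH h (g • m) (aG g m f)⟩)
    (hproj : ContMDiff 𝓘(ℂ, EM) 𝓘(ℂ, EX) ω (orbitProj H M))
    (hsec : ∀ m : M, ∃ s : LocalSection EH EM EX H M,
      orbitProj H M m ∈ s.dom ∧ s.sect (orbitProj H M m) = m) :
    ∃ Q : QuotientBundle EX EG A aG aH, Q.HoloEval EH := by
  have hex : ∀ x : orbitRel.Quotient H M, ∃ s : LocalSection EH EM EX H M, x ∈ s.dom :=
    fun x ↦ Quotient.inductionOn x fun m ↦ (hsec m).imp fun s hs ↦ hs.1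
  choose σ hσ using hex
  refine ⟨quotientBundle hfree ha haG hcomm hproj σ hσ, fun s x v hx ↦ ?_⟩
  have hfst : ContMDiffAt (𝓘(ℂ, EX).prod 𝓘(ℂ, F₀)) 𝓘(ℂ, EX) ω
      (Prod.fst : orbitRel.Quotient H M × F₀ → _) (x, v) := contMDiffAt_fst
  have hdom : ∀ᶠ p : orbitRel.Quotient H M × F₀ in 𝓝 (x, v), p.1 ∈ s.dom :=
    hfst.continuousAt (s.isOpen_dom.mem_nhds hx)
  have hsect : ContMDiffAt (𝓘(ℂ, EX).prod 𝓘(ℂ, F₀)) 𝓘(ℂ, EM) ω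
      (fun p : orbitRel.Quotient H M × F₀ ↦ s.sect p.1) (x, v) :=
    ContMDiffAt.comp (x, v) (g := s.sect)
      (s.holo_sect.contMDiffAt (s.isOpen_dom.mem_nhds hx)) hfst
  refine (holoAt_quotientAtlas_iff hfree ha hproj σ hσ hsect
    (hdom.mono fun p hp ↦ s.proj_sect _ hp)).1 ?_
  exact holoAt_frame hfst contMDiffAt_snd (HolomorphicBundle.mem_dom _ x)

end QuotientBundles

/-! ### Tensor products of line bundles -/

section Tensor

open HolomorphicBundle

variable {EB : Type*} [NormedAddCommGroup EB] [NormedSpace ℂ EB]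
  {B : Type*} [TopologicalSpace B] [ChartedSpace EB B]
  {F F' : Type*} [NormedAddCommGroup F] [NormedSpace ℂ F]
  [NormedAddCommGroup F'] [NormedSpace ℂ F']
  {L L' : B → Type*} [∀ x, AddCommGroup (L x)] [∀ x, Module ℂ (L x)]
  [∀ x, AddCommGroup (L' x)] [∀ x, Module ℂ (L' x)]
  {A : HolomorphicBundle EB F L} {A' : HolomorphicBundle EB F' L'}

theorem HolomorphicBundle.coordEquiv_apply {x₀ x : B} (hx : x ∈ A.dom x₀) (e : L x) :
    A.coordEquiv hx e = A.coord x₀ x e := rfl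

theorem HolomorphicBundle.coordEquiv_symm_apply {x₀ x : B} (hx : x ∈ A.dom x₀) (v : F) :
    (A.coordEquiv hx).symm v = A.frame x₀ x v := rfl

/-- The coordinates `l ⊗ l' ↦ α(l) β(l')` on the tensor product of two line bundles. -/
def lineTensorAtlas (A : HolomorphicBundle EB F L) (A' : HolomorphicBundle EB F' L')
    [FiniteDimensional ℂ F] [FiniteDimensional ℂ F']
    (α : F ≃ₗ[ℂ] ℂ) (β : F' ≃ₗ[ℂ] ℂ) :
    BundleAtlas EB ℂ (fun x ↦ L x ⊗[ℂ] L' x) where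
  dom x₀ := A.dom x₀ ∩ A'.dom x₀
  isOpen_dom x₀ := (A.isOpen_dom x₀).inter (A'.isOpen_dom x₀)
  mem_dom x := ⟨A.mem_dom x, A'.mem_dom x⟩
  coordEquiv x₀ x hx := (TensorProduct.congr ((A.coordEquiv hx.1).trans α)
    ((A'.coordEquiv hx.2).trans β)).trans (TensorProduct.lid ℂ ℂ)
  holomorphic := by
    rintro x₀ x₁ f hf v x ⟨h₀, h₁⟩
    refine ContMDiffAt.contMDiffWithinAt ?_
    have h1 : ContMDiffAt 𝓘(ℂ, EB) 𝓘(ℂ, F) ω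
        (fun y ↦ A.coord x₁ y (A.frame x₀ y (α.symm v))) x :=
      (holoAt_frame contMDiffAt_id contMDiffAt_const h₀.1).coord h₁.1
    have h2 : ContMDiffAt 𝓘(ℂ, EB) 𝓘(ℂ, F') ω
        (fun y ↦ A'.coord x₁ y (A'.frame x₀ y (β.symm 1))) x :=
      (holoAt_frame contMDiffAt_id contMDiffAt_const h₀.2).coord h₁.2
    have h3 := ((LinearMap.toContinuousLinearMap α.toLinearMap).contMDiff.contMDiffAt.comp x h1).mul
      ((LinearMap.toContinuousLinearMap β.toLinearMap).contMDiff.contMDiffAt.comp x h2)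
    refine h3.congr_of_eventuallyEq ?_
    filter_upwards [(A.isOpen_dom x₀).mem_nhds h₀.1, (A'.isOpen_dom x₀).mem_nhds h₀.2,
      (A.isOpen_dom x₁).mem_nhds h₁.1, (A'.isOpen_dom x₁).mem_nhds h₁.2] with y a b c d
    rw [hf y ⟨a, b⟩ ⟨c, d⟩]
    have hv : (TensorProduct.lid ℂ ℂ).symm v = v ⊗ₜ[ℂ] (1 : ℂ) := by
      rw [LinearEquiv.symm_apply_eq]; simp
    simp only [LinearMap.comp_apply, LinearEquiv.coe_coe, LinearEquiv.trans_symm,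
      LinearEquiv.trans_apply, hv, TensorProduct.congr_symm_tmul, TensorProduct.congr_tmul,
      TensorProduct.lid_tmul, coordEquiv_apply, coordEquiv_symm_apply]
    rfl

theorem lineTensorAtlas_coordEquiv_tmul [FiniteDimensional ℂ F] [FiniteDimensional ℂ F']
    (α : F ≃ₗ[ℂ] ℂ) (β : F' ≃ₗ[ℂ] ℂ) {x₀ x : B}
    (hx : x ∈ A.dom x₀ ∩ A'.dom x₀) (l : L x) (l' : L' x) :
    (lineTensorAtlas A A' α β).coordEquiv x₀ x hx (l ⊗ₜ l') =
      α (A.coord x₀ x l) * β (A'.coord x₀ x l') := by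
  change TensorProduct.lid ℂ ℂ (TensorProduct.congr _ _ (l ⊗ₜ l')) = _
  rw [TensorProduct.congr_tmul, TensorProduct.lid_tmul]
  rfl

/-- The tensor product of two line bundles exists, and it has the tensor products of local frames
as local frames. -/
theorem exists_lineTensorBundle (A : HolomorphicBundle EB F L) (A' : HolomorphicBundle EB F' L')
    (hF : finrank ℂ F = 1) (hF' : finrank ℂ F' = 1) :
    ∃ (T : LineTensorBundle A A') (a : F) (b : F'), ∀ x, ∀ᶠ y in 𝓝 x, ∀ c : ℂ,
      T.bundle.frame x y c = A.frame x y (c • a) ⊗ₜ A'.frame x y b := by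
  have : FiniteDimensional ℂ F := FiniteDimensional.of_finrank_eq_succ hF
  have : FiniteDimensional ℂ F' := FiniteDimensional.of_finrank_eq_succ hF'
  let α : F ≃ₗ[ℂ] ℂ := LinearEquiv.ofFinrankEq F ℂ (by rw [hF, finrank_self])
  let β : F' ≃ₗ[ℂ] ℂ := LinearEquiv.ofFinrankEq F' ℂ (by rw [hF', finrank_self])
  set Z := lineTensorAtlas A A' α β with hZ
  refine ⟨⟨Z.toBundle, ?_⟩, α.symm 1, β.symm 1, fun x ↦ ?_⟩
  · let := A.totalTopology
    let := A.fibreTopology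
    let := A.fibreBundle
    have := A.vectorBundle
    have := A.holomorphic
    let := A'.totalTopology
    let := A'.fibreTopology
    let := A'.fibreBundle
    have := A'.vectorBundle
    have := A'.holomorphic
    intro p
    have hid : ContMDiffAt (𝓘(ℂ, EB).prod 𝓘(ℂ, F × F')) (𝓘(ℂ, EB).prod 𝓘(ℂ, F × F')) ω
        (fun p : TotalSpace (F × F') (L ×ᵇ L') ↦ p) p := contMDiffAt_id
    rw [contMDiffAt_totalSpace] at hid
    obtain ⟨h1, h2⟩ := hid
    have h3 : ContMDiffAt (𝓘(ℂ, EB).prod 𝓘(ℂ, F × F')) 𝓘(ℂ, F) ω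
        (fun q : TotalSpace (F × F') (L ×ᵇ L') ↦ A.coord p.proj q.proj q.snd.1) p := by
      refine ((contDiff_fst (𝕜 := ℂ) (n := ω)).contMDiff.contMDiffAt.comp p
        h2).congr_of_eventuallyEq ?_
      filter_upwards [eventually_mem_dom h1.continuousAt (A.mem_dom p.proj)] with q hq
      exact congrFun ((trivializationAt F L p.proj).coe_linearMapAt_of_mem (R := ℂ) hq) _
    have h4 : ContMDiffAt (𝓘(ℂ, EB).prod 𝓘(ℂ, F × F')) 𝓘(ℂ, F') ω
        (fun q : TotalSpace (F × F') (L ×ᵇ L') ↦ A'.coord p.proj q.proj q.snd.2) p := by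
      refine ((contDiff_snd (𝕜 := ℂ) (n := ω)).contMDiff.contMDiffAt.comp p
        h2).congr_of_eventuallyEq ?_
      filter_upwards [eventually_mem_dom h1.continuousAt (A'.mem_dom p.proj)] with q hq
      exact congrFun ((trivializationAt F' L' p.proj).coe_linearMapAt_of_mem (R := ℂ) hq) _
    refine (holoAt_iff (A := Z.toBundle) (f := fun q : TotalSpace (F × F') (L ×ᵇ L') ↦
      ⟨q.proj, q.snd.1 ⊗ₜ[ℂ] q.snd.2⟩) (x₀ := p.proj) (Z.mem_dom p.proj)).2 ⟨h1, ?_⟩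
    have h5 := ((LinearMap.toContinuousLinearMap α.toLinearMap).contMDiff.contMDiffAt.comp p h3).mul
      ((LinearMap.toContinuousLinearMap β.toLinearMap).contMDiff.contMDiffAt.comp p h4)
    refine h5.congr_of_eventuallyEq ?_
    filter_upwards [eventually_mem_dom (A := Z.toBundle) h1.continuousAt (Z.mem_dom p.proj)]
      with q hq
    exact (Z.toBundle_coord hq _).trans (lineTensorAtlas_coordEquiv_tmul α β hq _ _)
  · filter_upwards [(Z.isOpen_dom x).mem_nhds (Z.mem_dom x)] with y hy c
    rw [Z.toBundle_frame hy, LinearEquiv.symm_apply_eq, lineTensorAtlas_coordEquiv_tmul α β hy,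
      coord_frame hy.1, coord_frame hy.2]
    simp

end Tensor

/-! ### Actions on product, tangent and canonical bundles -/

section StandardActions

set_option linter.unusedSectionVars false

open HolomorphicBundle

variable {K L EK EL : Type*} [NormedAddCommGroup EK] [NormedSpace ℂ EK]
  [Group K] [TopologicalSpace K] [ChartedSpace EK K]
  [NormedAddCommGroup EL] [NormedSpace ℂ EL]
  [Group L] [TopologicalSpace L] [ChartedSpace EL L]
  {EB : Type*} [NormedAddCommGroup EB] [NormedSpace ℂ EB]
  {B : Type*} [TopologicalSpace B] [ChartedSpace EB B]
  [MulAction K B] [MulAction L B]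

theorem isHolomorphicAction_repAction {V : Type*} [NormedAddCommGroup V] [NormedSpace ℂ V]
    [FiniteDimensional ℂ V] [ContMDiffSMul 𝓘(ℂ, EK) 𝓘(ℂ, EB) ω K B] {ρ : Representation ℂ K V}
    (hρ : ∀ v, ContMDiff 𝓘(ℂ, EK) 𝓘(ℂ, V) ω fun k ↦ ρ k v) :
    IsHolomorphicAction EK (productBundle EB B V) (repAction B ρ) where
  one_smul x e := by
    simp only [repAction, map_one]
    exact congrArg (fun y : B ↦ (⟨y, e⟩ : TotalSpace V (Trivial B V))) (one_smul K x)
  mul_smul k l x e := by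
    simp only [repAction, map_mul]
    exact congrArg (fun y : B ↦ (⟨y, ρ k (ρ l e)⟩ : TotalSpace V (Trivial B V))) (mul_smul k l x)
  holoAt_frame k x v := by
    have hfst : ContMDiffAt (𝓘(ℂ, EK).prod (𝓘(ℂ, EB).prod 𝓘(ℂ, V))) 𝓘(ℂ, EK) ω
      (Prod.fst : K × B × V → K) (k, x, v) := contMDiffAt_fst
    have h1 : (productBundle EB B V).HoloAt (𝓘(ℂ, EK).prod (𝓘(ℂ, EB).prod 𝓘(ℂ, V)))
        (fun p : K × B × V ↦ ⟨p.2.1, (productBundle EB B V).frame x p.2.1 p.2.2⟩) (k, x, v) :=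
      holoAt_frame (contMDiffAt_fst.comp _ contMDiffAt_snd)
        (contMDiffAt_snd.comp _ contMDiffAt_snd) (mem_dom _ x)
    have h2 := holoAt_productBundle_iff.1 h1
    refine holoAt_productBundle_iff.2 ⟨hfst.smul h2.1, ?_⟩
    have h3 : ContMDiffAt (𝓘(ℂ, EK).prod (𝓘(ℂ, EB).prod 𝓘(ℂ, V))) 𝓘(ℂ, V →L[ℂ] V) ω
        (fun p : K × B × V ↦ LinearMap.toContinuousLinearMap (ρ p.1)) (k, x, v) :=
      contMDiffAt_clm_of_apply fun w ↦ (hρ w).contMDiffAt.comp (k, x, v) hfst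
    exact h3.clm_apply h2.2

/-- A trivial action on the fibre commutes with every representation. -/
theorem repAction_one_comm [SMulCommClass L K B] {V : Type*} [AddCommGroup V] [Module ℂ V]
    (ρ : Representation ℂ K V) (l : L) (k : K) (x : B) (e : V) :
    (⟨l • k • x, repAction B (1 : Representation ℂ L V) l (k • x) (repAction B ρ k x e)⟩ :
      TotalSpace V (Trivial B V)) =
      ⟨k • l • x, repAction B ρ k (l • x) (repAction B (1 : Representation ℂ L V) l x e)⟩ :=
  congrArg (fun y : B ↦ (⟨y, ρ k e⟩ : TotalSpace V (Trivial B V))) (smul_comm l k x)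

section Tangent

variable (EK) in
theorem contMDiff_smul_left [ContMDiffSMul 𝓘(ℂ, EK) 𝓘(ℂ, EB) ω K B] (k : K) :
    ContMDiff 𝓘(ℂ, EB) 𝓘(ℂ, EB) ω fun y : B ↦ k • y :=
  ContMDiff.smul (I := 𝓘(ℂ, EK)) contMDiff_const contMDiff_id

variable (EK) in
theorem mdifferentiable_smul_left [ContMDiffSMul 𝓘(ℂ, EK) 𝓘(ℂ, EB) ω K B] (k : K) :
    MDifferentiable 𝓘(ℂ, EB) 𝓘(ℂ, EB) fun y : B ↦ k • y :=
  (contMDiff_smul_left EK k).mdifferentiable (by simp)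

theorem tangentAction_one_smul (x : B) (v : TangentSpace 𝓘(ℂ, EB) x) :
    (⟨(1 : K) • x, tangentAction K B EB 1 x v⟩ : TangentBundle 𝓘(ℂ, EB) B) = ⟨x, v⟩ := by
  change tangentMap 𝓘(ℂ, EB) 𝓘(ℂ, EB) (fun y : B ↦ (1 : K) • y) ⟨x, v⟩ = _
  have : (fun y : B ↦ (1 : K) • y) = id := funext fun y ↦ one_smul K y
  rw [this, tangentMap_id]
  rfl

variable (EK) in
theorem tangentAction_mul_smul [ContMDiffSMul 𝓘(ℂ, EK) 𝓘(ℂ, EB) ω K B] (k l : K) (x : B)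
    (v : TangentSpace 𝓘(ℂ, EB) x) :
    (⟨(k * l) • x, tangentAction K B EB (k * l) x v⟩ : TangentBundle 𝓘(ℂ, EB) B) =
      ⟨k • l • x, tangentAction K B EB k (l • x) (tangentAction K B EB l x v)⟩ := by
  change tangentMap 𝓘(ℂ, EB) 𝓘(ℂ, EB) (fun y : B ↦ (k * l) • y) ⟨x, v⟩ = _
  have : (fun y : B ↦ (k * l) • y) = (fun y ↦ k • y) ∘ fun y ↦ l • y :=
    funext fun y ↦ mul_smul k l y
  rw [this, tangentMap_comp (mdifferentiable_smul_left EK k) (mdifferentiable_smul_left EK l)]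
  rfl

variable (EK EL) in
theorem tangentAction_comm [ContMDiffSMul 𝓘(ℂ, EK) 𝓘(ℂ, EB) ω K B]
    [ContMDiffSMul 𝓘(ℂ, EL) 𝓘(ℂ, EB) ω L B] [SMulCommClass L K B] (l : L) (k : K) (x : B)
    (v : TangentSpace 𝓘(ℂ, EB) x) :
    (⟨l • k • x, tangentAction L B EB l (k • x) (tangentAction K B EB k x v)⟩ :
      TangentBundle 𝓘(ℂ, EB) B) =
      ⟨k • l • x, tangentAction K B EB k (l • x) (tangentAction L B EB l x v)⟩ := by
  change (tangentMap 𝓘(ℂ, EB) 𝓘(ℂ, EB) (fun y : B ↦ l • y) ∘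
    tangentMap 𝓘(ℂ, EB) 𝓘(ℂ, EB) (fun y : B ↦ k • y)) ⟨x, v⟩ =
    (tangentMap 𝓘(ℂ, EB) 𝓘(ℂ, EB) (fun y : B ↦ k • y) ∘
      tangentMap 𝓘(ℂ, EB) 𝓘(ℂ, EB) (fun y : B ↦ l • y)) ⟨x, v⟩
  rw [← tangentMap_comp (mdifferentiable_smul_left EK k) (mdifferentiable_smul_left EL l),
    ← tangentMap_comp (mdifferentiable_smul_left EL l) (mdifferentiable_smul_left EK k)]
  have : ((fun y : B ↦ l • y) ∘ fun y ↦ k • y) = (fun y ↦ k • y) ∘ fun y ↦ l • y :=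
    funext fun y ↦ smul_comm l k y
  rw [this]

theorem isHolomorphicAction_tangentAction [ContMDiffSMul 𝓘(ℂ, EK) 𝓘(ℂ, EB) ω K B]
    [IsManifold 𝓘(ℂ, EK) ω K] [IsManifold 𝓘(ℂ, EB) ω B] :
    IsHolomorphicAction EK (tangentBundle EB B) (tangentAction K B EB) where
  one_smul := tangentAction_one_smul
  mul_smul := tangentAction_mul_smul EK
  holoAt_frame k x v := by
    refine holoAt_mfderiv (f := fun (p : K × B × EB) (y : B) ↦ p.1 • y) (g := fun p ↦ p.2.1) ?_ ?_
    · have h1 : ContMDiffAt ((𝓘(ℂ, EK).prod (𝓘(ℂ, EB).prod 𝓘(ℂ, EB))).prod 𝓘(ℂ, EB)) 𝓘(ℂ, EK) ω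
        (fun p : (K × B × EB) × B ↦ p.1.1) ((k, x, v), x) := contMDiffAt_fst.comp _ contMDiffAt_fst
      exact h1.smul contMDiffAt_snd
    · exact holoAt_frame (contMDiffAt_fst.comp _ contMDiffAt_snd)
        (contMDiffAt_snd.comp _ contMDiffAt_snd) (mem_dom _ x)

variable (EK) in
theorem isInvertible_mfderiv_smul [ContMDiffSMul 𝓘(ℂ, EK) 𝓘(ℂ, EB) ω K B] (k : K) (x : B) :
    (mfderiv 𝓘(ℂ, EB) 𝓘(ℂ, EB) (fun y : B ↦ k • y) x).IsInvertible := by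
  have key : ∀ (k l : K) (x y : B), k • x = y → l * k = 1 → ∀ v : EB,
      (mfderiv 𝓘(ℂ, EB) 𝓘(ℂ, EB) (fun y : B ↦ l • y) y : EB → EB)
        ((mfderiv 𝓘(ℂ, EB) 𝓘(ℂ, EB) (fun y : B ↦ k • y) x : EB → EB) v) = v := by
    intro k l x y hxy hlk v
    have h1 := mfderiv_comp_apply_of_eq x (mdifferentiable_smul_left EK l y)
      (mdifferentiable_smul_left EK k x) hxy v
    have h2 : ((fun y : B ↦ l • y) ∘ fun y ↦ k • y) = id :=
      funext fun y ↦ by simp [← mul_smul, hlk]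
    rw [h2, mfderiv_id] at h1
    exact h1.symm
  exact ⟨ContinuousLinearEquiv.equivOfInverse _
    (mfderiv 𝓘(ℂ, EB) 𝓘(ℂ, EB) (fun y : B ↦ k⁻¹ • y) (k • x))
    (key k k⁻¹ x _ rfl (inv_mul_cancel k))
    (key k⁻¹ k _ _ (inv_smul_smul k x) (mul_inv_cancel k)), rfl⟩

variable (EK) in
theorem surjective_tangentAction [ContMDiffSMul 𝓘(ℂ, EK) 𝓘(ℂ, EB) ω K B] (k : K) (x : B) :
    Function.Surjective (tangentAction K B EB k x) := by
  obtain ⟨e, he⟩ := isInvertible_mfderiv_smul EK (EB := EB) k x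
  intro w
  refine ⟨e.symm w, ?_⟩
  change mfderiv 𝓘(ℂ, EB) 𝓘(ℂ, EB) (fun y : B ↦ k • y) x _ = w
  rw [← he]
  exact e.apply_symm_apply w

variable (EK) in
theorem inverse_tangentAction [ContMDiffSMul 𝓘(ℂ, EK) 𝓘(ℂ, EB) ω K B] (k : K) (x : B)
    (v : TangentSpace 𝓘(ℂ, EB) x) :
    (mfderiv 𝓘(ℂ, EB) 𝓘(ℂ, EB) (fun y : B ↦ k • y) x).inverse (tangentAction K B EB k x v) = v :=
  (isInvertible_mfderiv_smul EK k x).inverse_apply_eq.2 rfl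

/-- The action on top forms is characterized by its duality to the action on tangent vectors. -/
theorem canonicalAction_apply_tangentAction (EK : Type*) [NormedAddCommGroup EK] [NormedSpace ℂ EK]
    [ChartedSpace EK K] [ContMDiffSMul 𝓘(ℂ, EK) 𝓘(ℂ, EB) ω K B]
    (k : K) (x : B) (η : CanonicalFibre EB x)
    (v : Fin (finrank ℂ EB) → TangentSpace 𝓘(ℂ, EB) x) :
    canonicalAction K B EB k x η (fun i ↦ tangentAction K B EB k x (v i)) = η v := by
  refine congrArg η (funext fun i ↦ ?_)
  exact inverse_tangentAction EK k x (v i)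

/-- Equality of top forms at propositionally equal points. -/
theorem canonicalFibre_mk_eq {x y : B} (h : x = y) {η : CanonicalFibre EB x}
    {θ : CanonicalFibre EB y}
    (hη : ∀ (v : Fin (finrank ℂ EB) → TangentSpace 𝓘(ℂ, EB) x)
      (w : Fin (finrank ℂ EB) → TangentSpace 𝓘(ℂ, EB) y),
      (∀ i, (⟨x, v i⟩ : TangentBundle 𝓘(ℂ, EB) B) = ⟨y, w i⟩) → η v = θ w) :
    (⟨x, η⟩ : TotalSpace (EB [⋀^Fin (finrank ℂ EB)]→L[ℂ] ℂ) fun x : B ↦ CanonicalFibre EB x) =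
      ⟨y, θ⟩ := by
  subst h
  refine congrArg (TotalSpace.mk x) (ContinuousAlternatingMap.ext fun v ↦ ?_)
  exact hη v v fun _ ↦ rfl

theorem exists_tangentAction_eq (EK : Type*) [NormedAddCommGroup EK] [NormedSpace ℂ EK]
    [ChartedSpace EK K] [ContMDiffSMul 𝓘(ℂ, EK) 𝓘(ℂ, EB) ω K B] {ι : Type*} (k : K) (x : B)
    (w : ι → TangentSpace 𝓘(ℂ, EB) (k • x)) :
    ∃ v : ι → TangentSpace 𝓘(ℂ, EB) x, w = fun i ↦ tangentAction K B EB k x (v i) := by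
  choose v hv using fun i ↦ surjective_tangentAction EK k x (w i)
  exact ⟨v, funext fun i ↦ (hv i).symm⟩

theorem canonicalAction_comm (EK EL : Type*) [NormedAddCommGroup EK] [NormedSpace ℂ EK]
    [ChartedSpace EK K] [NormedAddCommGroup EL] [NormedSpace ℂ EL] [ChartedSpace EL L]
    [ContMDiffSMul 𝓘(ℂ, EK) 𝓘(ℂ, EB) ω K B]
    [ContMDiffSMul 𝓘(ℂ, EL) 𝓘(ℂ, EB) ω L B] [SMulCommClass L K B] (l : L) (k : K) (x : B)
    (η : CanonicalFibre EB x) :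
    (⟨l • k • x, canonicalAction L B EB l (k • x) (canonicalAction K B EB k x η)⟩ :
      TotalSpace (EB [⋀^Fin (finrank ℂ EB)]→L[ℂ] ℂ) fun x : B ↦ CanonicalFibre EB x) =
      ⟨k • l • x, canonicalAction K B EB k (l • x) (canonicalAction L B EB l x η)⟩ := by
  refine canonicalFibre_mk_eq (smul_comm l k x) fun v w hvw ↦ ?_
  obtain ⟨v, rfl⟩ := exists_tangentAction_eq EL l (k • x) v
  obtain ⟨v, rfl⟩ := exists_tangentAction_eq EK k x v
  have hw : w = fun i ↦ tangentAction K B EB k (l • x) (tangentAction L B EB l x (v i)) :=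
    funext fun i ↦ TotalSpace.mk_inj.1 ((hvw i).symm.trans (tangentAction_comm EK EL l k x (v i)))
  rw [hw, canonicalAction_apply_tangentAction EL, canonicalAction_apply_tangentAction EK,
    canonicalAction_apply_tangentAction EK, canonicalAction_apply_tangentAction EL]

theorem isHolomorphicAction_canonicalAction [FiniteDimensional ℂ EB]
    [ContMDiffSMul 𝓘(ℂ, EK) 𝓘(ℂ, EB) ω K B]
    [LieGroup 𝓘(ℂ, EK) ω K] [IsManifold 𝓘(ℂ, EB) ω B] :
    IsHolomorphicAction EK (canonicalBundle EB B) (canonicalAction K B EB) where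
  one_smul x η := by
    refine canonicalFibre_mk_eq (one_smul K x) fun v w hvw ↦ ?_
    obtain ⟨v, rfl⟩ := exists_tangentAction_eq EK (1 : K) x v
    rw [canonicalAction_apply_tangentAction EK]
    exact congrArg η (funext fun i ↦
      TotalSpace.mk_inj.1 ((tangentAction_one_smul x (v i)).symm.trans (hvw i)))
  mul_smul k l x η := by
    refine canonicalFibre_mk_eq (mul_smul k l x) fun v w hvw ↦ ?_
    obtain ⟨v, rfl⟩ := exists_tangentAction_eq EK (k * l) x v
    have hw : w = fun i ↦ tangentAction K B EB k (l • x) (tangentAction K B EB l x (v i)) :=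
      funext fun i ↦ TotalSpace.mk_inj.1
        ((hvw i).symm.trans (tangentAction_mul_smul EK k l x (v i)))
    rw [hw, canonicalAction_apply_tangentAction EK, canonicalAction_apply_tangentAction EK,
      canonicalAction_apply_tangentAction EK]
  holoAt_frame k x ζ := by
    set I := 𝓘(ℂ, EK).prod (𝓘(ℂ, EB).prod 𝓘(ℂ, EB [⋀^Fin (finrank ℂ EB)]→L[ℂ] ℂ)) with hI
    have hk : ContMDiffAt I 𝓘(ℂ, EK) ω
        (Prod.fst : K × B × (EB [⋀^Fin (finrank ℂ EB)]→L[ℂ] ℂ) → K) (k, x, ζ) := contMDiffAt_fst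
    have hx : ContMDiffAt I 𝓘(ℂ, EB) ω
        (fun p : K × B × (EB [⋀^Fin (finrank ℂ EB)]→L[ℂ] ℂ) ↦ p.2.1) (k, x, ζ) :=
      contMDiffAt_fst.comp _ contMDiffAt_snd
    have hkx : ContMDiffAt I 𝓘(ℂ, EB) ω
        (fun p : K × B × (EB [⋀^Fin (finrank ℂ EB)]→L[ℂ] ℂ) ↦ p.1 • p.2.1) (k, x, ζ) :=
      hk.smul hx
    have hη : (canonicalBundle EB B).HoloAt I
        (fun p : K × B × (EB [⋀^Fin (finrank ℂ EB)]→L[ℂ] ℂ) ↦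
          ⟨p.2.1, (canonicalBundle EB B).frame x p.2.1 p.2.2⟩) (k, x, ζ) :=
      holoAt_frame hx (contMDiffAt_snd.comp _ contMDiffAt_snd) (mem_dom _ x)
    have hv : ∀ i, (tangentBundle EB B).HoloAt I
        (fun p : K × B × (EB [⋀^Fin (finrank ℂ EB)]→L[ℂ] ℂ) ↦ ⟨p.2.1,
          (mfderiv 𝓘(ℂ, EB) 𝓘(ℂ, EB) (fun y : B ↦ p.1 • y) p.2.1).inverse
            ((tangentBundle EB B).frame (k • x) (p.1 • p.2.1) (finBasis ℂ EB i))⟩) (k, x, ζ) := by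
      intro i
      have hf : (tangentBundle EB B).HoloAt I
          (fun p : K × B × (EB [⋀^Fin (finrank ℂ EB)]→L[ℂ] ℂ) ↦ ⟨p.1 • p.2.1,
            (tangentBundle EB B).frame (k • x) (p.1 • p.2.1) (finBasis ℂ EB i)⟩) (k, x, ζ) :=
        holoAt_frame hkx (contMDiffAt_const (c := finBasis ℂ EB i)) (mem_dom _ _)
      have hw := (isHolomorphicAction_tangentAction (EK := EK) (K := K) (B := B) (EB := EB)).holoAt
        hk.inv hf
      refine hw.congr (Eventually.of_forall fun p ↦ ?_)
      obtain ⟨v, hv⟩ := surjective_tangentAction EK (EB := EB) p.1 p.2.1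
        ((tangentBundle EB B).frame (k • x) (p.1 • p.2.1) (finBasis ℂ EB i))
      change (⟨p.2.1, (mfderiv 𝓘(ℂ, EB) 𝓘(ℂ, EB) (fun y : B ↦ p.1 • y) p.2.1).inverse
          ((tangentBundle EB B).frame (k • x) (p.1 • p.2.1) (finBasis ℂ EB i))⟩ :
            TangentBundle 𝓘(ℂ, EB) B) = ⟨p.1⁻¹ • p.1 • p.2.1,
          tangentAction K B EB p.1⁻¹ (p.1 • p.2.1)
            ((tangentBundle EB B).frame (k • x) (p.1 • p.2.1) (finBasis ℂ EB i))⟩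
      rw [← hv, inverse_tangentAction EK, ← tangentAction_mul_smul EK, inv_mul_cancel]
      exact (tangentAction_one_smul _ v).symm
    have h := hη.form_apply hv
    exact holoAt_canonicalBundle hkx h

end Tangent

end StandardActions

/-! ### The adjoint representation and the fundamental vector fields -/

section AdjointHolomorphic

open HolomorphicBundle

variable {EH H : Type*} [NormedAddCommGroup EH] [NormedSpace ℂ EH] [FiniteDimensional ℂ EH]
  [TopologicalSpace H] [ChartedSpace EH H] [Group H] [LieGroup 𝓘(ℂ, EH) ω H]

theorem contMDiff_adjointRep (y : EH) :
    ContMDiff 𝓘(ℂ, EH) 𝓘(ℂ, EH) ω fun h : H ↦ adjointRep EH H h y := by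
  intro h
  have h1 : (tangentBundle EH H).HoloAt 𝓘(ℂ, EH)
      (fun k : H ↦ (⟨(1 : H), y⟩ : TangentBundle 𝓘(ℂ, EH) H)) h :=
    holoAt_tangent_const (fun _ ↦ rfl) contMDiffAt_const
  have hf : ContMDiffAt (𝓘(ℂ, EH).prod 𝓘(ℂ, EH)) 𝓘(ℂ, EH) ω
      (Function.uncurry fun k l : H ↦ k * l * k⁻¹) (h, (1 : H)) := by
    have h2 : ContMDiff (𝓘(ℂ, EH).prod 𝓘(ℂ, EH)) 𝓘(ℂ, EH) ω
        fun p : H × H ↦ p.1 * p.2 * p.1⁻¹ :=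
      (contMDiff_fst.mul contMDiff_snd).mul contMDiff_fst.inv
    exact h2.contMDiffAt
  have h2 := holoAt_mfderiv (f := fun k l : H ↦ k * l * k⁻¹) (g := fun _ : H ↦ (1 : H))
    (v := fun _ ↦ y) hf h1
  have h3 : (tangentBundle EH H).HoloAt 𝓘(ℂ, EH)
      (fun k : H ↦ (⟨(1 : H), adjointRep EH H k y⟩ : TangentBundle 𝓘(ℂ, EH) H)) h := by
    refine h2.congr (Eventually.of_forall fun k ↦ ?_)
    have h4 : ∀ z : H, z = 1 → ∀ w : EH, (⟨(1 : H), w⟩ : TangentBundle 𝓘(ℂ, EH) H) = ⟨z, w⟩ := by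
      rintro z rfl w; rfl
    exact h4 _ (by simp) _
  have h4 := h3.coord ((tangentBundle EH H).mem_dom (1 : H))
  let L : EH →ₗ[ℂ] EH := (tangentBundle EH H).frame 1 1
  refine ((LinearMap.toContinuousLinearMap L).contDiff.contMDiff.contMDiffAt.comp h
    h4).congr_of_eventuallyEq (Eventually.of_forall fun k ↦ ?_)
  exact (frame_coord ((tangentBundle EH H).mem_dom (1 : H)) _).symm

theorem contMDiff_adjointCharacter :
    ContMDiff 𝓘(ℂ, EH) 𝓘(ℂ, ℂ) ω fun h : H ↦ (adjointCharacter EH H h : ℂ) := by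
  have h1 : ContMDiff 𝓘(ℂ, EH) 𝓘(ℂ, Fin (finrank ℂ EH) → EH) ω
      fun (h : H) i ↦ adjointRep EH H h (finBasis ℂ EH i) :=
    contMDiff_pi_space.2 fun i ↦ contMDiff_adjointRep _
  have h2 : ContDiff ℂ ω fun w : Fin (finrank ℂ EH) → EH ↦ (finBasis ℂ EH).det w :=
    (detForm (finBasis ℂ EH)).toContinuousMultilinearMap.contDiff
  refine (h2.contMDiff.comp h1).congr fun h ↦ ?_
  refine Eq.trans ?_ ((finBasis ℂ EH).det_comp (adjointRep EH H h) (finBasis ℂ EH)).symm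
  rw [(finBasis ℂ EH).det_self, mul_one]
  rfl

end AdjointHolomorphic

section FundamentalField

open HolomorphicBundle

set_option linter.unusedSectionVars false

variable {EX EG EH EM G H M : Type*}
  [NormedAddCommGroup EX] [NormedSpace ℂ EX]
  [NormedAddCommGroup EG] [NormedSpace ℂ EG]
  [NormedAddCommGroup EH] [NormedSpace ℂ EH]
  [NormedAddCommGroup EM] [NormedSpace ℂ EM]
  [Group G] [TopologicalSpace G] [ChartedSpace EG G]
  [Group H] [TopologicalSpace H] [ChartedSpace EH H] [LieGroup 𝓘(ℂ, EH) ω H]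
  [TopologicalSpace M] [ChartedSpace EM M] [IsManifold 𝓘(ℂ, EM) ω M]
  [MulAction G M] [ContMDiffSMul 𝓘(ℂ, EG) 𝓘(ℂ, EM) ω G M]
  [MulAction H M] [ContMDiffSMul 𝓘(ℂ, EH) 𝓘(ℂ, EM) ω H M] [SMulCommClass G H M]
  [ChartedSpace EX (orbitRel.Quotient H M)] [IsManifold 𝓘(ℂ, EX) ω (orbitRel.Quotient H M)]

variable (EH EM H) in
/-- The infinitesimal action `y ↦ ξ_y(m)` as a linear map. -/
def infinitesimalAction (m : M) : EH →ₗ[ℂ] TangentSpace 𝓘(ℂ, EM) m where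
  toFun y := fundamentalField EH EM H y m
  map_add' y z := by simp only [fundamentalField]; exact map_add _ _ _
  map_smul' c y := by simp only [fundamentalField]; exact map_smul _ _ _

theorem infinitesimalAction_apply (m : M) (y : EH) :
    infinitesimalAction EH EM H m y = fundamentalField EH EM H y m := rfl

theorem contMDiff_inv_smul (m : M) :
    ContMDiff 𝓘(ℂ, EH) 𝓘(ℂ, EM) ω fun h : H ↦ h⁻¹ • m :=
  (contMDiff_inv 𝓘(ℂ, EH) ω).smul contMDiff_const

theorem mdifferentiable_inv_smul (m : M) :
    MDifferentiable 𝓘(ℂ, EH) 𝓘(ℂ, EM) fun h : H ↦ h⁻¹ • m :=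
  (contMDiff_inv_smul m).mdifferentiable (by simp)

theorem holoAt_fundamentalField [FiniteDimensional ℂ EH]
    {EN : Type*} [NormedAddCommGroup EN] [NormedSpace ℂ EN]
    {HN : Type*} [TopologicalSpace HN] {I : ModelWithCorners ℂ EN HN} {N : Type*}
    [TopologicalSpace N] [ChartedSpace HN N] [IsManifold I ω N] {m : N → M} {y : N → EH} {n : N}
    (hm : ContMDiffAt I 𝓘(ℂ, EM) ω m n) (hy : ContMDiffAt I 𝓘(ℂ, EH) ω y n) :
    (tangentBundle EM M).HoloAt I
      (fun z ↦ ⟨m z, fundamentalField EH EM H (y z) (m z)⟩) n := by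
  have h1 : (tangentBundle EH H).HoloAt I
      (fun z ↦ (⟨(1 : H), y z⟩ : TangentBundle 𝓘(ℂ, EH) H)) n :=
    holoAt_tangent_const (fun _ ↦ rfl) hy
  have hf : ContMDiffAt (I.prod 𝓘(ℂ, EH)) 𝓘(ℂ, EM) ω
      (Function.uncurry fun (z : N) (h : H) ↦ h⁻¹ • m z) (n, (1 : H)) := by
    have h2 : ContMDiffAt (I.prod 𝓘(ℂ, EH)) 𝓘(ℂ, EH) ω (fun p : N × H ↦ p.2⁻¹) (n, (1 : H)) :=
      contMDiffAt_snd.inv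
    have h3 : ContMDiffAt (I.prod 𝓘(ℂ, EH)) 𝓘(ℂ, EM) ω (fun p : N × H ↦ m p.1) (n, (1 : H)) :=
      ContMDiffAt.comp (n, (1 : H)) (g := m) hm contMDiffAt_fst
    exact h2.smul h3
  refine (holoAt_mfderiv (f := fun (z : N) (h : H) ↦ h⁻¹ • m z) (g := fun _ ↦ (1 : H))
    (v := fun z ↦ y z) hf h1).congr (Eventually.of_forall fun z ↦ ?_)
  have h4 : ∀ x : M, x = m z → ∀ w : EM, (⟨m z, w⟩ : TangentBundle 𝓘(ℂ, EM) M) = ⟨x, w⟩ := by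
    rintro x rfl w; rfl
  exact h4 _ (by simp) _

/-- `H`-equivariance of the infinitesimal action: `ξ_{Ad(h) y}(h m) = dh ξ_y(m)`. -/
theorem fundamentalField_adjointRep (h : H) (m : M) (y : EH) :
    fundamentalField EH EM H (adjointRep EH H h y) (h • m) =
      tangentAction H M EM h m (fundamentalField EH EM H y m) := by
  have hconj : MDifferentiableAt 𝓘(ℂ, EH) 𝓘(ℂ, EH) (fun k : H ↦ h * k * h⁻¹) 1 :=
    (((contMDiff_mul_right (I := 𝓘(ℂ, EH)) (n := ω) (a := h⁻¹)).comp
      (contMDiff_mul_left (I := 𝓘(ℂ, EH)) (n := ω) (a := h))).mdifferentiable (by simp)) 1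
  have h1 := mfderiv_comp_apply_of_eq (1 : H)
    (mdifferentiable_inv_smul (EM := EM) (h • m) (1 : H)) hconj (by simp) y
  have h2 := mfderiv_comp_apply_of_eq (1 : H) (mdifferentiable_smul_left EH (EB := EM) h m)
    (mdifferentiable_inv_smul m (1 : H)) (by simp) y
  have h3 : ((fun k : H ↦ k⁻¹ • h • m) ∘ fun k : H ↦ h * k * h⁻¹) =
      (fun y : M ↦ h • y) ∘ fun k : H ↦ k⁻¹ • m := by
    funext k
    simp [smul_smul, mul_assoc]
  rw [h3] at h1
  exact h1.symm.trans h2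

/-- `G`-equivariance of the infinitesimal action: `ξ_y(g m) = dg ξ_y(m)`. -/
theorem fundamentalField_smul (EG : Type*) [NormedAddCommGroup EG] [NormedSpace ℂ EG]
    [ChartedSpace EG G] [ContMDiffSMul 𝓘(ℂ, EG) 𝓘(ℂ, EM) ω G M] (g : G) (m : M) (y : EH) :
    fundamentalField EH EM H y (g • m) =
      tangentAction G M EM g m (fundamentalField EH EM H y m) := by
  have h2 := mfderiv_comp_apply_of_eq (1 : H) (mdifferentiable_smul_left EG (EB := EM) g m)
    (mdifferentiable_inv_smul m (1 : H)) (by simp) y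
  have h3 : ((fun y : M ↦ g • y) ∘ fun k : H ↦ k⁻¹ • m) = fun k : H ↦ k⁻¹ • g • m :=
    funext fun k ↦ smul_comm g k⁻¹ m
  rw [h3] at h2
  exact h2


theorem mfderiv_proj_fundamentalField
    (hproj : ContMDiff 𝓘(ℂ, EM) 𝓘(ℂ, EX) ω (orbitProj H M))
    (m : M) (y : EH) :
    mfderiv 𝓘(ℂ, EM) 𝓘(ℂ, EX) (orbitProj H M) m (fundamentalField EH EM H y m) = 0 := by
  have h2 := mfderiv_comp_apply_of_eq (1 : H) (hproj.mdifferentiable (by simp) m)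
    (mdifferentiable_inv_smul m (1 : H)) (by simp) y
  have h3 : (orbitProj H M ∘ fun k : H ↦ k⁻¹ • m) = fun _ ↦ orbitProj H M m :=
    funext fun k ↦ orbitProj_smul k⁻¹ m
  rw [h3, mfderiv_const] at h2
  exact h2.symm

theorem mfderiv_proj_tangentAction (EH : Type*) [NormedAddCommGroup EH] [NormedSpace ℂ EH]
    [ChartedSpace EH H] [ContMDiffSMul 𝓘(ℂ, EH) 𝓘(ℂ, EM) ω H M]
    (hproj : ContMDiff 𝓘(ℂ, EM) 𝓘(ℂ, EX) ω (orbitProj H M))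
    (h : H) (m : M) (v : TangentSpace 𝓘(ℂ, EM) m) :
    (mfderiv 𝓘(ℂ, EM) 𝓘(ℂ, EX) (orbitProj H M) (h • m) (tangentAction H M EM h m v) : EX) =
      (mfderiv 𝓘(ℂ, EM) 𝓘(ℂ, EX) (orbitProj H M) m v : EX) := by
  have h2 := mfderiv_comp_apply m (hproj.mdifferentiable (by simp) (h • m))
    (mdifferentiable_smul_left EH (EB := EM) h m) v
  have h3 : (orbitProj H M ∘ fun y : M ↦ h • y) = orbitProj H M :=
    funext fun y ↦ orbitProj_smul h y
  rw [h3] at h2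
  exact h2.symm

theorem mfderiv_proj_smul
    (hproj : ContMDiff 𝓘(ℂ, EM) 𝓘(ℂ, EX) ω (orbitProj H M))
    (EG : Type*) [NormedAddCommGroup EG] [NormedSpace ℂ EG]
    [ChartedSpace EG G] [ContMDiffSMul 𝓘(ℂ, EG) 𝓘(ℂ, EM) ω G M]
    [ContMDiffSMul 𝓘(ℂ, EG) 𝓘(ℂ, EX) ω G (orbitRel.Quotient H M)]
    (g : G) (m : M) (v : TangentSpace 𝓘(ℂ, EM) m) :
    mfderiv 𝓘(ℂ, EM) 𝓘(ℂ, EX) (orbitProj H M) (g • m) (tangentAction G M EM g m v) =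
      tangentAction G (orbitRel.Quotient H M) EX g (orbitProj H M m)
        (mfderiv 𝓘(ℂ, EM) 𝓘(ℂ, EX) (orbitProj H M) m v) := by
  have h1 := mfderiv_comp_apply m (hproj.mdifferentiable (by simp) (g • m))
    (mdifferentiable_smul_left EG (EB := EM) g m) v
  have h2 := mfderiv_comp_apply m
    (mdifferentiable_smul_left EG (EB := EX) g (orbitProj H M m))
    (hproj.mdifferentiable (by simp) m) v
  exact h1.symm.trans h2

/-- The kernel of `dπ` consists of the values of the fundamental vector fields. -/
theorem ker_mfderiv_proj
    (hproj : ContMDiff 𝓘(ℂ, EM) 𝓘(ℂ, EX) ω (orbitProj H M))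
    [FiniteDimensional ℂ EM] [FiniteDimensional ℂ EH] (m : M)
    (hdim : finrank ℂ EM = finrank ℂ EH + finrank ℂ EX)
    (hinj : Function.Injective (infinitesimalAction EH EM H m))
    (hsurj : Function.Surjective (mfderiv 𝓘(ℂ, EM) 𝓘(ℂ, EX) (orbitProj H M) m)) :
    LinearMap.range (infinitesimalAction EH EM H m) =
      LinearMap.ker (mfderiv 𝓘(ℂ, EM) 𝓘(ℂ, EX) (orbitProj H M) m).toLinearMap := by
  let p : EM →ₗ[ℂ] EX := (mfderiv 𝓘(ℂ, EM) 𝓘(ℂ, EX) (orbitProj H M) m).toLinearMap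
  let ξ : EH →ₗ[ℂ] EM := infinitesimalAction EH EM H m
  change LinearMap.range ξ = LinearMap.ker p
  refine Submodule.eq_of_le_of_finrank_eq ?_ ?_
  · rintro _ ⟨y, rfl⟩
    exact mfderiv_proj_fundamentalField hproj m y
  · have h1 := p.finrank_range_add_finrank_ker
    rw [LinearMap.range_eq_top (f := p).2 hsurj, finrank_top] at h1
    have h2 := LinearMap.finrank_range_of_inj (f := ξ) hinj
    omega


end FundamentalField

/-! ### Contraction of top forms along an exact sequence -/

section LinearContraction

variable {V E X : Type*} [AddCommGroup V] [Module ℂ V] [AddCommGroup E] [Module ℂ E]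
  [FiniteDimensional ℂ E] [AddCommGroup X] [Module ℂ X] {q d n : ℕ}

/-- For an exact sequence `0 → V → E → X → 0` and bases of `V` and `X` there is a basis of `E` for
which determinants are the products of the determinants in `V` and in `X`. -/
theorem exists_basis_det_append (ξ : V →ₗ[ℂ] E) (p : E →ₗ[ℂ] X) (hξ : Function.Injective ξ)
    (hp : Function.Surjective p) (hpξ : ∀ y, p (ξ y) = 0) (b : Basis (Fin q) ℂ V)
    (e : Basis (Fin d) ℂ X) (hE : finrank ℂ E = n) (hn : n = q + d) :
    ∃ β : Basis (Fin n) ℂ E, ∀ (y : Fin q → V) (v : Fin d → E),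
      β.det (fun i ↦ Fin.append (fun j ↦ ξ (y j)) v (Fin.cast hn i)) =
        b.det y * e.det fun j ↦ p (v j) := by
  subst hn
  -- the basis consists of the images of `b` and of lifts of `e`; with respect to it, the matrix of
  -- the appended family is block triangular
  obtain ⟨r, hr⟩ := p.exists_rightInverse_of_surjective (LinearMap.range_eq_top.2 hp)
  have hpr : ∀ x, p (r x) = x := fun x ↦ LinearMap.congr_fun hr x
  have hli : LinearIndependent ℂ (Sum.elim (fun j ↦ ξ (b j)) fun j ↦ r (e j)) := by
    refine LinearIndependent.sum_type ?_ ?_ ?_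
    · exact b.linearIndependent.map' ξ (LinearMap.ker_eq_bot.2 hξ)
    · exact e.linearIndependent.map' r (LinearMap.ker_eq_bot.2
        (Function.LeftInverse.injective hpr))
    · rw [Submodule.disjoint_def]
      intro x h1 h2
      have h3 : p x = 0 := by
        have : Submodule.span ℂ (Set.range fun j ↦ ξ (b j)) ≤ LinearMap.ker p := by
          rw [Submodule.span_le]
          rintro _ ⟨j, rfl⟩
          exact hpξ (b j)
        exact this h1
      have h4 : Submodule.span ℂ (Set.range fun j ↦ r (e j)) ≤ LinearMap.range r := by
        rw [Submodule.span_le]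
        rintro _ ⟨j, rfl⟩
        exact ⟨_, rfl⟩
      obtain ⟨z, rfl⟩ := h4 h2
      rw [hpr] at h3
      rw [h3, map_zero]
  have hcard : Fintype.card (Fin q ⊕ Fin d) = finrank ℂ E := by simp [hE]
  let β₀ : Basis (Fin q ⊕ Fin d) ℂ E := basisOfLinearIndependentOfCardEqFinrank' _ hli hcard
  have hβ₀ : ⇑β₀ = Sum.elim (fun j ↦ ξ (b j)) fun j ↦ r (e j) :=
    coe_basisOfLinearIndependentOfCardEqFinrank' _ hli hcard
  refine ⟨β₀.reindex finSumFinEquiv, fun y v ↦ ?_⟩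
  have hv : (fun i ↦ Fin.append (fun j ↦ ξ (y j)) v (Fin.cast rfl i)) =
      Sum.elim (fun j ↦ ξ (y j)) v ∘ finSumFinEquiv.symm := by
    funext i
    refine Fin.addCases (fun j ↦ ?_) (fun j ↦ ?_) i <;> simp
  rw [hv, Basis.det_reindex, Function.comp_assoc, Equiv.symm_comp_self, Function.comp_id]
  have h1 : ∀ (z : V) (j : Fin q), β₀.repr (ξ z) (Sum.inl j) = b.repr z j := by
    intro z j
    have : β₀.coord (Sum.inl j) ∘ₗ ξ = b.coord j := by
      refine b.ext fun k ↦ ?_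
      have : ξ (b k) = β₀ (Sum.inl k) := by rw [hβ₀]; rfl
      simp [this, Finsupp.single_apply]
    exact LinearMap.congr_fun this z
  have h2 : ∀ (z : E) (j : Fin d), β₀.repr z (Sum.inr j) = e.repr (p z) j := by
    intro z j
    have : β₀.coord (Sum.inr j) = e.coord j ∘ₗ p := by
      refine β₀.ext fun k ↦ ?_
      rcases k with k | k
      · have : p (β₀ (Sum.inl k)) = 0 := by rw [hβ₀]; exact hpξ _
        simp [this]
      · have : p (β₀ (Sum.inr k)) = e k := by rw [hβ₀]; exact hpr _
        simp [this, Finsupp.single_apply]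
    exact LinearMap.congr_fun this z
  have hM : β₀.toMatrix (Sum.elim (fun j ↦ ξ (y j)) v) =
      Matrix.fromBlocks (b.toMatrix y) (Matrix.of fun i j ↦ β₀.repr (v j) (Sum.inl i)) 0
        (e.toMatrix fun j ↦ p (v j)) := by
    ext i j
    rcases i with i | i <;> rcases j with j | j
    · exact h1 _ _
    · rfl
    · refine (h2 _ _).trans ?_
      simp [hpξ]
    · exact h2 _ _
  rw [Basis.det_apply, hM, Matrix.det_fromBlocks_zero₂₁]
  rfl

end LinearContraction

/-! ### Top forms on the quotient induced by top forms on `M` -/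

section InducedForms

open HolomorphicBundle

set_option linter.unusedSectionVars false

variable {EX EG EH EM G H M : Type*}
  [NormedAddCommGroup EX] [NormedSpace ℂ EX] [FiniteDimensional ℂ EX]
  [NormedAddCommGroup EG] [NormedSpace ℂ EG]
  [NormedAddCommGroup EH] [NormedSpace ℂ EH] [FiniteDimensional ℂ EH]
  [NormedAddCommGroup EM] [NormedSpace ℂ EM] [FiniteDimensional ℂ EM]
  [Group G] [TopologicalSpace G] [ChartedSpace EG G]
  [Group H] [TopologicalSpace H] [ChartedSpace EH H] [LieGroup 𝓘(ℂ, EH) ω H]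
  [TopologicalSpace M] [ChartedSpace EM M] [IsManifold 𝓘(ℂ, EM) ω M]
  [MulAction G M] [ContMDiffSMul 𝓘(ℂ, EG) 𝓘(ℂ, EM) ω G M]
  [MulAction H M] [ContMDiffSMul 𝓘(ℂ, EH) 𝓘(ℂ, EM) ω H M] [SMulCommClass G H M]
  [ChartedSpace EX (orbitRel.Quotient H M)] [IsManifold 𝓘(ℂ, EX) ω (orbitRel.Quotient H M)]
  {b : Basis (Fin (finrank ℂ EH)) ℂ EH} {m : M}

/-- The basis of `T_m M` adapted to the exact sequence `0 → 𝔥 → T_m M → T_[m] X → 0`. -/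
theorem exists_adapted_basis (hdim : finrank ℂ EM = finrank ℂ EH + finrank ℂ EX)
    (hproj : ContMDiff 𝓘(ℂ, EM) 𝓘(ℂ, EX) ω (orbitProj H M))
    (hfree : ∀ (h : H) (m : M), h • m = m → h = 1)
    (hsurj : ∀ m : M, Function.Surjective (mfderiv 𝓘(ℂ, EM) 𝓘(ℂ, EX) (orbitProj H M) m))
    (b : Basis (Fin (finrank ℂ EH)) ℂ EH) (m : M) :
    ∃ β : Basis (Fin (finrank ℂ EM)) ℂ EM, ∀ (y : Fin (finrank ℂ EH) → EH)
      (v : Fin (finrank ℂ EX) → TangentSpace 𝓘(ℂ, EM) m),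
      β.det (fun i ↦ Fin.append (fun j ↦ fundamentalField EH EM H (y j) m) v (Fin.cast hdim i)) =
        b.det y * (finBasis ℂ EX).det
          fun j ↦ mfderiv 𝓘(ℂ, EM) 𝓘(ℂ, EX) (orbitProj H M) m (v j) := by
  have hcomplete : CompleteSpace EH := FiniteDimensional.complete ℂ EH
  have hinj : Function.Injective (infinitesimalAction EH EM H m) :=
    (injective_iff_map_eq_zero _).2 fun y hy ↦ injective_fundamentalField hfree m hy
  let ξ : EH →ₗ[ℂ] EM := infinitesimalAction EH EM H m
  let p : EM →ₗ[ℂ] EX := (mfderiv 𝓘(ℂ, EM) 𝓘(ℂ, EX) (orbitProj H M) m).toLinearMap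
  exact exists_basis_det_append ξ p hinj (hsurj m) (mfderiv_proj_fundamentalField hproj m) b
    (finBasis ℂ EX) rfl hdim

/-- The contraction `η ↦ η(ξ_{b₁}, …, ξ_{b_q}, ·)` of top forms descends to the quotient of `T_m M`
by the tangent space of the orbit, and is an isomorphism onto the top forms of this quotient. -/
theorem exists_contraction (hdim : finrank ℂ EM = finrank ℂ EH + finrank ℂ EX)
    (hproj : ContMDiff 𝓘(ℂ, EM) 𝓘(ℂ, EX) ω (orbitProj H M))
    (hfree : ∀ (h : H) (m : M), h • m = m → h = 1)
    (hsurj : ∀ m : M, Function.Surjective (mfderiv 𝓘(ℂ, EM) 𝓘(ℂ, EX) (orbitProj H M) m))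
    (b : Basis (Fin (finrank ℂ EH)) ℂ EH) (m : M) :
    ∃ C : CanonicalFibre EM m ≃ₗ[ℂ] CanonicalFibre EX (orbitProj H M m),
      ∀ η, IsInducedForm b m η (C η) := by
  obtain ⟨β, hβ⟩ := exists_adapted_basis hdim hproj hfree hsurj b m
  refine ⟨(topFormEquiv β).trans (topFormEquiv (finBasis ℂ EX)).symm, fun η ↦ ⟨hdim, fun v ↦ ?_⟩⟩
  have h1 := topForm_apply β η
    (fun i ↦ Fin.append (fun j ↦ fundamentalField EH EM H (b j) m) v (Fin.cast hdim i))
  rw [hβ, b.det_self, one_mul] at h1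
  exact h1.symm

/-- The induced form is unique, as `dπ` is surjective. -/
theorem IsInducedForm.unique
    (hsurj : Function.Surjective (mfderiv 𝓘(ℂ, EM) 𝓘(ℂ, EX) (orbitProj H M) m))
    {η : CanonicalFibre EM m} {θ θ' : CanonicalFibre EX (orbitProj H M m)}
    (h : IsInducedForm b m η θ) (h' : IsInducedForm b m η θ') : θ = θ' := by
  ext w
  choose v hv using fun j ↦ hsurj (w j)
  obtain rfl : (fun j ↦ mfderiv 𝓘(ℂ, EM) 𝓘(ℂ, EX) (orbitProj H M) m (v j)) = w := funext hv
  exact (h.2 v).trans (h'.2 v).symm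

theorem IsInducedForm.smul {η : CanonicalFibre EM m} {θ : CanonicalFibre EX (orbitProj H M m)}
    (h : IsInducedForm b m η θ) (c : ℂ) : IsInducedForm b m (c • η) (c • θ) :=
  ⟨h.1, fun v ↦ congrArg (c * ·) (h.2 v)⟩

/-- The forms on `T_[m] X` induced by forms at different points of the orbit of `m`: the change of
the fundamental vector fields by `Ad` is compensated by the character `χ_𝔥`. -/
theorem IsInducedForm.smul_canonicalAction
    (hproj : ContMDiff 𝓘(ℂ, EM) 𝓘(ℂ, EX) ω (orbitProj H M))
    (hfree : ∀ (h : H) (m : M), h • m = m → h = 1)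
    (hsurj : ∀ m : M, Function.Surjective (mfderiv 𝓘(ℂ, EM) 𝓘(ℂ, EX) (orbitProj H M) m))
    {η : CanonicalFibre EM m} {θ : EX [⋀^Fin (finrank ℂ EX)]→L[ℂ] ℂ}
    (hθ : IsInducedForm (H := H) b m η θ) (h : H) :
    IsInducedForm (H := H) b (h • m)
      ((adjointCharacter EH H h : ℂ) • canonicalAction H M EM h m η) θ := by
  obtain ⟨hdim, hθ⟩ := hθ
  obtain ⟨β, hβ⟩ := exists_adapted_basis hdim hproj hfree hsurj b m
  refine ⟨hdim, fun v ↦ ?_⟩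
  obtain ⟨v, rfl⟩ := exists_tangentAction_eq EH h m v
  -- `ξ_{b_j}(h m) = dh ξ_{Ad(h⁻¹) b_j}(m)`, so the determinant of `Ad(h⁻¹)` comes in
  have hb : ∀ j, fundamentalField EH EM H (b j) (h • m) = tangentAction H M EM h m
      (fundamentalField EH EM H (adjointRep EH H h⁻¹ (b j)) m) := fun j ↦ by
    rw [← fundamentalField_adjointRep, ← Module.End.mul_apply, ← map_mul, mul_inv_cancel, map_one,
      Module.End.one_apply]
  have happ : (fun i ↦ Fin.append (fun j ↦ fundamentalField EH EM H (b j) (h • m))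
      (fun j ↦ tangentAction H M EM h m (v j)) (Fin.cast hdim i)) =
      fun i ↦ tangentAction H M EM h m (Fin.append (fun j ↦
        fundamentalField EH EM H (adjointRep EH H h⁻¹ (b j)) m) v (Fin.cast hdim i)) := by
    funext i
    simp only [hb]
    exact Fin.addCases (fun j ↦ by simp) (fun j ↦ by simp) (Fin.cast hdim i)
  have hdet : b.det (fun j ↦ adjointRep EH H h⁻¹ (b j)) = (adjointCharacter EH H h⁻¹ : ℂ) := by
    refine (b.det_comp (adjointRep EH H h⁻¹) b).trans ?_
    rw [b.det_self, mul_one]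
    rfl
  have h1 := topForm_apply β η (fun i ↦ Fin.append (fun j ↦
        fundamentalField EH EM H (adjointRep EH H h⁻¹ (b j)) m) v (Fin.cast hdim i))
  have h2 := topForm_apply β η
    (fun i ↦ Fin.append (fun j ↦ fundamentalField EH EM H (b j) m) v (Fin.cast hdim i))
  rw [hβ, hdet] at h1
  rw [hβ, b.det_self, one_mul] at h2
  have h3 : (adjointCharacter EH H h : ℂ) * (adjointCharacter EH H h⁻¹ : ℂ) = 1 := by
    rw [← Units.val_mul, ← map_mul, mul_inv_cancel, map_one, Units.val_one]
  have h4 : (fun j ↦ (mfderiv 𝓘(ℂ, EM) 𝓘(ℂ, EX) (orbitProj H M) (h • m)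
      (tangentAction H M EM h m (v j)) : EX)) =
      fun j ↦ mfderiv 𝓘(ℂ, EM) 𝓘(ℂ, EX) (orbitProj H M) m (v j) :=
    funext fun j ↦ mfderiv_proj_tangentAction EH hproj h m (v j)
  rw [happ]
  refine (congrArg θ h4).trans ((hθ v).trans (h2.trans ?_))
  rw [ContinuousAlternatingMap.smul_apply, canonicalAction_apply_tangentAction EH, smul_eq_mul]
  refine Eq.trans ?_ (congrArg ((adjointCharacter EH H h : ℂ) * ·) h1.symm)
  linear_combination (-(η β) * (finBasis ℂ EX).det
    fun j ↦ mfderiv 𝓘(ℂ, EM) 𝓘(ℂ, EX) (orbitProj H M) m (v j)) * h3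

/-- Passing to the induced form commutes with the action of `G`, as `G` fixes the fundamental vector
fields of `H` and `dπ` is `G`-equivariant. -/
theorem IsInducedForm.canonicalAction_of_commute
    (hproj : ContMDiff 𝓘(ℂ, EM) 𝓘(ℂ, EX) ω (orbitProj H M))
    (EG : Type*) [NormedAddCommGroup EG] [NormedSpace ℂ EG]
    [ChartedSpace EG G] [ContMDiffSMul 𝓘(ℂ, EG) 𝓘(ℂ, EM) ω G M]
    [ContMDiffSMul 𝓘(ℂ, EG) 𝓘(ℂ, EX) ω G (orbitRel.Quotient H M)]
    {η : CanonicalFibre EM m} {θ : CanonicalFibre EX (orbitProj H M m)}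
    (hθ : IsInducedForm b m η θ) (g : G) :
    IsInducedForm b (g • m) (canonicalAction G M EM g m η)
      (canonicalAction G (orbitRel.Quotient H M) EX g (orbitProj H M m) θ) := by
  obtain ⟨hdim, hθ⟩ := hθ
  refine ⟨hdim, fun v ↦ ?_⟩
  obtain ⟨v, rfl⟩ := exists_tangentAction_eq EG g m v
  have happ : (fun i ↦ Fin.append (fun j ↦ fundamentalField EH EM H (b j) (g • m))
      (fun j ↦ tangentAction G M EM g m (v j)) (Fin.cast hdim i)) =
      fun i ↦ tangentAction G M EM g m (Fin.append (fun j ↦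
        fundamentalField EH EM H (b j) m) v (Fin.cast hdim i)) := by
    funext i
    simp only [fundamentalField_smul EG]
    exact Fin.addCases (fun j ↦ by simp) (fun j ↦ by simp) (Fin.cast hdim i)
  rw [happ, canonicalAction_apply_tangentAction EG, ← hθ v,
    ← canonicalAction_apply_tangentAction EG g (orbitProj H M m) θ]
  exact congrArg _ (funext fun j ↦ mfderiv_proj_smul hproj EG g m (v j))

/-- The forms on `X` induced by a holomorphic family of forms along a local section of `M → X` form
a holomorphic family. -/
theorem holoAt_of_isInducedForm [ProperSMul H M]
    (hproj : ContMDiff 𝓘(ℂ, EM) 𝓘(ℂ, EX) ω (orbitProj H M))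
    (s : LocalSection EH EM EX H M)
    {EN : Type*} [NormedAddCommGroup EN] [NormedSpace ℂ EN]
    {HN : Type*} [TopologicalSpace HN] {I : ModelWithCorners ℂ EN HN} {N : Type*}
    [TopologicalSpace N] [ChartedSpace HN N] [IsManifold I ω N] {g : N → orbitRel.Quotient H M}
    {η : ∀ y, CanonicalFibre EM (s.sect (g y))} {θ : ∀ y, CanonicalFibre EX (g y)} {n : N}
    (hg : ContMDiffAt I 𝓘(ℂ, EX) ω g n) (hn : g n ∈ s.dom)
    (hη : (canonicalBundle EM M).HoloAt I (fun y ↦ ⟨s.sect (g y), η y⟩) n)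
    (hθ : ∀ y, g y ∈ s.dom → IsInducedForm (H := H) b (s.sect (g y)) (η y)
      (show EX [⋀^Fin (finrank ℂ EX)]→L[ℂ] ℂ from θ y)) :
    (canonicalBundle EX (orbitRel.Quotient H M)).HoloAt I (fun y ↦ ⟨g y, θ y⟩) n := by
  obtain ⟨hdim, -⟩ := hθ n hn
  have hs : ContMDiffAt I 𝓘(ℂ, EM) ω (fun y ↦ s.sect (g y)) n :=
    ContMDiffAt.comp n (s.holo_sect.contMDiffAt (s.isOpen_dom.mem_nhds hn)) hg
  have hw : ∀ j, (tangentBundle EX (orbitRel.Quotient H M)).HoloAt I (fun y ↦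
      ⟨g y, (tangentBundle EX (orbitRel.Quotient H M)).frame (g n) (g y) (finBasis ℂ EX j)⟩) n :=
    fun j ↦ holoAt_frame hg contMDiffAt_const (mem_dom _ _)
  have hlift : ∀ j, (tangentBundle EM M).HoloAt I (fun y ↦ ⟨s.sect (g y),
      mfderiv 𝓘(ℂ, EX) 𝓘(ℂ, EM) s.sect (g y) ((tangentBundle EX (orbitRel.Quotient H M)).frame
        (g n) (g y) (finBasis ℂ EX j))⟩) n := fun j ↦
    holoAt_mfderiv (f := fun _ ↦ s.sect)
      (ContMDiffAt.comp (n, g n) (s.holo_sect.contMDiffAt (s.isOpen_dom.mem_nhds hn))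
        contMDiffAt_snd) (hw j)
  refine holoAt_canonicalBundle hg ?_
  have hv : ∀ i, (tangentBundle EM M).HoloAt I (fun y ↦ ⟨s.sect (g y),
      Fin.append (fun j ↦ fundamentalField EH EM H (b j) (s.sect (g y)))
        (fun j ↦ mfderiv 𝓘(ℂ, EX) 𝓘(ℂ, EM) s.sect (g y)
          ((tangentBundle EX (orbitRel.Quotient H M)).frame (g n) (g y) (finBasis ℂ EX j)))
        (Fin.cast hdim i)⟩) n := by
    intro i
    refine Fin.addCases (fun j ↦ ?_) (fun j ↦ ?_) (Fin.cast hdim i)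
    · simp only [Fin.append_left]
      exact holoAt_fundamentalField hs contMDiffAt_const
    · simp only [Fin.append_right]
      exact hlift j
  refine (hη.form_apply hv).congr_of_eventuallyEq ?_
  filter_upwards [hg.continuousAt (s.isOpen_dom.mem_nhds hn)] with y hy
  refine Eq.trans ?_ ((hθ y hy).2 _)
  refine congrArg (show EX [⋀^Fin (finrank ℂ EX)]→L[ℂ] ℂ from θ y) (funext fun j ↦ ?_)
  exact (s.mfderiv_proj_mfderiv_sect hproj hy _).symm

end InducedForms

/-! ### Evaluation of elements of quotient bundles -/

section QuotientBundleAPI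

open HolomorphicBundle

set_option linter.unusedSectionVars false

variable {EX EG EH EM G H M : Type*}
  [NormedAddCommGroup EX] [NormedSpace ℂ EX]
  [NormedAddCommGroup EG] [NormedSpace ℂ EG]
  [NormedAddCommGroup EH] [NormedSpace ℂ EH]
  [NormedAddCommGroup EM] [NormedSpace ℂ EM]
  [Group G] [TopologicalSpace G] [ChartedSpace EG G]
  [Group H] [TopologicalSpace H] [ChartedSpace EH H]
  [TopologicalSpace M] [ChartedSpace EM M]
  [MulAction G M] [MulAction H M] [SMulCommClass G H M]
  [ChartedSpace EX (orbitRel.Quotient H M)]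
  {F₀ : Type*} [NormedAddCommGroup F₀] [NormedSpace ℂ F₀]
  {F : M → Type*} [∀ m, AddCommGroup (F m)] [∀ m, Module ℂ (F m)]
  {A : HolomorphicBundle EM F₀ F} {aG : FibreAction G F} {aH : FibreAction H F}

namespace QuotientBundle

variable (Q : QuotientBundle EX EG A aG aH)

theorem fibreVal_quotMap (m : M) (f : F m) :
    fibreVal aH (orbitProj H M m) m (Q.quotMap m f) = f :=
  (fibreVal_apply rfl _).trans (Q.quotMap_apply m f)

theorem quotMap_fibreVal (m : M) (t : quotientFibre aH (orbitProj H M m)) :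
    Q.quotMap m (fibreVal aH (orbitProj H M m) m t) = t :=
  fibreVal_injective (m := m) rfl (Q.fibreVal_quotMap m _)

/-- The evaluation at a point of the orbit. -/
def evalEquiv {x : orbitRel.Quotient H M} {m : M} (hm : orbitProj H M m = x) :
    quotientFibre aH x ≃ₗ[ℂ] F m :=
  LinearEquiv.ofBijective (fibreVal aH x m) ⟨fibreVal_injective hm, by
    subst hm
    exact fun f ↦ ⟨_, Q.fibreVal_quotMap m f⟩⟩

theorem fibreVal_action (g : G) (m : M) (t : quotientFibre aH (orbitProj H M m)) :
    fibreVal aH (g • orbitProj H M m) (g • m) (Q.action g (orbitProj H M m) t) =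
      aG g m (fibreVal aH (orbitProj H M m) m t) := by
  conv_lhs => rw [← Q.quotMap_fibreVal m t, Q.action_quotMap]
  exact Q.fibreVal_quotMap (g • m) _

/-- Holomorphic families in `F` along a lift to `M` yield holomorphic families in `F/H`. -/
theorem holoAt_of_fibreVal {EN : Type*} [NormedAddCommGroup EN] [NormedSpace ℂ EN]
    {HN : Type*} [TopologicalSpace HN] {I : ModelWithCorners ℂ EN HN} {N : Type*}
    [TopologicalSpace N] [ChartedSpace HN N] {m : N → M} {g : N → orbitRel.Quotient H M}
    {t : ∀ y, quotientFibre aH (g y)} {n : N}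
    (hmg : ∀ᶠ y in 𝓝 n, orbitProj H M (m y) = g y)
    (h : A.HoloAt I (fun y ↦ ⟨m y, fibreVal aH (g y) (m y) (t y)⟩) n) :
    Q.bundle.HoloAt I (fun y ↦ ⟨g y, t y⟩) n := by
  refine (Q.holomorphic_quotMap.holoAt h).congr ?_
  filter_upwards [hmg] with y hy
  generalize t y = t'
  generalize g y = x at hy t'
  subst hy
  exact congrArg (TotalSpace.mk _) (Q.quotMap_fibreVal _ _).symm

end QuotientBundle

end QuotientBundleAPI

/-! ### The generalized Euler sequence -/

section Euler

open HolomorphicBundle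

set_option linter.unusedSectionVars false

variable {EX EG EH EM G H M : Type*}
  [NormedAddCommGroup EX] [NormedSpace ℂ EX] [FiniteDimensional ℂ EX]
  [NormedAddCommGroup EG] [NormedSpace ℂ EG]
  [NormedAddCommGroup EH] [NormedSpace ℂ EH] [FiniteDimensional ℂ EH]
  [NormedAddCommGroup EM] [NormedSpace ℂ EM] [FiniteDimensional ℂ EM]
  [Group G] [TopologicalSpace G] [ChartedSpace EG G] [LieGroup 𝓘(ℂ, EG) ω G]
  [Group H] [TopologicalSpace H] [ChartedSpace EH H] [LieGroup 𝓘(ℂ, EH) ω H]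
  [TopologicalSpace M] [ChartedSpace EM M] [IsManifold 𝓘(ℂ, EM) ω M]
  [MulAction G M] [ContMDiffSMul 𝓘(ℂ, EG) 𝓘(ℂ, EM) ω G M]
  [MulAction H M] [ContMDiffSMul 𝓘(ℂ, EH) 𝓘(ℂ, EM) ω H M] [SMulCommClass G H M]
  [ChartedSpace EX (orbitRel.Quotient H M)] [IsManifold 𝓘(ℂ, EX) ω (orbitRel.Quotient H M)]

variable (EH EM H) in
/-- The map `[m, y] ↦ [ξ_y(m)]` on the fibres of `M ×_H 𝔥 → TM/H`. -/
def eulerInclusion (M : Type*) [TopologicalSpace M] [ChartedSpace EM M] [MulAction H M]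
    [IsManifold 𝓘(ℂ, EM) ω M] [ContMDiffSMul 𝓘(ℂ, EH) 𝓘(ℂ, EM) ω H M]
    (x : orbitRel.Quotient H M) :
    quotientFibre (repAction M (adjointRep EH H)) x →ₗ[ℂ]
      quotientFibre (tangentAction H M EM) x where
  toFun s := ⟨fun m ↦ infinitesimalAction EH EM H m.1 (s.1 m), fun h m ↦ by
    refine Eq.trans ?_ (fundamentalField_adjointRep h m.1 (s.1 m))
    exact congrArg (infinitesimalAction EH EM H (h • m.1)) (s.2 h m)⟩
  map_add' s t := Subtype.ext (funext fun m ↦ map_add (infinitesimalAction EH EM H m.1) _ _)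
  map_smul' c s := Subtype.ext (funext fun m ↦ map_smul (infinitesimalAction EH EM H m.1) _ _)

theorem fibreVal_eulerInclusion {x : orbitRel.Quotient H M} {m : M} (hm : orbitProj H M m = x)
    (s : quotientFibre (repAction M (adjointRep EH H)) x) :
    fibreVal (tangentAction H M EM) x m (eulerInclusion EH EM H M x s) =
      fundamentalField EH EM H (fibreVal (repAction M (adjointRep EH H)) x m s) m := by
  rw [fibreVal_apply hm, fibreVal_apply hm]
  rfl

variable (EX EM) in
/-- The map `[v] ↦ dπ(v)` on the fibres of `TM/H → TX`, computed at a representative of the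
orbit. -/
def eulerProjection (x : orbitRel.Quotient H M) :
    quotientFibre (tangentAction H M EM) x →ₗ[ℂ] TangentSpace 𝓘(ℂ, EX) x :=
  let p : TangentSpace 𝓘(ℂ, EM) x.out →ₗ[ℂ] EX :=
    (mfderiv 𝓘(ℂ, EM) 𝓘(ℂ, EX) (orbitProj H M) x.out).toLinearMap
  p ∘ₗ fibreVal (tangentAction H M EM) x x.out

theorem eulerProjection_apply (EH : Type*) [NormedAddCommGroup EH] [NormedSpace ℂ EH]
    [ChartedSpace EH H] [ContMDiffSMul 𝓘(ℂ, EH) 𝓘(ℂ, EM) ω H M]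
    (hproj : ContMDiff 𝓘(ℂ, EM) 𝓘(ℂ, EX) ω (orbitProj H M))
    {x : orbitRel.Quotient H M} {m : M} (hm : orbitProj H M m = x)
    (t : quotientFibre (tangentAction H M EM) x) :
    (eulerProjection EX EM x t : EX) = (mfderiv 𝓘(ℂ, EM) 𝓘(ℂ, EX) (orbitProj H M) m
      (fibreVal (tangentAction H M EM) x m t) : EX) := by
  obtain ⟨h, rfl⟩ := orbitProj_eq_iff.1 (hm.trans x.out_eq.symm)
  rw [fibreVal_smul x.out_eq]
  exact (mfderiv_proj_tangentAction EH hproj h _ _).symm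

/-- The generalized Euler sequence `0 → M ×_H 𝔥 → (TM)/H → TX → 0`: on fibres, evaluation at a point
`m` of the orbit turns it into `0 → 𝔥 → T_m M → T_[m] X → 0`, which is exact because the action is
infinitesimally free and `π` is a submersion. -/
theorem exists_eulerSequence [ProperSMul H M]
    (hdim : Nonempty M → finrank ℂ EM = finrank ℂ EH + finrank ℂ EX)
    (hfree : ∀ (h : H) (m : M), h • m = m → h = 1)
    (hquot : IsQuotientManifold EX EG EM G H M)
    (hsec : ∀ m : M, ∃ s : LocalSection EH EM EX H M,
      orbitProj H M m ∈ s.dom ∧ s.sect (orbitProj H M m) = m) :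
    ∃ (A : QuotientBundle EX EG (productBundle EM M EH)
          (repAction M (1 : Representation ℂ G EH)) (repAction M (adjointRep EH H)))
        (B : QuotientBundle EX EG (tangentBundle EM M)
          (tangentAction G M EM) (tangentAction H M EM))
        (i : ∀ x, quotientFibre (repAction M (adjointRep EH H)) x →ₗ[ℂ]
          quotientFibre (tangentAction H M EM) x)
        (p : ∀ x, quotientFibre (tangentAction H M EM) x →ₗ[ℂ] TangentSpace 𝓘(ℂ, EX) x),
      A.bundle.IsMorphism B.bundle i ∧ IsEquivariant A.action B.action i ∧
      B.bundle.IsMorphism (tangentBundle EX (orbitRel.Quotient H M)) p ∧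
      IsEquivariant B.action (tangentAction G (orbitRel.Quotient H M) EX) p ∧
      (∀ x, Function.Injective (i x)) ∧
      (∀ x, LinearMap.range (i x) = LinearMap.ker (p x)) ∧
      (∀ x, Function.Surjective (p x)) ∧
      (∀ (m : M) (y : EH), i _ (A.quotMap m y) = B.quotMap m (fundamentalField EH EM H y m)) ∧
      (∀ (m : M) (v : TangentSpace 𝓘(ℂ, EM) m), p _ (B.quotMap m v) =
        mfderiv 𝓘(ℂ, EM) 𝓘(ℂ, EX) (orbitProj H M) m v) := by
  have hproj := hquot.holomorphic_proj
  have hsmul := hquot.holomorphic_smul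
  have hcomplete : CompleteSpace EH := FiniteDimensional.complete ℂ EH
  have hinj : ∀ m : M, Function.Injective (infinitesimalAction EH EM H m) := fun m ↦
    (injective_iff_map_eq_zero _).2 fun y hy ↦ injective_fundamentalField hfree m hy
  obtain ⟨A, hA⟩ := exists_quotientBundle (EX := EX) (EG := EG) hfree
    (isHolomorphicAction_repAction (EK := EH) (EB := EM) (B := M) (ρ := adjointRep EH H)
      contMDiff_adjointRep)
    (isHolomorphicAction_repAction (EK := EG) (EB := EM) (B := M)
      (ρ := (1 : Representation ℂ G EH)) fun _ ↦ contMDiff_const)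
    (repAction_one_comm _) hproj hsec
  obtain ⟨B, hB⟩ := exists_quotientBundle (EX := EX) (EG := EG) (A := tangentBundle EM M) hfree
    (isHolomorphicAction_tangentAction (EK := EH) (K := H))
    (isHolomorphicAction_tangentAction (EK := EG) (K := G))
    (tangentAction_comm EH EG) hproj hsec
  have hex : ∀ x : orbitRel.Quotient H M, ∃ s : LocalSection EH EM EX H M, x ∈ s.dom :=
    fun x ↦ Quotient.inductionOn x fun m ↦ (hsec m).imp fun s hs ↦ hs.1
  have hi : ∀ (m : M) (y : EH), eulerInclusion EH EM H M _ (A.quotMap m y) =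
      B.quotMap m (fundamentalField EH EM H y m) := fun m y ↦ by
    refine fibreVal_injective (m := m) rfl ?_
    rw [fibreVal_eulerInclusion rfl, A.fibreVal_quotMap, B.fibreVal_quotMap]
  have hp : ∀ (m : M) (v : TangentSpace 𝓘(ℂ, EM) m), eulerProjection EX EM _ (B.quotMap m v) =
      mfderiv 𝓘(ℂ, EM) 𝓘(ℂ, EX) (orbitProj H M) m v := fun m v ↦ by
    refine (eulerProjection_apply EH hproj rfl _).trans ?_
    rw [B.fibreVal_quotMap]
  refine ⟨A, B, eulerInclusion EH EM H M, eulerProjection EX EM, ?_, ?_, ?_, ?_, ?_, ?_, ?_, hi, hp⟩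
  · refine isMorphism_of_frame fun x v ↦ ?_
    obtain ⟨s, hs⟩ := hex x
    have hdom : ∀ᶠ p : orbitRel.Quotient H M × EH in 𝓝 (x, v), p.1 ∈ s.dom :=
      continuousAt_fst (s.isOpen_dom.mem_nhds hs)
    obtain ⟨h1, h2⟩ := holoAt_productBundle_iff.1 (hA s x v hs)
    refine B.holoAt_of_fibreVal (hdom.mono fun p hp ↦ s.proj_sect _ hp)
      ((holoAt_fundamentalField (H := H) h1 h2).congr ?_)
    filter_upwards [hdom] with p hp
    exact congrArg (TotalSpace.mk _) (fibreVal_eulerInclusion (s.proj_sect _ hp) _)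
  · intro g x e
    induction x using Quotient.inductionOn with | _ m
    refine fibreVal_injective (m := g • m) rfl ?_
    refine (fibreVal_eulerInclusion (x := g • orbitProj H M m) rfl _).trans ?_
    refine Eq.trans ?_ (B.fibreVal_action g m _).symm
    rw [fibreVal_eulerInclusion rfl, ← fundamentalField_smul EG]
    exact congrArg (fun y ↦ fundamentalField EH EM H y (g • m)) (A.fibreVal_action g m e)
  · refine isMorphism_of_frame fun x v ↦ ?_
    obtain ⟨s, hs⟩ := hex x
    have hdom : ∀ᶠ p : orbitRel.Quotient H M × EM in 𝓝 (x, v), p.1 ∈ s.dom :=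
      continuousAt_fst (s.isOpen_dom.mem_nhds hs)
    refine (holoAt_mfderiv (f := fun _ ↦ orbitProj H M)
      (hproj.contMDiffAt.comp _ contMDiffAt_snd) (hB s x v hs)).congr ?_
    filter_upwards [hdom] with p hp
    have h1 := eulerProjection_apply EH hproj (s.proj_sect _ hp) (B.bundle.frame x p.1 p.2)
    -- the two vectors lie over points that are only propositionally equal
    have h2 : ∀ y z : orbitRel.Quotient H M, y = z → ∀ v w : EX, v = w →
        (⟨y, v⟩ : TangentBundle 𝓘(ℂ, EX) (orbitRel.Quotient H M)) = ⟨z, w⟩ := by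
      rintro y _ rfl v _ rfl; rfl
    exact h2 _ _ (s.proj_sect _ hp).symm _ _ h1
  · intro g x e
    induction x using Quotient.inductionOn with | _ m
    refine (eulerProjection_apply EH hproj (x := g • orbitProj H M m) (m := g • m) rfl _).trans ?_
    rw [B.fibreVal_action g m]
    refine (mfderiv_proj_smul hproj EG g m _).trans ?_
    exact congrArg _ (eulerProjection_apply EH hproj rfl e).symm
  · intro x
    induction x using Quotient.inductionOn with | _ m
    intro s t hst
    refine fibreVal_injective (m := m) rfl (hinj m ?_)
    have := congrArg (fibreVal (tangentAction H M EM) _ m) hst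
    rwa [fibreVal_eulerInclusion rfl, fibreVal_eulerInclusion rfl] at this
  · intro x
    induction x using Quotient.inductionOn with | _ m
    have hker := ker_mfderiv_proj hproj m (hdim ⟨m⟩) (hinj m) (hquot.submersion m)
    ext t
    constructor
    · rintro ⟨s, rfl⟩
      refine (eulerProjection_apply EH hproj rfl _).trans ?_
      rw [fibreVal_eulerInclusion rfl]
      exact mfderiv_proj_fundamentalField hproj m _
    · intro ht
      have h1 : fibreVal (tangentAction H M EM) _ m t ∈
          LinearMap.ker (mfderiv 𝓘(ℂ, EM) 𝓘(ℂ, EX) (orbitProj H M) m).toLinearMap :=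
        (eulerProjection_apply EH hproj rfl t).symm.trans ht
      rw [← hker] at h1
      obtain ⟨y, hy⟩ := h1
      refine ⟨A.quotMap m y, (hi m y).trans ?_⟩
      rw [← infinitesimalAction_apply, hy]
      exact B.quotMap_fibreVal m t
  · intro x
    induction x using Quotient.inductionOn with | _ m
    intro w
    obtain ⟨v, hv⟩ := hquot.submersion m w
    exact ⟨B.quotMap m v, (hp m v).trans hv⟩

end Euler

/-! ### The adjunction formula and the canonical bundle of the quotient -/

section Canonical

open HolomorphicBundle

set_option linter.unusedSectionVars false

variable {EX EG EH EM G H M : Type*}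
  [NormedAddCommGroup EX] [NormedSpace ℂ EX] [FiniteDimensional ℂ EX]
  [NormedAddCommGroup EG] [NormedSpace ℂ EG]
  [NormedAddCommGroup EH] [NormedSpace ℂ EH] [FiniteDimensional ℂ EH]
  [NormedAddCommGroup EM] [NormedSpace ℂ EM] [FiniteDimensional ℂ EM]
  [Group G] [TopologicalSpace G] [ChartedSpace EG G] [LieGroup 𝓘(ℂ, EG) ω G]
  [Group H] [TopologicalSpace H] [ChartedSpace EH H] [LieGroup 𝓘(ℂ, EH) ω H]
  [TopologicalSpace M] [ChartedSpace EM M] [IsManifold 𝓘(ℂ, EM) ω M]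
  [MulAction G M] [ContMDiffSMul 𝓘(ℂ, EG) 𝓘(ℂ, EM) ω G M]
  [MulAction H M] [ContMDiffSMul 𝓘(ℂ, EH) 𝓘(ℂ, EM) ω H M] [SMulCommClass G H M]
  [ChartedSpace EX (orbitRel.Quotient H M)] [IsManifold 𝓘(ℂ, EX) ω (orbitRel.Quotient H M)]

theorem contMDiff_characterRep {χ : H →* ℂˣ}
    (hχ : ContMDiff 𝓘(ℂ, EH) 𝓘(ℂ, ℂ) ω fun h : H ↦ (χ h : ℂ)) (c : ℂ) :
    ContMDiff 𝓘(ℂ, EH) 𝓘(ℂ, ℂ) ω fun h : H ↦ characterRep χ h c :=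
  hχ.mul contMDiff_const

/-- The line bundle `L_χ` of a holomorphic character. -/
theorem exists_characterBundle (hfree : ∀ (h : H) (m : M), h • m = m → h = 1)
    (hproj : ContMDiff 𝓘(ℂ, EM) 𝓘(ℂ, EX) ω (orbitProj H M))
    (hsec : ∀ m : M, ∃ s : LocalSection EH EM EX H M,
      orbitProj H M m ∈ s.dom ∧ s.sect (orbitProj H M m) = m) {χ : H →* ℂˣ}
    (hχ : ContMDiff 𝓘(ℂ, EH) 𝓘(ℂ, ℂ) ω fun h : H ↦ (χ h : ℂ)) :
    ∃ L : QuotientBundle EX EG (productBundle EM M ℂ) (repAction M (1 : Representation ℂ G ℂ))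
      (repAction M (characterRep χ)), L.HoloEval EH :=
  exists_quotientBundle hfree
    (isHolomorphicAction_repAction (EK := EH) (EB := EM) (B := M) (ρ := characterRep χ)
      (contMDiff_characterRep hχ))
    (isHolomorphicAction_repAction (EK := EG) (EB := EM) (B := M)
      (ρ := (1 : Representation ℂ G ℂ)) fun _ ↦ contMDiff_const)
    (repAction_one_comm _) hproj hsec

/-- The adjunction formula: the contraction of `c η` with a basis of `𝔥` does not depend on the
choice of the point of the orbit, as the factor `χ_𝔥` in the second bundle compensates its change
under `H`. -/
theorem exists_adjunction [ProperSMul H M]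
    (hdim : Nonempty M → finrank ℂ EM = finrank ℂ EH + finrank ℂ EX)
    (hfree : ∀ (h : H) (m : M), h • m = m → h = 1)
    (hquot : IsQuotientManifold EX EG EM G H M)
    (hsec : ∀ m : M, ∃ s : LocalSection EH EM EX H M,
      orbitProj H M m ∈ s.dom ∧ s.sect (orbitProj H M m) = m) :
    ∃ (C : QuotientBundle EX EG (canonicalBundle EM M)
          (canonicalAction G M EM) (canonicalAction H M EM))
        (L : QuotientBundle EX EG (productBundle EM M ℂ)
          (repAction M (1 : Representation ℂ G ℂ))
          (repAction M (characterRep (adjointCharacter EH H))))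
        (T : LineTensorBundle C.bundle L.bundle),
      ∀ b : Basis (Fin (finrank ℂ EH)) ℂ EH,
      ∃ Φ : ∀ x, (quotientFibre (canonicalAction H M EM) x ⊗[ℂ]
          quotientFibre (repAction M (characterRep (adjointCharacter EH H))) x) ≃ₗ[ℂ]
            CanonicalFibre EX x,
        T.bundle.IsIso (canonicalBundle EX (orbitRel.Quotient H M)) Φ ∧
        IsEquivariant (tensorAction C.action L.action)
          (canonicalAction G (orbitRel.Quotient H M) EX) (fun x ↦ (Φ x).toLinearMap) ∧
        ∀ (m : M) (η : CanonicalFibre EM m) (c : ℂ),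
          IsInducedForm b m (c • η) (Φ _ (C.quotMap m η ⊗ₜ[ℂ] L.quotMap m c)) := by
  have hproj := hquot.holomorphic_proj
  have hsmul := hquot.holomorphic_smul
  have hsurj := hquot.submersion
  have hex : ∀ x : orbitRel.Quotient H M, ∃ s : LocalSection EH EM EX H M, x ∈ s.dom :=
    fun x ↦ Quotient.inductionOn x fun m ↦ (hsec m).imp fun s hs ↦ hs.1
  obtain ⟨C, hC⟩ := exists_quotientBundle (EX := EX) (EG := EG) (A := canonicalBundle EM M) hfree
    (isHolomorphicAction_canonicalAction (EK := EH) (K := H))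
    (isHolomorphicAction_canonicalAction (EK := EG) (K := G))
    (canonicalAction_comm EH EG) hproj hsec
  obtain ⟨L, hL⟩ := exists_characterBundle (G := G) (EG := EG) hfree hproj hsec
    (contMDiff_adjointCharacter (EH := EH) (H := H))
  obtain ⟨T, a, d, hT⟩ := exists_lineTensorBundle C.bundle L.bundle
    ((topFormEquiv (finBasis ℂ EM)).finrank_eq.trans (finrank_self ℂ)) (finrank_self ℂ)
  refine ⟨C, L, T, fun b ↦ ?_⟩
  choose K hK using fun m : M ↦ exists_contraction (hdim ⟨m⟩) hproj hfree hsurj b m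
  -- `Φ` is defined by the contraction at a representative of the orbit, but by `hΦ` it is given by
  -- the contraction at every point of the orbit
  let Φ : ∀ x, (quotientFibre (canonicalAction H M EM) x ⊗[ℂ]
      quotientFibre (repAction M (characterRep (adjointCharacter EH H))) x) ≃ₗ[ℂ]
        CanonicalFibre EX x := fun x ↦
    ((TensorProduct.congr (C.evalEquiv x.out_eq)
      (L.evalEquiv x.out_eq : _ ≃ₗ[ℂ] ℂ)).trans (TensorProduct.rid ℂ _)).trans (K x.out)
  have hΦ : ∀ (x : orbitRel.Quotient H M) (m : M) (_ : orbitProj H M m = x)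
      (η : quotientFibre (canonicalAction H M EM) x)
      (l : quotientFibre (repAction M (characterRep (adjointCharacter EH H))) x),
      IsInducedForm (H := H) b m ((fibreVal _ x m l : ℂ) • fibreVal _ x m η)
        (show EX [⋀^Fin (finrank ℂ EX)]→L[ℂ] ℂ from Φ x (η ⊗ₜ l)) := by
    intro x m hm η l
    obtain ⟨h, rfl⟩ := orbitProj_eq_iff.1 (hm.trans x.out_eq.symm)
    have h1 := (hK x.out ((fibreVal _ x x.out l : ℂ) • fibreVal _ x x.out η)).smul_canonicalAction
      hproj hfree hsurj h
    rw [map_smul, smul_smul] at h1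
    rw [fibreVal_smul x.out_eq, fibreVal_smul x.out_eq]
    exact h1
  refine ⟨Φ, isIso_of_isMorphism (isMorphism_of_frame fun x v ↦ ?_), ?_, ?_⟩
  · obtain ⟨s, hs⟩ := hex x
    have hfst : ContMDiffAt (𝓘(ℂ, EX).prod 𝓘(ℂ, ℂ)) 𝓘(ℂ, EX) ω
      (Prod.fst : orbitRel.Quotient H M × ℂ → _) (x, v) := contMDiffAt_fst
    have hsnd : ContMDiffAt (𝓘(ℂ, EX).prod 𝓘(ℂ, ℂ)) 𝓘(ℂ, ℂ) ω
      (Prod.snd : orbitRel.Quotient H M × ℂ → _) (x, v) := contMDiffAt_snd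
    have h1 := HoloAt.comp (g := fun p : orbitRel.Quotient H M × ℂ ↦ (p.1, p.2 • a)) (n := (x, v))
      (hC s x (v • a) hs) (hfst.prodMk (hsnd.smul contMDiffAt_const))
    have h2 := HoloAt.comp (g := fun p : orbitRel.Quotient H M × ℂ ↦ (p.1, d)) (n := (x, v))
      (hL s x d hs) (hfst.prodMk contMDiffAt_const)
    -- `h3` is the value of `c η` along the section `s`, for the local frame of the tensor product
    have h3 := h1.smul (holoAt_productBundle_iff.1 h2).2
    refine (holoAt_of_isInducedForm (b := b) hproj s (g := Prod.fst)
      (θ := fun p ↦ Φ p.1 (C.bundle.frame x p.1 (p.2 • a) ⊗ₜ L.bundle.frame x p.1 d)) hfst hs h3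
      fun p hp ↦ hΦ p.1 _ (s.proj_sect _ hp) _ _).congr ?_
    filter_upwards [hfst.continuousAt (hT x)] with p hp
    exact congrArg (fun t ↦ TotalSpace.mk p.1 (Φ p.1 t)) (hp p.2)
  · intro g x e
    induction x using Quotient.inductionOn with | _ m
    induction e using TensorProduct.induction_on with
    | zero => simp only [map_zero]
    | add e e' he he' => simp only [map_add, he, he']
    | tmul η l =>
      refine IsInducedForm.unique (b := b) (m := g • m) (hsurj _)
        (hΦ (g • orbitProj H M m) (g • m) rfl _ _) ?_
      rw [C.fibreVal_action g m, L.fibreVal_action g m]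
      have h1 := (hΦ _ m rfl η l).canonicalAction_of_commute hproj EG g
      rw [map_smul] at h1
      exact h1
  · intro m η c
    have h1 := hΦ _ m rfl (C.quotMap m η) (L.quotMap m c)
    rwa [C.fibreVal_quotMap, L.fibreVal_quotMap] at h1

/-- The canonical bundle in the presence of a semi-invariant nowhere vanishing top form `ωM`: the
form `c ωM` is contracted with a basis of `𝔥`, and the factors `χM` and `χ_𝔥` compensate the change
of `ωM` and of the basis under `H`. -/
theorem exists_canonicalIso [ProperSMul H M]
    (hdim : Nonempty M → finrank ℂ EM = finrank ℂ EH + finrank ℂ EX)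
    (hfree : ∀ (h : H) (m : M), h • m = m → h = 1)
    (hquot : IsQuotientManifold EX EG EM G H M)
    (hsec : ∀ m : M, ∃ s : LocalSection EH EM EX H M,
      orbitProj H M m ∈ s.dom ∧ s.sect (orbitProj H M m) = m)
    {ωM : ∀ m : M, CanonicalFibre EM m} {χM : H →* ℂˣ}
    (hω : (canonicalBundle EM M).HolomorphicSection ωM) (hω0 : ∀ m, ωM m ≠ 0)
    (hχ : ContMDiff 𝓘(ℂ, EH) 𝓘(ℂ, ℂ) ω (fun h : H ↦ (χM h : ℂ)))
    (hωH : ∀ (h : H) (m : M), canonicalAction H M EM h m (ωM m) = (χM h : ℂ) • ωM (h • m)) :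
    ∃ L : QuotientBundle EX EG (productBundle EM M ℂ)
        (repAction M (1 : Representation ℂ G ℂ))
        (repAction M (characterRep (χM * adjointCharacter EH H))),
      ∀ b : Basis (Fin (finrank ℂ EH)) ℂ EH,
      ∃ Ψ : ∀ x, quotientFibre
          (repAction M (characterRep (χM * adjointCharacter EH H))) x ≃ₗ[ℂ] CanonicalFibre EX x,
        L.bundle.IsIso (canonicalBundle EX (orbitRel.Quotient H M)) Ψ ∧
        (∀ (m : M) (c : ℂ), IsInducedForm b m (c • ωM m) (Ψ _ (L.quotMap m c))) ∧
        (∀ (g : G) (θ : ℂ),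
          (∀ m : M, canonicalAction G M EM g m (ωM m) = θ • ωM (g • m)) →
          ∀ x e, canonicalAction G (orbitRel.Quotient H M) EX g x (Ψ x e) =
            θ • Ψ (g • x) (L.action g x e)) := by
  have hproj := hquot.holomorphic_proj
  have hsmul := hquot.holomorphic_smul
  have hsurj := hquot.submersion
  have hex : ∀ x : orbitRel.Quotient H M, ∃ s : LocalSection EH EM EX H M, x ∈ s.dom :=
    fun x ↦ Quotient.inductionOn x fun m ↦ (hsec m).imp fun s hs ↦ hs.1
  obtain ⟨L, hL⟩ := exists_characterBundle (G := G) (EG := EG) hfree hproj hsec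
    (χ := χM * adjointCharacter EH H)
    (hχ.mul (contMDiff_adjointCharacter (EH := EH) (H := H)))
  refine ⟨L, fun b ↦ ?_⟩
  choose K hK using fun m : M ↦ exists_contraction (hdim ⟨m⟩) hproj hfree hsurj b m
  -- the fibres of the canonical bundle are lines
  have hspan : ∀ m : M, Function.Bijective (LinearMap.toSpanSingleton ℂ _ (ωM m)) := by
    intro m
    have h0 : ωM m (finBasis ℂ EM) ≠ 0 := fun h0 ↦ hω0 m
      ((topFormEquiv (finBasis ℂ EM)).injective (h0.trans (map_zero _).symm))
    refine ⟨fun c c' h ↦ ?_, fun η ↦ ⟨η (finBasis ℂ EM) / ωM m (finBasis ℂ EM), ?_⟩⟩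
    · exact smul_left_injective ℂ (hω0 m) h
    · exact (topFormEquiv (finBasis ℂ EM)).injective (div_mul_cancel₀ _ h0)
  -- again `Ψ` is defined at a representative, and by `hΨ` it is valid at every point of the orbit
  let Ψ : ∀ x, quotientFibre
      (repAction M (characterRep (χM * adjointCharacter EH H))) x ≃ₗ[ℂ] CanonicalFibre EX x :=
    fun x ↦ ((L.evalEquiv x.out_eq : _ ≃ₗ[ℂ] ℂ).trans (LinearEquiv.ofBijective _
      (hspan x.out))).trans (K x.out)
  have hΨ : ∀ (x : orbitRel.Quotient H M) (m : M) (_ : orbitProj H M m = x)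
      (l : quotientFibre (repAction M (characterRep (χM * adjointCharacter EH H))) x),
      IsInducedForm (H := H) b m ((fibreVal _ x m l : ℂ) • ωM m)
        (show EX [⋀^Fin (finrank ℂ EX)]→L[ℂ] ℂ from Ψ x l) := by
    intro x m hm l
    obtain ⟨h, rfl⟩ := orbitProj_eq_iff.1 (hm.trans x.out_eq.symm)
    have h1 := (hK x.out ((fibreVal _ x x.out l : ℂ) • ωM x.out)).smul_canonicalAction
      hproj hfree hsurj h
    rw [map_smul, hωH, smul_smul, smul_smul] at h1
    rw [fibreVal_smul x.out_eq]
    have h2 : ∀ c : ℂ, (adjointCharacter EH H h : ℂ) * c * (χM h : ℂ) =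
        characterRep (χM * adjointCharacter EH H) h c := fun c ↦ by
      change _ = ((χM h : ℂ) * (adjointCharacter EH H h : ℂ)) * c
      ring
    rw [h2] at h1
    exact h1
  refine ⟨Ψ, isIso_of_isMorphism (isMorphism_of_frame fun x v ↦ ?_), ?_, ?_⟩
  · obtain ⟨s, hs⟩ := hex x
    have hfst : ContMDiffAt (𝓘(ℂ, EX).prod 𝓘(ℂ, ℂ)) 𝓘(ℂ, EX) ω
      (Prod.fst : orbitRel.Quotient H M × ℂ → _) (x, v) := contMDiffAt_fst
    obtain ⟨h1, h2⟩ := holoAt_productBundle_iff.1 (hL s x v hs)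
    exact holoAt_of_isInducedForm (b := b) hproj s (g := Prod.fst) hfst hs
      ((HolomorphicSection.holoAt hω h1).smul h2) fun p hp ↦ hΨ p.1 _ (s.proj_sect _ hp) _
  · intro m c
    have h1 := hΨ _ m rfl (L.quotMap m c)
    rwa [L.fibreVal_quotMap] at h1
  · intro g θ hg x e
    induction x using Quotient.inductionOn with | _ m
    have h1 := (hΨ _ m rfl e).canonicalAction_of_commute hproj EG g
    have h2 := (hΨ (g • orbitProj H M m) (g • m) rfl (L.action g (orbitProj H M m) e)).smul θ
    rw [map_smul, hg, smul_comm] at h1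
    rw [L.fibreVal_action g m] at h2
    exact IsInducedForm.unique (b := b) (m := g • m) (hsurj _) h1 h2

end Canonical

end

theorem theorem2p9
    {EG EH EM G H M : Type*}
    [NormedAddCommGroup EG] [NormedSpace ℂ EG] [FiniteDimensional ℂ EG]
    [NormedAddCommGroup EH] [NormedSpace ℂ EH] [FiniteDimensional ℂ EH]
    [NormedAddCommGroup EM] [NormedSpace ℂ EM] [FiniteDimensional ℂ EM]
    -- `G` and `H` are complex Lie groups, `M` is a complex manifold
    [Group G] [TopologicalSpace G] [ChartedSpace EG G] [LieGroup 𝓘(ℂ, EG) ω G]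
    [Group H] [TopologicalSpace H] [ChartedSpace EH H] [LieGroup 𝓘(ℂ, EH) ω H]
    [TopologicalSpace M] [T2Space M] [ChartedSpace EM M] [IsManifold 𝓘(ℂ, EM) ω M]
    -- commuting holomorphic actions; `h • m` is `m h⁻¹` in terms of the right action of `H`
    [MulAction G M] [ContMDiffSMul 𝓘(ℂ, EG) 𝓘(ℂ, EM) ω G M]
    [MulAction H M] [ContMDiffSMul 𝓘(ℂ, EH) 𝓘(ℂ, EM) ω H M]
    [SMulCommClass G H M]
    -- the action of `H` is proper and free
    [ProperSMul H M] (hfree : ∀ (h : H) (m : M), h • m = m → h = 1) :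
    ∃ (_ : ChartedSpace (QuotientModel EM EH) (orbitRel.Quotient H M))
      (_ : IsManifold 𝓘(ℂ, QuotientModel EM EH) ω (orbitRel.Quotient H M)),
      IsQuotientManifold (QuotientModel EM EH) EG EM G H M ∧
      -- the generalized Euler sequence `M ×_H 𝔥 → TM/H → TX`
      (∃ (A : QuotientBundle (QuotientModel EM EH) EG (productBundle EM M EH)
            (repAction M (1 : Representation ℂ G EH)) (repAction M (adjointRep EH H)))
          (B : QuotientBundle (QuotientModel EM EH) EG (tangentBundle EM M)
            (tangentAction G M EM) (tangentAction H M EM))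
          (i : ∀ x, quotientFibre (repAction M (adjointRep EH H)) x →ₗ[ℂ]
            quotientFibre (tangentAction H M EM) x)
          (p : ∀ x, quotientFibre (tangentAction H M EM) x →ₗ[ℂ]
            TangentSpace 𝓘(ℂ, QuotientModel EM EH) x),
        A.bundle.IsMorphism B.bundle i ∧ IsEquivariant A.action B.action i ∧
        B.bundle.IsMorphism (tangentBundle (QuotientModel EM EH) (orbitRel.Quotient H M)) p ∧
        IsEquivariant B.action
          (tangentAction G (orbitRel.Quotient H M) (QuotientModel EM EH)) p ∧
        (∀ x, Function.Injective (i x)) ∧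
        (∀ x, LinearMap.range (i x) = LinearMap.ker (p x)) ∧
        (∀ x, Function.Surjective (p x)) ∧
        (∀ (m : M) (y : EH), i _ (A.quotMap m y) = B.quotMap m (fundamentalField EH EM H y m)) ∧
        (∀ (m : M) (v : TangentSpace 𝓘(ℂ, EM) m), p _ (B.quotMap m v) =
          mfderiv 𝓘(ℂ, EM) 𝓘(ℂ, QuotientModel EM EH) (orbitProj H M) m v)) ∧
      -- `χ_𝔥` is a holomorphic character
      ContMDiff 𝓘(ℂ, EH) 𝓘(ℂ, ℂ) ω (fun h : H ↦ (adjointCharacter EH H h : ℂ)) ∧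
      -- the adjunction formula `K_X ≅ K_M/H ⊗ L_{χ_𝔥}`
      (∃ (C : QuotientBundle (QuotientModel EM EH) EG (canonicalBundle EM M)
            (canonicalAction G M EM) (canonicalAction H M EM))
          (L : QuotientBundle (QuotientModel EM EH) EG (productBundle EM M ℂ)
            (repAction M (1 : Representation ℂ G ℂ))
            (repAction M (characterRep (adjointCharacter EH H))))
          (T : LineTensorBundle C.bundle L.bundle),
        ∀ b : Basis (Fin (finrank ℂ EH)) ℂ EH,
        ∃ Φ : ∀ x, (quotientFibre (canonicalAction H M EM) x ⊗[ℂ]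
            quotientFibre (repAction M (characterRep (adjointCharacter EH H))) x) ≃ₗ[ℂ]
              CanonicalFibre (QuotientModel EM EH) x,
          T.bundle.IsIso
            (canonicalBundle (QuotientModel EM EH) (orbitRel.Quotient H M)) Φ ∧
          IsEquivariant (tensorAction C.action L.action)
            (canonicalAction G (orbitRel.Quotient H M) (QuotientModel EM EH))
            (fun x ↦ (Φ x).toLinearMap) ∧
          ∀ (m : M) (η : CanonicalFibre EM m) (c : ℂ),
            IsInducedForm b m (c • η) (Φ _ (C.quotMap m η ⊗ₜ[ℂ] L.quotMap m c))) ∧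
      -- the isomorphism `K_X ≅ L_{χ_M χ_𝔥}` for a nowhere vanishing form `ω_M` of character `χ_M`
      (∀ (ωM : ∀ m : M, CanonicalFibre EM m) (χM : H →* ℂˣ),
        (canonicalBundle EM M).HolomorphicSection ωM → (∀ m, ωM m ≠ 0) →
        ContMDiff 𝓘(ℂ, EH) 𝓘(ℂ, ℂ) ω (fun h : H ↦ (χM h : ℂ)) →
        (∀ (h : H) (m : M), canonicalAction H M EM h m (ωM m) = (χM h : ℂ) • ωM (h • m)) →
        ∃ L : QuotientBundle (QuotientModel EM EH) EG (productBundle EM M ℂ)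
            (repAction M (1 : Representation ℂ G ℂ))
            (repAction M (characterRep (χM * adjointCharacter EH H))),
          ∀ b : Basis (Fin (finrank ℂ EH)) ℂ EH,
          ∃ Ψ : ∀ x, quotientFibre
              (repAction M (characterRep (χM * adjointCharacter EH H))) x ≃ₗ[ℂ]
                CanonicalFibre (QuotientModel EM EH) x,
            L.bundle.IsIso
              (canonicalBundle (QuotientModel EM EH) (orbitRel.Quotient H M)) Ψ ∧
            (∀ (m : M) (c : ℂ), IsInducedForm b m (c • ωM m) (Ψ _ (L.quotMap m c))) ∧
            -- equivariance for the elements of `G` that scale `ω_M`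
            (∀ (g : G) (θ : ℂ),
              (∀ m : M, canonicalAction G M EM g m (ωM m) = θ • ωM (g • m)) →
              ∀ x e, canonicalAction G (orbitRel.Quotient H M) (QuotientModel EM EH) g x (Ψ x e) =
                θ • Ψ (g • x) (L.action g x e))) := by
  have hX : finrank ℂ (QuotientModel EM EH) = finrank ℂ EM - finrank ℂ EH :=
    finrank_euclideanSpace_fin
  obtain ⟨cs, man, hproj, hsec⟩ := exists_complexStructure (EX := QuotientModel EM EH) hX hfree
  have hquot := isQuotientManifold (EG := EG) (G := G) hproj hsec
  have hcomplete : CompleteSpace EH := FiniteDimensional.complete ℂ EH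
  -- a free action needs `dim H ≤ dim M`, so the truncated difference `hX` is a true one
  have hdim : Nonempty M → finrank ℂ EM = finrank ℂ EH + finrank ℂ (QuotientModel EM EH) := by
    rintro ⟨m⟩
    let ξ : EH →ₗ[ℂ] EM := infinitesimalAction EH EM H m
    have hle := LinearMap.finrank_le_finrank_of_injective (f := ξ)
      ((injective_iff_map_eq_zero _).2 fun y hy ↦ injective_fundamentalField hfree m hy)
    omega
  exact ⟨cs, man, hquot, exists_eulerSequence hdim hfree hquot hsec, contMDiff_adjointCharacter,
    exists_adjunction hdim hfree hquot hsec, fun _ _ hω hω0 hχ hωH ↦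
      exists_canonicalIso hdim hfree hquot hsec hω hω0 hχ hωH⟩
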